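/- **Setting.** Let $q=e^{\hbar}$ with $0<|q|<1$. Consider the 2-periodic lattice with points $m^{\pm}$, $m\in\mathbb Z/2$ (so $2^\pm=0^\pm$), and complex numbers $c^{m\pm}$. At $m^\pm$ let $E_i=-(q-q^{-1})e^{\pm\alpha_i}$ ($i=0,1$) act by multiplication, let $h_i$ be the operator with $[h_i,e^{\pm\alpha_j}]=\pm\alpha_j(h_i)e^{\pm\alpha_j}$ (type $A_1^{(1)}$: $\alpha_j(h_i)=2$ if $i=j$ and $-2$ otherwise; $h_1\cdot 1=0$) and $h_0+h_1=c^{m\pm}$, put $k_i=q^{h_i}$, $\Delta^{m\pm}=E_0E_1$, and let $d$ be the derivation with $[d,e^{\pm\alpha_0}]=\pm e^{\pm\alpha_0}$, $[d,e^{\pm\alpha_1}]=0$, $d\cdot 1=0$. All operators act on formal series in rational powers of the variables $e^{\pm\alpha_i}$ of all lattice points. Put $$R^{m^+n^-}=(qE_1^{m+}E_1^{n-};q^2)_\infty^{-1}\,(q^2\Delta^{m+}\Delta^{n-};q^4)_\infty^{-1}\,(qE_0^{m+}E_0^{n-};q^2)_\infty^{-1}\,q^{-\frac12 h_1^{m+}h_1^{n-}-c^{m+}d^{n-}-d^{m+}c^{n-}},$$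 $(x;Q)_\infty=\prod_{n\ge0}(1-xQ^n)$, $\mathcal H=\mathcal H_0\mathcal H_1$ with $\mathcal H_0=R^{1^+1^-}R^{2^+2^-}$, $\mathcal H_1=R^{2^+1^-}R^{1^+0^-}$, and $\mathcal T(O)=\mathcal H^{-1}O\,\mathcal H$. Let $$w_i^{mn}=\begin{cases}E_i^{m+}E_i^{n-}& m\equiv n \bmod 2,\\ E_i^{m+}(k_i^{m+})^{-1}\,k_i^{n-}E_i^{n-}&\text{otherwise,}\end{cases}\qquad \Delta^{mn}=w_0^{mn}w_1^{mn}.$$ Define, all roots being taken inside the one-parameter groups of Weyl-ordered monomials (with $(q-q^{-1})^{\pm1}$ as fourth root of $(q-q^{-1})^{\pm4}$), $$-qF=\sqrt[4]{\frac{w_0^{11}w_0^{22}}{w_1^{22}w_1^{11}}},\quad -qG=\sqrt[4]{\frac{w_0^{10}w_0^{21}}{w_1^{21}w_1^{10}}},$$ $$a_0^4=\frac{w_0^{21}}{w_0^{10}},\ a_1^4=\frac{w_1^{21}}{w_1^{10}},\ a_2^4=\frac1{\Delta^{21}},\ a_3^4=\Delta^{11},\ a_4^4=\frac{w_1^{22}}{w_1^{11}},\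 a_5^4=\frac{w_0^{22}}{w_0^{11}},$$ $p=a_0a_1a_2^2a_3^2a_4a_5$ and $t=a_3^2a_4a_5$; put $c=c^{0-}+c^{1-}-c^{0+}-c^{1+}$. **Theorem 2.** (1) $F$, $G$, $a_j$ are indeed such fourth roots. The $a_j$ commute with all $w_i^{mn}$, with each other and with $F$, $G$; $FG=q^2GF$; $p=q^{-c/4}$ is a scalar; $t^4=\Delta^{00}\Delta^{11}$ and $\mathcal T(t^4)=q^{2c}t^4$. (2) $\mathcal T(a_j)=a_j$ for $j=0,1,4,5$, $\mathcal T(p)=p$, $\mathcal T(t)=p^{-2}t$; $F$, $G$ and all denominators below are invertible, and $$\mathcal T(F)=\frac{p^2}{q^2t^2}\cdot\frac{G+p^{-1}a_1^{-2}t}{G+pa_0^{-2}t^{-1}}\cdot\frac{G+p^{-1}a_1^{2}t}{G+pa_0^{2}t^{-1}}\,F^{-1},\qquad \mathcal T^{-1}(G)=\frac{1}{q^2t^2}\,G^{-1}\cdot\frac{F+a_4^{2}t}{F+a_5^{2}t^{-1}}\cdot\frac{F+a_4^{-2}t}{F+a_5^{-2}t^{-1}}.$$ (3) This is the system defined by the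 affine Weyl group of type $D_5^{(1)}$ (with $a_0,a_1$ joined to $a_2$; $a_2$ to $a_3$; $a_4,a_5$ to $a_3$). Let $K=\mathbb C(a_0,\dots,a_5)\langle F,G\rangle$, $a_j$ central, $FG=q^2GF$, with $s_i(a_j)=a_i^{-C_{ij}}a_j$ ($C$ the Cartan matrix), $s_2(F)=F\frac{a_0a_1^{-1}G+a_2^2}{a_0a_1^{-1}a_2^2G+1}$, $s_3(G)=\frac{a_3^2a_4a_5^{-1}F+1}{a_4a_5^{-1}F+a_3^2}G$, $s_j(F)=F$ for $j\ne2$, $s_j(G)=G$ for $j\neq3$, and $\sigma:a_0\leftrightarrow a_1,\ a_4\leftrightarrow a_5,\ a_2\mapsto a_2,\ a_3\mapsto a_3,\ F\mapsto q^{-2}F^{-1},\ G\mapsto q^{-2}G^{-1}$, and let $T_3=s_2s_1s_0s_2s_3s_4s_5s_3\sigma$. Then the values of $\mathcal T^{\pm1}$ on $a_0,\dots,a_5,F,G$ are the expressions $T_3^{\pm1}(a_j)$, $T_3^{\pm1}(F)$, $T_3^{\pm1}(G)$ evaluated at the lattice variables. Moreover, in any skew field containing $\mathbb C$ centrally, with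 elements $a_j\neq0$ (commuting with each other and with $F$, $G$) and $F,G\ne0$ with $FG=q^2GF$, and with automorphisms $s_j,\sigma$ over $\mathbb C$ acting on these elements by these formulas, $T_3$ satisfies the relations and equations of (2). -/

import Mathlib

noncomputable section

namespace QLattice

/-! ### The operators on one period of the lattice

Lattice points are pairs `(s, m)`: the sign `s` (`true` is `+`, `false` is `-`) and the position
`m : ZMod 2`.  Indexing positions by `ZMod 2` is the 2-periodic reduction. -/

/-- Parameters: `q = exp ħ` with `|q| < 1`, and the value `c s m` of the canonical central element
at the lattice point `m^s`. -/
structure Params where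
  ħ : ℂ
  re_neg : ħ.re < 0
  c : Bool → ZMod 2 → ℂ

/-- `(s, m, i)` labels the variable `e^{α_i}` (for `s = +`) or `e^{-α_i}` (for `s = -`) at the
lattice point `m^s`. -/
abbrev Var : Type := Bool × ZMod 2 × Fin 2

/-- Exponents; rational ones are admitted because fourth roots of monomials are needed. -/
abbrev Expo : Type := Var → ℚ

/-- The completed space of states: formal series in rational powers of the variables, with
(partially) well-ordered support. -/
abbrev Space : Type := HahnSeries Expo ℂ

abbrev Op : Type := Module.End ℂ Space

/-- The diagonal operator `x^β ↦ χ β • x^β`. -/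
def diag (χ : Expo → ℂ) : Op where
  toFun f :=
    { coeff := fun β => χ β * f.coeff β
      isPWO_support' := f.isPWO_support.mono fun β hβ => by
        simp only [Function.mem_support] at hβ
        exact HahnSeries.mem_support f β |>.2 (right_ne_zero_of_mul hβ) }
  map_add' f g := by ext β; simp [mul_add]
  map_smul' z f := by ext β; simp; ring

/-- Multiplication by an invertible series. -/
def mulU (f : Spaceˣ) : Opˣ := Units.map (Algebra.lmul ℂ Space).toRingHom.toMonoidHom f

/-- Multiplication by a nonzero scalar. -/
def scal (z : ℂˣ) : Opˣ := Units.map (algebraMap ℂ Op).toMonoidHom z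

/-- Multiplication by the monomial `x^γ`. -/
def monom (γ : Expo) : Opˣ :=
  mulU
    { val := HahnSeries.single γ 1
      inv := HahnSeries.single (-γ) 1
      val_inv := by simp [HahnSeries.single_mul_single]
      inv_val := by simp [HahnSeries.single_mul_single] }

/-! ### Infinite products -/

/-- `(x, Q)_∞ = ∏_{n ≥ 0} (1 - x Q^n)` as a formal power series in `x`: the coefficientwise limit
of the finite products. -/
def qPoch (Q : ℂ) : PowerSeries ℂ :=
  PowerSeries.mk fun k => Filter.limUnder Filter.atTop fun N : ℕ =>
    PowerSeries.coeff k
      (∏ n ∈ Finset.range N, (1 - PowerSeries.C (Q ^ n) * PowerSeries.X : PowerSeries ℂ))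

theorem constantCoeff_qPoch (Q : ℂ) : PowerSeries.constantCoeff (qPoch Q) = 1 := by
  rw [← PowerSeries.coeff_zero_eq_constantCoeff_apply, qPoch, PowerSeries.coeff_mk]
  refine Filter.Tendsto.limUnder_eq ?_
  simp [map_prod]

theorem isUnit_qPoch (Q : ℂ) : IsUnit (qPoch Q) := by
  rw [PowerSeries.isUnit_iff_constantCoeff, constantCoeff_qPoch]
  exact isUnit_one

/-- Substitution `X ↦ x^γ` for a positive exponent `γ`. -/
def substMonom (γ : Expo) (hγ : 0 < γ) : PowerSeries ℂ →+* Space :=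
  (HahnSeries.embDomainRingHom (multiplesHom Expo γ)
    (fun m n h => by
      obtain ⟨v, hv⟩ := (Pi.lt_def.1 hγ).2
      have h' := congrFun h v
      simp only [multiplesHom_apply, Pi.smul_apply, nsmul_eq_mul] at h'
      exact_mod_cast mul_right_cancel₀ hv.ne' h')
    (fun m n => by
      obtain ⟨hle, v, hv⟩ := Pi.lt_def.1 hγ
      constructor
      · intro h
        have h' := h v
        simp only [multiplesHom_apply, Pi.smul_apply, nsmul_eq_mul] at h'
        exact_mod_cast le_of_mul_le_mul_right h' hv
      · intro h
        exact nsmul_le_nsmul_left hle h)).comp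
    HahnSeries.toPowerSeries.symm.toRingHom

/-- Multiplication by `(κ x^γ, Q)_∞`. -/
def dilog (Q κ : ℂ) (γ : Expo) (hγ : 0 < γ) : Opˣ :=
  mulU (Units.map
    ((substMonom γ hγ).comp (PowerSeries.rescale κ)).toMonoidHom (isUnit_qPoch Q).unit)

/-! ### Weyl-ordered exponentials -/

/-- `(γ, l, κ)` stands for (the logarithm of `x^γ`) `+ ħ (l + κ)`, where `l + κ` is the diagonal
operator with eigenvalue `l β + κ` on `x^β`. -/
abbrev LogMonom : Type := Expo × (Expo →ₗ[ℚ] ℂ) × ℂ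

end QLattice

namespace QLattice.Params

open QLattice

variable (P : Params)

def q : ℂ := Complex.exp P.ħ

/-- The number `q^r`, with `q = exp ħ`. -/
def qpow (r : ℂ) : ℂˣ := Units.mk0 (Complex.exp (P.ħ * r)) (Complex.exp_ne_zero _)

theorem q_sub_inv_ne_zero : P.q - P.q⁻¹ ≠ 0 := by
  intro h
  have h0 : P.q ≠ 0 := Complex.exp_ne_zero _
  have h1 : P.q * P.q = 1 := by
    have := sub_eq_zero.1 h
    field_simp at this
    rw [← sq]; exact this
  have h2 : ‖P.q‖ < 1 := by
    rw [q, Complex.norm_exp]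
    exact Real.exp_lt_one_iff.2 P.re_neg
  have h3 : ‖P.q‖ * ‖P.q‖ = 1 := by rw [← norm_mul, h1, norm_one]
  nlinarith [norm_nonneg P.q]

/-- `q - q⁻¹` -/
def qq : ℂˣ := Units.mk0 (P.q - P.q⁻¹) P.q_sub_inv_ne_zero

/-- The operator `q^l : x^β ↦ q^{l β} x^β`. -/
def qdiag (l : Expo → ℂ) : Opˣ where
  val := diag fun β => Complex.exp (P.ħ * l β)
  inv := diag fun β => Complex.exp (-(P.ħ * l β))
  val_inv := by
    ext f β
    simp [diag, ← mul_assoc, ← Complex.exp_add]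
  inv_val := by
    ext f β
    simp [diag, ← mul_assoc, ← Complex.exp_add]

/-- The exponential of `X = (γ, l, κ)`, symmetrically ordered:
`x^β ↦ q^{l (β + γ/2) + κ} x^{β + γ}`.  It satisfies `wexp (n • X) = (wexp X) ^ n`. -/
def wexp (X : LogMonom) : Opˣ :=
  monom ((1 / 2 : ℚ) • X.1) * P.qdiag (fun β => X.2.1 β + X.2.2) * monom ((1 / 2 : ℚ) • X.1)

/-! ### The representation of `U_q^±` at each lattice point -/

/-- `+1` or `-1` -/
def sgn (s : Bool) : ℚ := if s then 1 else -1

/-- The Cartan matrix of type `A_1^{(1)}`. -/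
def cartanA (i j : Fin 2) : ℚ := if i = j then 2 else -2

/-- The derivation `e^{±α_j} ↦ ± α_j(h_i) e^{±α_j}` at the point `m^s`. -/
def hder (s : Bool) (m : ZMod 2) (i : Fin 2) : Expo →ₗ[ℚ] ℂ :=
  Algebra.linearMap ℚ ℂ ∘ₗ
    ∑ j : Fin 2, (sgn s * cartanA i j) • (LinearMap.proj (s, m, j) : Expo →ₗ[ℚ] ℚ)

/-- The vacuum eigenvalue of `h_i`: since `h_0 + h_1` acts as the scalar `c`, it is `c` for
`h_0` and `0` for `h_1`. -/
def hvac (s : Bool) (m : ZMod 2) (i : Fin 2) : ℂ := if i = 0 then P.c s m else 0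

/-- Eigenvalue of `h_i` at the point `m^s` on the monomial `x^β`. -/
def h (s : Bool) (m : ZMod 2) (i : Fin 2) (β : Expo) : ℂ := hder s m i β + P.hvac s m i

/-- Eigenvalue of the scaling element: `[d, e^{±α_0}] = ± e^{±α_0}`, `[d, e^{±α_1}] = 0`. -/
def d (s : Bool) (m : ZMod 2) (β : Expo) : ℂ := ((sgn s * β (s, m, 0) : ℚ) : ℂ)

/-- Exponent of the variable `e^{±α_i}` at the point `m^s`. -/
def ex (s : Bool) (m : ZMod 2) (i : Fin 2) : Expo := Pi.single (s, m, i) 1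

/-- `E_i^± = -(q - q⁻¹) e^{±α_i}` at the point `m^s`. -/
def E (s : Bool) (m : ZMod 2) (i : Fin 2) : Opˣ := scal (-P.qq) * monom (ex s m i)

/-- `k_i = q^{h_i}` at the point `m^s`. -/
def k (s : Bool) (m : ZMod 2) (i : Fin 2) : Opˣ := P.qdiag (P.h s m i)

/-! ### The R matrix and the dynamics -/

/-- Exponent of `E_i^+ ⊗ E_i^-` on the points `m^+`, `n^-`. -/
def pair (m n : ZMod 2) (i : Fin 2) : Expo := ex true m i + ex false n i

theorem pair_pos (m n : ZMod 2) (i : Fin 2) : 0 < pair m n i :=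
  add_pos (Pi.single_pos.2 one_pos) (Pi.single_pos.2 one_pos)

/-- `T = ½ h_1 ⊗ h_1 + c^+ ⊗ d + d ⊗ c^-` on the points `m^+`, `n^-`. -/
def tT (m n : ZMod 2) (β : Expo) : ℂ :=
  1 / 2 * P.h true m 1 β * P.h false n 1 β + P.c true m * d false n β + d true m β * P.c false n

/-- `R^{m^+ n^-} = (q E_1^+⊗E_1^-, q²)_∞⁻¹ (q² Δ^+⊗Δ^-, q⁴)_∞⁻¹ (q E_0^+⊗E_0^-, q²)_∞⁻¹ q^{-T}`,
where `Δ^± = E_0^± E_1^±`. -/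
def R (m n : ZMod 2) : Opˣ :=
  (dilog (P.q ^ 2) (P.q * (P.q - P.q⁻¹) ^ 2) (pair m n 1) (pair_pos m n 1))⁻¹ *
  (dilog (P.q ^ 4) (P.q ^ 2 * (P.q - P.q⁻¹) ^ 4) (pair m n 0 + pair m n 1)
    (add_pos (pair_pos m n 0) (pair_pos m n 1)))⁻¹ *
  (dilog (P.q ^ 2) (P.q * (P.q - P.q⁻¹) ^ 2) (pair m n 0) (pair_pos m n 0))⁻¹ *
  (P.qdiag (P.tT m n))⁻¹

/-- `𝓗₀ = R^{1^+1^-} R^{2^+2^-}` -/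
def H0 : Opˣ := P.R 1 1 * P.R 0 0

/-- `𝓗₁ = R^{2^+1^-} R^{3^+2^-}` -/
def H1 : Opˣ := P.R 0 1 * P.R 1 0

/-- `𝓗 = 𝓗₀ 𝓗₁` -/
def H : Opˣ := P.H0 * P.H1

/-- The time evolution `𝓣 : O ↦ 𝓗⁻¹ O 𝓗`. -/
def T : Op ≃ₐ[ℂ] Op where
  toFun O := ↑(P.H⁻¹) * O * ↑P.H
  invFun O := ↑P.H * O * ↑(P.H⁻¹)
  left_inv O := by simp [mul_assoc]
  right_inv O := by simp [mul_assoc]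
  map_mul' O O' := by simp [mul_assoc]
  map_add' O O' := by simp [mul_add, add_mul]
  commutes' z := by
    rw [← Algebra.commutes z (↑(P.H⁻¹) : Op), mul_assoc, Units.inv_mul, mul_one]

/-! ### The lattice variables -/

/-- `w_i(m^+ n^-)`: it is `E_i^+ ⊗ E_i^-` for `m ≡ n` and `E_i^+ k_i⁻¹ ⊗ k_i E_i^-` otherwise. -/
def w (i : Fin 2) (m n : ZMod 2) : Opˣ :=
  if m = n then P.E true m i * P.E false n i
  else (P.E true m i * (P.k true m i)⁻¹) * (P.k false n i * P.E false n i)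

/-- `Δ(m^+ n^-) = w_0(m^+ n^-) w_1(m^+ n^-)`.  For `m ≡ n` this is `Δ^{m+} ⊗ Δ^{n-}`, otherwise
it is `q^{c^{n-} - c^{m+}} Δ^{m+} ⊗ Δ^{n-}`. -/
def Del (m n : ZMod 2) : Opˣ := P.w 0 m n * P.w 1 m n

/-- The logarithm of `w_i(m^+ n^-)`: one has `w_i(m^+ n^-) = (q - q⁻¹)² wexp (lw i m n)`. -/
def lw (i : Fin 2) (m n : ZMod 2) : LogMonom :=
  if m = n then (pair m n i, 0, 0)
  else (pair m n i, hder false n i - hder true m i, P.hvac false n i - P.hvac true m i)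

/-- The fourth roots `a_j`, taken inside the one-parameter groups of monomials. -/
def a : Fin 6 → Opˣ :=
  ![P.wexp ((1 / 4 : ℚ) • (P.lw 0 0 1 - P.lw 0 1 0)),
    P.wexp ((1 / 4 : ℚ) • (P.lw 1 0 1 - P.lw 1 1 0)),
    scal P.qq⁻¹ * P.wexp (-(1 / 4 : ℚ) • (P.lw 0 0 1 + P.lw 1 0 1)),
    scal P.qq * P.wexp ((1 / 4 : ℚ) • (P.lw 0 1 1 + P.lw 1 1 1)),
    P.wexp ((1 / 4 : ℚ) • (P.lw 1 0 0 - P.lw 1 1 1)),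
    P.wexp ((1 / 4 : ℚ) • (P.lw 0 0 0 - P.lw 0 1 1))]

/-- `-q F` is the fourth root of `w_0^{11} w_0^{22} / (w_1^{22} w_1^{11})`. -/
def F : Opˣ :=
  scal (-(P.qpow 1)⁻¹) *
    P.wexp ((1 / 4 : ℚ) • (P.lw 0 1 1 + P.lw 0 0 0 - P.lw 1 0 0 - P.lw 1 1 1))

/-- `-q G` is the fourth root of `w_0^{10} w_0^{21} / (w_1^{21} w_1^{10})`. -/
def G : Opˣ :=
  scal (-(P.qpow 1)⁻¹) *
    P.wexp ((1 / 4 : ℚ) • (P.lw 0 1 0 + P.lw 0 0 1 - P.lw 1 0 1 - P.lw 1 1 0))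

end QLattice.Params

/-! ### The Weyl group side -/

namespace QWeyl

/-- Values for the generators `a_0, …, a_5, F, G` of `K = ℂ(a_0, …, a_5)⟨F, G⟩` in a ring. -/
@[ext]
structure Pt (D : Type*) [Ring D] where
  a : Fin 6 → Dˣ
  F : D
  G : D

/-- The Cartan matrix of type `D_5^{(1)}`. -/
def cartan : Matrix (Fin 6) (Fin 6) ℤ :=
  !![ 2,  0, -1,  0,  0,  0;
      0,  2, -1,  0,  0,  0;
     -1, -1,  2, -1,  0,  0;
      0,  0, -1,  2, -1, -1;
      0,  0,  0, -1,  2,  0;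
      0,  0,  0, -1,  0,  2]

namespace Pt

variable {D : Type*} [Ring D] [Algebra ℂ D]

open scoped Ring

/-- `p = a_0 a_1 a_2² a_3² a_4 a_5` -/
def p (x : Pt D) : Dˣ := x.a 0 * x.a 1 * x.a 2 ^ 2 * x.a 3 ^ 2 * x.a 4 * x.a 5

/-- `t = a_3² a_4 a_5` -/
def t (x : Pt D) : Dˣ := x.a 3 ^ 2 * x.a 4 * x.a 5

/-- The images of all generators under a ring automorphism. -/
def map (φ : D ≃ₐ[ℂ] D) (x : Pt D) : Pt D :=
  ⟨fun j => Units.map (φ : D →* D) (x.a j), φ x.F, φ x.G⟩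

/-- The images of the generators under the simple reflection `s_i`:
`s_i(a_j) = a_i^{-C_{ij}} a_j`,
`s_2(F) = F (a_0 a_1⁻¹ G + a_2²) / (a_0 a_1⁻¹ a_2² G + 1)`,
`s_3(G) = (a_3² a_4 a_5⁻¹ F + 1) / (a_4 a_5⁻¹ F + a_3²) G`. -/
def s (i : Fin 6) (x : Pt D) : Pt D where
  a j := x.a i ^ (-cartan i j) * x.a j
  F := if i = 2 then
      x.F * (↑(x.a 0 * (x.a 1)⁻¹) * x.G + ↑(x.a 2 ^ 2)) *
        (↑(x.a 0 * (x.a 1)⁻¹ * x.a 2 ^ 2) * x.G + 1)⁻¹ʳ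
    else x.F
  G := if i = 3 then
      (↑(x.a 3 ^ 2 * x.a 4 * (x.a 5)⁻¹) * x.F + 1) *
        (↑(x.a 4 * (x.a 5)⁻¹) * x.F + ↑(x.a 3 ^ 2))⁻¹ʳ * x.G
    else x.G

/-- The images of the generators under the diagram automorphism `σ = σ_{01} σ_{45}`:
`a_0 ↔ a_1`, `a_4 ↔ a_5`, `F ↦ q⁻² F⁻¹`, `G ↦ q⁻² G⁻¹`. -/
def σ (q : ℂ) (x : Pt D) : Pt D where
  a := ![x.a 1, x.a 0, x.a 2, x.a 3, x.a 5, x.a 4]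
  F := (q ^ 2)⁻¹ • x.F⁻¹ʳ
  G := (q ^ 2)⁻¹ • x.G⁻¹ʳ

/-- The images of the generators under `T_3 = s_2 s_1 s_0 s_2 s_3 s_4 s_5 s_3 σ`.  The image of a
generator under a product `φ ψ` of automorphisms is `φ(ψ(·))`, that is, the formula for `ψ` with
every generator in it replaced by its image under `φ`; so the leftmost factor is substituted
first. -/
def T3 (q : ℂ) (x : Pt D) : Pt D :=
  σ q (s 3 (s 5 (s 4 (s 3 (s 2 (s 0 (s 1 (s 2 x))))))))

/-- The images of the generators under `T_3⁻¹ = σ s_3 s_5 s_4 s_3 s_2 s_0 s_1 s_2`. -/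
def T3inv (q : ℂ) (x : Pt D) : Pt D :=
  s 2 (s 1 (s 0 (s 2 (s 3 (s 4 (s 5 (s 3 (σ q x))))))))

end Pt

open scoped Ring

/-- The commutation relations of `K`: the `a_j` are central, `F G = q² G F`. -/
structure Relations {D : Type*} [Ring D] [Algebra ℂ D] (q : ℂ) (x : Pt D) : Prop where
  aa : ∀ i j, Commute (x.a i) (x.a j)
  aF : ∀ i, Commute (x.a i : D) x.F
  aG : ∀ i, Commute (x.a i : D) x.G
  FG : x.F * x.G = q ^ 2 • (x.G * x.F)

/-- The quantized discrete Painlevé VI system for the automorphism `T` and the variables `x`. -/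
structure IsQPVI {D : Type*} [Ring D] [Algebra ℂ D] (q : ℂ) (T : D ≃ₐ[ℂ] D) (x : Pt D) :
    Prop where
  /-- the constants and the time -/
  T_a : ∀ j : Fin 6, j ≠ 2 → j ≠ 3 → T (x.a j) = x.a j
  T_p : T x.p = x.p
  T_t : T x.t = ↑(x.p⁻¹ ^ 2 * x.t)
  /-- the denominators (and `F`, `G`) are invertible -/
  unit_F : IsUnit x.F
  unit_G : IsUnit x.G
  unit_G₁ : IsUnit (x.G + ↑(x.p * x.a 0 ^ (-2 : ℤ) * x.t⁻¹))
  unit_G₂ : IsUnit (x.G + ↑(x.p * x.a 0 ^ (2 : ℤ) * x.t⁻¹))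
  unit_F₁ : IsUnit (x.F + ↑(x.a 5 ^ (2 : ℤ) * x.t⁻¹))
  unit_F₂ : IsUnit (x.F + ↑(x.a 5 ^ (-2 : ℤ) * x.t⁻¹))
  /-- the equation for `T(F)` -/
  T_F : T x.F = (q ^ 2)⁻¹ • (↑(x.p ^ 2 * x.t⁻¹ ^ 2) *
    ((x.G + ↑(x.p⁻¹ * x.a 1 ^ (-2 : ℤ) * x.t)) * (x.G + ↑(x.p * x.a 0 ^ (-2 : ℤ) * x.t⁻¹))⁻¹ʳ) *
    ((x.G + ↑(x.p⁻¹ * x.a 1 ^ (2 : ℤ) * x.t)) * (x.G + ↑(x.p * x.a 0 ^ (2 : ℤ) * x.t⁻¹))⁻¹ʳ) *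
    x.F⁻¹ʳ)
  /-- the equation for `T⁻¹(G)` -/
  T_symm_G : T.symm x.G = (q ^ 2)⁻¹ • (↑(x.t⁻¹ ^ 2) * x.G⁻¹ʳ *
    ((x.F + ↑(x.a 4 ^ (2 : ℤ) * x.t)) * (x.F + ↑(x.a 5 ^ (2 : ℤ) * x.t⁻¹))⁻¹ʳ) *
    ((x.F + ↑(x.a 4 ^ (-2 : ℤ) * x.t)) * (x.F + ↑(x.a 5 ^ (-2 : ℤ) * x.t⁻¹))⁻¹ʳ))

end QWeyl

namespace QLattice.Params

/-- The lattice variables `a_0, …, a_5, F, G`. -/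
def pt (P : QLattice.Params) : QWeyl.Pt QLattice.Op := ⟨P.a, P.F, P.G⟩

/-- `c = c^{0-} + c^{1-} - c^{0+} - c^{1+}` -/
def ctot (P : QLattice.Params) : ℂ := P.c false 0 + P.c false 1 - P.c true 0 - P.c true 1

end QLattice.Params

end

noncomputable section

namespace QLattice

/-! ### Elementary operators -/

/-! Apart from the infinite products, every operator involved is a scalar times a Weyl-ordered
exponential `wexp X`. These multiply by adding logarithms, up to a power of q read off from the form
`symp` (`wexp_mul`). Fourth roots, commutation relations and the values of p and t are therefore
linear algebra on logarithms, governed by `symp_lw_lw`.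

The R matrix is a power series part times q^{-T}. Conjugation by q^T is a linear shear of logarithms
(`qT_mul_wexp`), since T is quadratic. Moving a monomial through (κ x^γ; Q)_∞ only rescales κ
(`wexp_mul_dilog`), and (x; Q)_∞ = (1 - x)(Qx; Q)_∞ makes the product collapse to a single factor
when the rescaling is by Q or its inverse. Along F, two of the four R matrices only shear, and the
other two contribute factors 1 - q w_1 and (1 - q⁻¹ w_0)⁻¹; along G and the inverse evolution the
roles are exchanged (`H_conj_wexp_flog`, `H_conj_inv_wexp_glog`). The remaining monomials are q⁻² G²
F⁻¹ and q⁻² G⁻¹ F². Since 1 - q w_1 and 1 - q⁻¹ w_0 are, up to monomials, the numerators and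
denominators of the equations (`num_G`, `den_G`, `num_F`, `den_F`), these become `H_conj_F` and
`H_conj_inv_G`; invertibility is free, because the factors are power series with constant term 1,
possibly conjugated.

On the Weyl group side, monomials in the a_j are encoded by integer vectors (`exists_hasExp`), so
that their bookkeeping is decidable. The half word s_2 s_1 s_0 s_2 fixes G and sends F to the
inverse of the bracket M in the first equation (`Factors.reflG_F`); the half word σ s_3 s_5 s_4 s_3
produces the second equation (`Factors.reflF_G`). An automorphism with the prescribed values on the
a_j and F, whose inverse has the prescribed value on G, carries one half word to the other. As all
reflections are involutions at the points that occur, it agrees with T_3 on every generator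
(`Factors.map_eq_T3`). For a skew field the argument runs in the opposite direction, and the
denominators are nonzero because F and G do not commute. -/

theorem scal_mul (z z' : ℂˣ) : scal (z * z') = scal z * scal z' := map_mul _ _ _

theorem scal_one : scal 1 = 1 := map_one (Units.map (algebraMap ℂ Op).toMonoidHom)

theorem scal_inv (z : ℂˣ) : scal z⁻¹ = (scal z)⁻¹ :=
  map_inv (Units.map (algebraMap ℂ Op).toMonoidHom) z

theorem scal_pow (z : ℂˣ) (n : ℕ) : scal (z ^ n) = scal z ^ n :=
  map_pow (Units.map (algebraMap ℂ Op).toMonoidHom) z n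

theorem coe_scal (z : ℂˣ) : (scal z : Op) = algebraMap ℂ Op z := rfl

theorem scal_commute (z : ℂˣ) (O : Opˣ) : Commute (scal z) O :=
  Units.ext (Algebra.commutes (z : ℂ) (O : Op))

theorem commute_scal (z : ℂˣ) (O : Opˣ) : Commute O (scal z) := (scal_commute z O).symm

theorem coe_scal_mul (z : ℂˣ) (O : Opˣ) : ((scal z * O : Opˣ) : Op) = (z : ℂ) • (O : Op) :=
  (Algebra.smul_def _ _).symm

theorem op_ext {A B : Op} (h : ∀ f β, (A f).coeff β = (B f).coeff β) : A = B :=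
  LinearMap.ext fun f => HahnSeries.ext (funext (h f))

theorem diag_coeff (χ : Expo → ℂ) (f : Space) (β : Expo) :
    (diag χ f).coeff β = χ β * f.coeff β := rfl

theorem scal_coeff (z : ℂˣ) (f : Space) (β : Expo) :
    ((scal z : Op) f).coeff β = z * f.coeff β := by
  rw [coe_scal, Module.algebraMap_end_apply, HahnSeries.coeff_smul, smul_eq_mul]

theorem monom_coeff (γ : Expo) (f : Space) (β : Expo) :
    ((monom γ : Op) f).coeff β = f.coeff (β - γ) := by
  change (HahnSeries.single γ 1 * f).coeff β = _
  rw [HahnSeries.coeff_single_mul, one_mul]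

/-- The symplectic form governing the commutation relations of Weyl-ordered exponentials. -/
def symp (X Y : LogMonom) : ℂ := X.2.1 Y.1 - Y.2.1 X.1

theorem symp_add_left (X Y Z : LogMonom) : symp (X + Y) Z = symp X Z + symp Y Z := by
  simp [symp]; ring

theorem symp_sub_left (X Y Z : LogMonom) : symp (X - Y) Z = symp X Z - symp Y Z := by
  simp [symp]; ring

theorem symp_neg_left (X Y : LogMonom) : symp (-X) Y = -symp X Y := by
  simp [symp]; ring

theorem symp_smul_left (r : ℚ) (X Y : LogMonom) : symp (r • X) Y = r * symp X Y := by
  simp [symp, Rat.smul_def]; ring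

theorem symp_swap (X Y : LogMonom) : symp X Y = -symp Y X := by
  simp [symp]

theorem symp_add_right (X Y Z : LogMonom) : symp X (Y + Z) = symp X Y + symp X Z := by
  simp [symp]; ring

theorem symp_sub_right (X Y Z : LogMonom) : symp X (Y - Z) = symp X Y - symp X Z := by
  simp [symp]; ring

theorem symp_neg_right (X Y : LogMonom) : symp X (-Y) = -symp X Y := by
  simp [symp]; ring

theorem symp_smul_right (r : ℚ) (X Y : LogMonom) : symp X (r • Y) = r * symp X Y := by
  simp [symp, Rat.smul_def]; ring

theorem symp_self (X : LogMonom) : symp X X = 0 := sub_self _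

end QLattice

namespace QLattice.Params

open QLattice

variable (P : Params)

theorem qpow_val (r : ℂ) : (P.qpow r : ℂ) = Complex.exp (P.ħ * r) := rfl

theorem qpow_add (r r' : ℂ) : P.qpow (r + r') = P.qpow r * P.qpow r' :=
  Units.ext (by simp [qpow_val, mul_add, Complex.exp_add])

theorem qpow_zero : P.qpow 0 = 1 := Units.ext (by simp [qpow_val])

theorem qpow_neg (r : ℂ) : P.qpow (-r) = (P.qpow r)⁻¹ := by
  rw [eq_inv_iff_mul_eq_one, ← qpow_add, neg_add_cancel, qpow_zero]

theorem qpow_one : (P.qpow 1 : ℂ) = P.q := by simp [qpow_val, q]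

theorem qpow_natCast (n : ℕ) : P.qpow n = P.qpow 1 ^ n := by
  induction n with
  | zero => simpa using P.qpow_zero
  | succ n ih => rw [Nat.cast_succ, qpow_add, ih, pow_succ]

theorem qpow_two : P.qpow 2 = P.qpow 1 ^ 2 := by simpa using P.qpow_natCast 2

theorem qdiag_coeff (l : Expo → ℂ) (f : Space) (β : Expo) :
    ((P.qdiag l : Op) f).coeff β = Complex.exp (P.ħ * l β) * f.coeff β := rfl

theorem wexp_coeff (X : LogMonom) (f : Space) (β : Expo) :
    ((P.wexp X : Op) f).coeff β =
      Complex.exp (P.ħ * (X.2.1 (β - (1 / 2 : ℚ) • X.1) + X.2.2)) * f.coeff (β - X.1) := by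
  simp only [wexp, Units.val_mul, Module.End.mul_apply, monom_coeff, qdiag_coeff]
  rw [sub_sub, ← add_smul]
  norm_num

theorem wexp_mul (X Y : LogMonom) :
    P.wexp X * P.wexp Y = scal (P.qpow (symp X Y / 2)) * P.wexp (X + Y) := by
  refine Units.ext (op_ext fun f β => ?_)
  simp only [Units.val_mul, Module.End.mul_apply, wexp_coeff, scal_coeff, qpow_val, symp,
    Prod.fst_add, Prod.snd_add, LinearMap.add_apply, map_sub, map_add, map_smul, smul_add]
  rw [← mul_assoc, ← mul_assoc, ← Complex.exp_add, ← Complex.exp_add]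
  simp only [Rat.smul_def]
  congr 2
  · push_cast
    ring
  · rw [sub_sub]

theorem wexp_mul_comm (X Y : LogMonom) :
    P.wexp X * P.wexp Y = scal (P.qpow (symp X Y)) * (P.wexp Y * P.wexp X) := by
  rw [wexp_mul, wexp_mul, ← mul_assoc, ← scal_mul, ← qpow_add, add_comm Y X, symp_swap Y X]
  congr 3
  ring

theorem wexp_commute {X Y : LogMonom} (h : symp X Y = 0) : Commute (P.wexp X) (P.wexp Y) := by
  rw [Commute, SemiconjBy, wexp_mul_comm, h, qpow_zero, scal_one, one_mul]

theorem wexp_mul_of_symp_eq_zero {X Y : LogMonom} (h : symp X Y = 0) :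
    P.wexp X * P.wexp Y = P.wexp (X + Y) := by
  rw [wexp_mul, h, zero_div, qpow_zero, scal_one, one_mul]

theorem wexp_scalar (κ : ℂ) : P.wexp (0, 0, κ) = scal (P.qpow κ) := by
  refine Units.ext (op_ext fun f β => ?_)
  simp [wexp_coeff, scal_coeff, qpow_val]

theorem wexp_zero : P.wexp 0 = 1 := by
  rw [← scal_one, ← P.qpow_zero]; exact P.wexp_scalar 0

theorem wexp_neg (X : LogMonom) : P.wexp (-X) = (P.wexp X)⁻¹ := by
  rw [eq_inv_iff_mul_eq_one, wexp_mul_of_symp_eq_zero, neg_add_cancel, wexp_zero]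
  rw [symp_neg_left, symp_self, neg_zero]

theorem wexp_pow (X : LogMonom) (n : ℕ) : P.wexp X ^ n = P.wexp ((n : ℚ) • X) := by
  induction n with
  | zero => simp [wexp_zero]
  | succ n ih =>
    rw [pow_succ, ih, wexp_mul_of_symp_eq_zero]
    · rw [Nat.cast_succ, add_smul, one_smul]
    · rw [symp_smul_left, symp_self, mul_zero]

theorem monom_eq_wexp (γ : Expo) : monom γ = P.wexp (γ, 0, 0) := by
  refine Units.ext (op_ext fun f β => ?_)
  simp [wexp_coeff, monom_coeff]

theorem qdiag_eq_wexp (l : Expo →ₗ[ℚ] ℂ) (κ : ℂ) :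
    P.qdiag (fun β => l β + κ) = P.wexp (0, l, κ) := by
  refine Units.ext (op_ext fun f β => ?_)
  simp [wexp_coeff, qdiag_coeff]

/-- A diagonal operator with quadratic exponent acts on Weyl-ordered exponentials by a shear. -/
theorem qdiag_mul_wexp (χ : Expo → ℂ) (X Y : LogMonom) (h₁ : Y.1 = X.1)
    (h : ∀ β, χ (β + (1 / 2 : ℚ) • X.1) - χ (β - (1 / 2 : ℚ) • X.1) =
      Y.2.1 β + Y.2.2 - (X.2.1 β + X.2.2)) :
    P.qdiag χ * P.wexp X = P.wexp Y * P.qdiag χ := by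
  refine Units.ext (op_ext fun f β => ?_)
  simp only [Units.val_mul, Module.End.mul_apply, wexp_coeff, qdiag_coeff, h₁]
  rw [← mul_assoc, ← mul_assoc, ← Complex.exp_add, ← Complex.exp_add, ← mul_add, ← mul_add]
  have h' := h (β - (1 / 2 : ℚ) • X.1)
  rw [sub_add_cancel, sub_sub, ← add_smul] at h'
  rw [show (1 / 2 + 1 / 2 : ℚ) = 1 by norm_num, one_smul] at h'
  congr 3
  linear_combination h'

end QLattice.Params

namespace QLattice

/-! ### The `q`-difference equation of the infinite product -/

/-- The finite products converging to `qPoch`. -/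
def qPochPartial (Q : ℂ) (N : ℕ) : PowerSeries ℂ :=
  ∏ n ∈ Finset.range N, (1 - PowerSeries.C (Q ^ n) * PowerSeries.X : PowerSeries ℂ)

theorem coeff_succ_qPochPartial_succ (Q : ℂ) (N k : ℕ) :
    PowerSeries.coeff (k + 1) (qPochPartial Q (N + 1)) =
      PowerSeries.coeff (k + 1) (qPochPartial Q N) -
        Q ^ N * PowerSeries.coeff k (qPochPartial Q N) := by
  rw [qPochPartial, Finset.prod_range_succ, ← qPochPartial, mul_sub, mul_one, map_sub,
    mul_left_comm, PowerSeries.coeff_C_mul, PowerSeries.coeff_succ_mul_X]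

theorem coeff_zero_qPochPartial (Q : ℂ) (N : ℕ) :
    PowerSeries.coeff 0 (qPochPartial Q N) = 1 := by
  simp [qPochPartial, map_prod]

theorem exists_tendsto_coeff_qPochPartial {Q : ℂ} (hQ : ‖Q‖ < 1) (k : ℕ) :
    ∃ z, Filter.Tendsto (fun N => PowerSeries.coeff k (qPochPartial Q N)) Filter.atTop
      (nhds z) := by
  induction k with
  | zero => exact ⟨1, by simp only [coeff_zero_qPochPartial]; exact tendsto_const_nhds⟩
  | succ k ih =>
    obtain ⟨z, hz⟩ := ih
    obtain ⟨C, hC⟩ := (Metric.isBounded_range_of_tendsto _ hz).exists_norm_le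
    -- The increment of coefficient k + 1 is Q^N times coefficient k, which is bounded because it
    -- converges by induction; the increments are thus dominated by a geometric series.
    refine cauchySeq_tendsto_of_complete (cauchySeq_of_le_geometric ‖Q‖ C hQ fun N => ?_)
    rw [dist_eq_norm, coeff_succ_qPochPartial_succ, sub_sub_cancel, norm_mul, norm_pow, mul_comm]
    exact mul_le_mul_of_nonneg_right (hC _ ⟨N, rfl⟩) (by positivity)

theorem tendsto_coeff_qPochPartial {Q : ℂ} (hQ : ‖Q‖ < 1) (k : ℕ) :
    Filter.Tendsto (fun N => PowerSeries.coeff k (qPochPartial Q N)) Filter.atTop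
      (nhds (PowerSeries.coeff k (qPoch Q))) := by
  rw [qPoch, PowerSeries.coeff_mk]
  exact tendsto_nhds_limUnder (exists_tendsto_coeff_qPochPartial hQ k)

theorem qPochPartial_succ (Q : ℂ) (N : ℕ) :
    qPochPartial Q (N + 1) = (1 - PowerSeries.X) * PowerSeries.rescale Q (qPochPartial Q N) := by
  rw [qPochPartial, Finset.prod_range_succ', qPochPartial, map_prod, mul_comm]
  congr 1
  · simp
  · refine Finset.prod_congr rfl fun n _ => ?_
    rw [map_sub, map_mul, map_one, PowerSeries.rescale_X]
    have h : PowerSeries.rescale Q (PowerSeries.C (Q ^ n)) = PowerSeries.C (Q ^ n) := by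
      ext k
      rw [PowerSeries.coeff_rescale, PowerSeries.coeff_C]
      split_ifs with hk <;> simp [hk]
    rw [h, ← mul_assoc, ← map_mul, pow_succ]

/-- `(x, Q)_∞ = (1 - x) (Q x, Q)_∞` -/
theorem qPoch_eq {Q : ℂ} (hQ : ‖Q‖ < 1) :
    qPoch Q = (1 - PowerSeries.X) * PowerSeries.rescale Q (qPoch Q) := by
  ext k
  refine tendsto_nhds_unique
    ((Filter.tendsto_add_atTop_iff_nat 1).2 (tendsto_coeff_qPochPartial hQ k)) ?_
  simp only [qPochPartial_succ]
  cases k with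
  | zero =>
    simp only [PowerSeries.coeff_zero_eq_constantCoeff, map_mul, map_sub, map_one,
      PowerSeries.constantCoeff_X, sub_zero, one_mul]
    simp only [← PowerSeries.coeff_zero_eq_constantCoeff_apply, PowerSeries.coeff_rescale]
    exact (tendsto_coeff_qPochPartial hQ 0).const_mul _
  | succ k =>
    simp only [sub_mul, one_mul, map_sub, PowerSeries.coeff_succ_X_mul, PowerSeries.coeff_rescale]
    exact ((tendsto_coeff_qPochPartial hQ (k + 1)).const_mul _).sub
      ((tendsto_coeff_qPochPartial hQ k).const_mul _)

/-! ### Power series in a monomial as operators -/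

/-- Multiplication by a power series in the monomial `x^γ`. -/
def mulSubst (γ : Expo) (hγ : 0 < γ) : PowerSeries ℂ →+* Op :=
  (Algebra.lmul ℂ Space).toRingHom.comp (substMonom γ hγ)

theorem mulSubst_apply (γ : Expo) (hγ : 0 < γ) (φ : PowerSeries ℂ) (f : Space) :
    mulSubst γ hγ φ f = substMonom γ hγ φ * f := rfl

theorem nsmul_injective_of_pos {γ : Expo} (hγ : 0 < γ) :
    Function.Injective fun n : ℕ => n • γ := by
  intro m n h
  obtain ⟨v, hv⟩ := (Pi.lt_def.1 hγ).2
  have h' := congrFun h v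
  simp only [Pi.smul_apply, nsmul_eq_mul] at h'
  exact_mod_cast mul_right_cancel₀ hv.ne' h'

theorem substMonom_coeff_nsmul (γ : Expo) (hγ : 0 < γ) (φ : PowerSeries ℂ) (n : ℕ) :
    (substMonom γ hγ φ).coeff (n • γ) = PowerSeries.coeff n φ := by
  have h := HahnSeries.toPowerSeries_symm_apply_coeff (f := φ) (n := n)
  rw [← h]
  exact HahnSeries.embDomain_coeff (f := ⟨⟨fun n : ℕ => n • γ, _⟩, _⟩)

theorem substMonom_coeff_of_notMem (γ : Expo) (hγ : 0 < γ) (φ : PowerSeries ℂ) {β : Expo}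
    (hβ : ∀ n : ℕ, n • γ ≠ β) : (substMonom γ hγ φ).coeff β = 0 :=
  HahnSeries.embDomain_of_notMem_range (f := ⟨⟨fun n : ℕ => n • γ, _⟩, _⟩)
    fun ⟨n, hn⟩ => hβ n hn

theorem substMonom_X (γ : Expo) (hγ : 0 < γ) :
    substMonom γ hγ PowerSeries.X = HahnSeries.single γ 1 := by
  ext β
  by_cases h : ∃ n : ℕ, n • γ = β
  · obtain ⟨n, rfl⟩ := h
    rw [substMonom_coeff_nsmul, PowerSeries.coeff_X, HahnSeries.coeff_single]
    have : n • γ = γ ↔ n = 1 := by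
      conv_lhs => rw [← one_smul ℕ γ, smul_smul, mul_one]
      exact (nsmul_injective_of_pos hγ).eq_iff
    simp only [this]
  · rw [substMonom_coeff_of_notMem _ _ _ (not_exists.1 h), HahnSeries.coeff_single_of_ne]
    exact fun h' => h ⟨1, by rw [one_smul, h']⟩

theorem substMonom_C (γ : Expo) (hγ : 0 < γ) (z : ℂ) :
    substMonom γ hγ (PowerSeries.C z) = HahnSeries.single 0 z := by
  ext β
  by_cases h : ∃ n : ℕ, n • γ = β
  · obtain ⟨n, rfl⟩ := h
    rw [substMonom_coeff_nsmul, PowerSeries.coeff_C, HahnSeries.coeff_single]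
    have : n • γ = 0 ↔ n = 0 := by
      conv_lhs => rw [← zero_smul ℕ γ]
      exact (nsmul_injective_of_pos hγ).eq_iff
    simp only [this]
  · rw [substMonom_coeff_of_notMem _ _ _ (not_exists.1 h), HahnSeries.coeff_single_of_ne]
    exact fun h' => h ⟨0, by rw [zero_smul, h']⟩

theorem mulSubst_X (γ : Expo) (hγ : 0 < γ) : mulSubst γ hγ PowerSeries.X = monom γ := by
  refine LinearMap.ext fun f => ?_
  rw [mulSubst_apply, substMonom_X]
  rfl

theorem mulSubst_C (γ : Expo) (hγ : 0 < γ) (z : ℂ) :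
    mulSubst γ hγ (PowerSeries.C z) = algebraMap ℂ Op z := by
  refine LinearMap.ext fun f => ?_
  rw [mulSubst_apply, substMonom_C, HahnSeries.single_zero_mul_eq_smul]
  rfl

theorem mulSubst_commute (γ γ' : Expo) (hγ : 0 < γ) (hγ' : 0 < γ') (φ φ' : PowerSeries ℂ) :
    Commute (mulSubst γ hγ φ) (mulSubst γ' hγ' φ') :=
  LinearMap.ext fun f => by
    simp only [Module.End.mul_apply, mulSubst_apply]
    exact mul_left_comm _ _ _

/-- A diagonal operator with `χ (γ + β) = z χ β` rescales power series in `x^γ`. -/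
theorem diag_mul_mulSubst {χ : Expo → ℂ} {γ : Expo} (hγ : 0 < γ) {z : ℂ}
    (h : ∀ β, χ (γ + β) = z * χ β) (φ : PowerSeries ℂ) :
    diag χ * mulSubst γ hγ φ = mulSubst γ hγ (PowerSeries.rescale z φ) * diag χ := by
  have hn : ∀ (n : ℕ) β, χ (n • γ + β) = z ^ n * χ β := by
    intro n β
    induction n with
    | zero => simp
    | succ n ih => rw [succ_nsmul', add_assoc, h, ih, pow_succ']; ring
  refine op_ext fun f β => ?_
  simp only [Module.End.mul_apply, mulSubst_apply, diag_coeff]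
  -- Both z and χ may vanish, so supports can shrink: the two coefficient sums run over different
  -- antidiagonals and are compared on the larger one.
  have hs₁ : (substMonom γ hγ (PowerSeries.rescale z φ)).support ⊆
      (substMonom γ hγ φ).support := by
    intro α hα
    rw [HahnSeries.mem_support] at hα ⊢
    by_cases hα' : ∃ n : ℕ, n • γ = α
    · obtain ⟨n, rfl⟩ := hα'
      rw [substMonom_coeff_nsmul] at hα ⊢
      rw [PowerSeries.coeff_rescale] at hα
      exact right_ne_zero_of_mul hα
    · exact absurd (substMonom_coeff_of_notMem _ _ _ (not_exists.1 hα')) hα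
  have hs₂ : (diag χ f).support ⊆ f.support := by
    intro α hα
    rw [HahnSeries.mem_support] at hα ⊢
    exact right_ne_zero_of_mul hα
  rw [HahnSeries.coeff_mul, HahnSeries.coeff_mul_left' (substMonom γ hγ φ).isPWO_support hs₁,
    Finset.mul_sum]
  have key : ∀ i j : Expo, i + j = β →
      (substMonom γ hγ (PowerSeries.rescale z φ)).coeff i * (χ j * f.coeff j) =
        χ β * ((substMonom γ hγ φ).coeff i * f.coeff j) := by
    rintro i j rfl
    by_cases hi : ∃ n : ℕ, n • γ = i
    · obtain ⟨n, rfl⟩ := hi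
      rw [substMonom_coeff_nsmul, substMonom_coeff_nsmul, PowerSeries.coeff_rescale, hn]
      ring
    · rw [substMonom_coeff_of_notMem _ _ _ (not_exists.1 hi),
        substMonom_coeff_of_notMem _ _ _ (not_exists.1 hi)]
      ring
  symm
  refine Finset.sum_subset_zero_on_sdiff (fun ij hij => ?_) (fun ij hij => ?_) (fun ij hij => ?_)
  · simp only [Finset.mem_antidiagonal] at hij ⊢
    exact ⟨hij.1, hs₂ hij.2.1, hij.2.2⟩
  · simp only [Finset.mem_sdiff, Finset.mem_antidiagonal, HahnSeries.mem_support, diag_coeff,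
      not_and] at hij
    obtain ⟨⟨h₁, h₂, h₃⟩, h₄⟩ := hij
    rw [← key _ _ h₃]
    by_cases h₅ : χ ij.2 * f.coeff ij.2 = 0
    · rw [h₅, mul_zero]
    · exact absurd h₃ (h₄ h₁ h₅)
  · simp only [Finset.mem_antidiagonal] at hij
    exact key _ _ hij.2.2

theorem coe_dilog (Q κ : ℂ) (γ : Expo) (hγ : 0 < γ) :
    (dilog Q κ γ hγ : Op) = mulSubst γ hγ (PowerSeries.rescale κ (qPoch Q)) := rfl

theorem isUnit_one_sub_C_mul_X (κ : ℂ) :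
    IsUnit (1 - PowerSeries.C κ * PowerSeries.X : PowerSeries ℂ) := by
  rw [PowerSeries.isUnit_iff_constantCoeff]
  simp

/-- Multiplication by `1 - κ x^γ`. -/
def oneSub (κ : ℂ) (γ : Expo) (hγ : 0 < γ) : Opˣ :=
  Units.map (mulSubst γ hγ).toMonoidHom (isUnit_one_sub_C_mul_X κ).unit

theorem coe_oneSub_eq_mulSubst (κ : ℂ) (γ : Expo) (hγ : 0 < γ) :
    (oneSub κ γ hγ : Op) = mulSubst γ hγ (1 - PowerSeries.C κ * PowerSeries.X) := rfl

theorem coe_oneSub (κ : ℂ) (γ : Expo) (hγ : 0 < γ) :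
    (oneSub κ γ hγ : Op) = 1 - κ • (monom γ : Op) := by
  rw [coe_oneSub_eq_mulSubst, map_sub, map_mul, map_one, mulSubst_X, mulSubst_C, Algebra.smul_def]

theorem dilog_eq {Q : ℂ} (hQ : ‖Q‖ < 1) (κ : ℂ) (γ : Expo) (hγ : 0 < γ) :
    dilog Q κ γ hγ = oneSub κ γ hγ * dilog Q (κ * Q) γ hγ := by
  refine Units.ext ?_
  rw [Units.val_mul, coe_dilog, coe_dilog, coe_oneSub_eq_mulSubst, ← map_mul]
  congr 1
  conv_lhs => rw [qPoch_eq hQ]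
  rw [map_mul, map_sub, map_one, PowerSeries.rescale_X, PowerSeries.rescale_rescale, mul_comm κ Q]

theorem oneSub_commute_dilog (Q κ κ' : ℂ) (γ γ' : Expo) (hγ : 0 < γ) (hγ' : 0 < γ') :
    Commute (oneSub κ γ hγ) (dilog Q κ' γ' hγ') :=
  Units.ext (mulSubst_commute _ _ hγ hγ' _ _)

end QLattice

namespace QLattice.Params

open QLattice

variable (P : Params)

theorem coe_qdiag (l : Expo → ℂ) :
    (P.qdiag l : Op) = diag fun β => Complex.exp (P.ħ * l β) := rfl

theorem qdiag_mul_dilog (χ : Expo → ℂ) (Q κ r : ℂ) (γ : Expo) (hγ : 0 < γ)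
    (h : ∀ β, χ (γ + β) = r + χ β) :
    P.qdiag χ * dilog Q κ γ hγ = dilog Q (κ * P.qpow r) γ hγ * P.qdiag χ := by
  refine Units.ext ?_
  rw [Units.val_mul, Units.val_mul, coe_dilog, coe_dilog, coe_qdiag,
    ← PowerSeries.rescale_rescale]
  refine diag_mul_mulSubst hγ (fun β => ?_) _
  rw [h, qpow_val, mul_add, Complex.exp_add]

theorem monom_commute_dilog (γ' : Expo) (Q κ : ℂ) (γ : Expo) (hγ : 0 < γ) :
    Commute (monom γ') (dilog Q κ γ hγ) :=
  Units.ext (LinearMap.ext fun f => by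
    simp only [Units.val_mul, Module.End.mul_apply]
    exact mul_left_comm _ _ _)

/-- Multiplication operators commute among themselves, so only the diagonal part of the exponential
acts; it scales x^γ by q^{l(γ)}. -/
theorem wexp_mul_dilog (X : LogMonom) (Q κ : ℂ) (γ : Expo) (hγ : 0 < γ) :
    P.wexp X * dilog Q κ γ hγ = dilog Q (κ * P.qpow (X.2.1 γ)) γ hγ * P.wexp X := by
  have h := P.qdiag_mul_dilog (fun β => X.2.1 β + X.2.2) Q κ (X.2.1 γ) γ hγ
    (fun β => by rw [map_add]; ring)
  have h₁ := monom_commute_dilog ((1 / 2 : ℚ) • X.1) Q κ γ hγ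
  have h₂ := monom_commute_dilog ((1 / 2 : ℚ) • X.1) Q (κ * P.qpow (X.2.1 γ)) γ hγ
  rw [wexp, mul_assoc, h₁.eq, mul_assoc, ← mul_assoc (P.qdiag _) (dilog _ _ _ _), h, ← mul_assoc,
    ← mul_assoc, h₂.eq]
  simp only [mul_assoc]

/-! ### Logarithms of the lattice operators -/

/-- The logarithm of `k_i` at the point `m^s`. -/
def hlog (s : Bool) (m : ZMod 2) (i : Fin 2) : LogMonom := (0, hder s m i, P.hvac s m i)

/-- The logarithm of the monomial in `E_i^{m+} E_i^{n-}`. -/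
def plog (i : Fin 2) (m n : ZMod 2) : LogMonom := (pair m n i, 0, 0)

theorem lw_eq_plog (i : Fin 2) {m n : ZMod 2} (h : m = n) : P.lw i m n = plog i m n := by
  simp [lw, h, plog]

theorem lw_eq_add (i : Fin 2) {m n : ZMod 2} (h : m ≠ n) :
    P.lw i m n = plog i m n + P.hlog false n i - P.hlog true m i := by
  simp [lw, h, plog, hlog]

theorem hder_apply (s : Bool) (m : ZMod 2) (i : Fin 2) (β : Expo) :
    hder s m i β =
      ((sgn s * cartanA i 0 * β (s, m, 0) + sgn s * cartanA i 1 * β (s, m, 1) : ℚ) : ℂ) := by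
  simp [hder, Fin.sum_univ_two]

theorem hder_zero (s : Bool) (m : ZMod 2) : hder s m 0 = -hder s m 1 := by
  refine LinearMap.ext fun β => ?_
  rw [LinearMap.neg_apply, hder_apply, hder_apply]
  simp [cartanA]
  ring

theorem hder_true_pair (m : ZMod 2) (i : Fin 2) (m' n' : ZMod 2) (j : Fin 2) :
    hder true m i (pair m' n' j) = if m = m' then (cartanA i j : ℂ) else 0 := by
  rw [hder_apply]
  fin_cases j <;> by_cases h : m = m' <;> simp [pair, ex, sgn, h]

theorem hder_false_pair (n : ZMod 2) (i : Fin 2) (m' n' : ZMod 2) (j : Fin 2) :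
    hder false n i (pair m' n' j) = if n = n' then -(cartanA i j : ℂ) else 0 := by
  rw [hder_apply]
  fin_cases j <;> by_cases h : n = n' <;> simp [pair, ex, sgn, h]

theorem symp_plog_right (X : LogMonom) (i : Fin 2) (m n : ZMod 2) :
    symp X (plog i m n) = X.2.1 (pair m n i) := by
  simp [symp, plog]

theorem symp_hlog_plog_true (m : ZMod 2) (i : Fin 2) (m' n' : ZMod 2) (j : Fin 2) :
    symp (P.hlog true m i) (plog j m' n') = if m = m' then (cartanA i j : ℂ) else 0 := by
  rw [symp_plog_right, hlog, hder_true_pair]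

theorem symp_hlog_plog_false (n : ZMod 2) (i : Fin 2) (m' n' : ZMod 2) (j : Fin 2) :
    symp (P.hlog false n i) (plog j m' n') = if n = n' then -(cartanA i j : ℂ) else 0 := by
  rw [symp_plog_right, hlog, hder_false_pair]

theorem symp_plog_plog (i : Fin 2) (m n : ZMod 2) (j : Fin 2) (m' n' : ZMod 2) :
    symp (plog i m n) (plog j m' n') = 0 := by
  simp [symp, plog]

theorem symp_hlog_hlog (s : Bool) (m : ZMod 2) (i : Fin 2) (s' : Bool) (m' : ZMod 2) (j : Fin 2) :
    symp (P.hlog s m i) (P.hlog s' m' j) = 0 := by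
  simp [symp, hlog]

theorem symp_plog_hlog (i : Fin 2) (m n : ZMod 2) (s : Bool) (m' : ZMod 2) (j : Fin 2) :
    symp (plog i m n) (P.hlog s m' j) = -symp (P.hlog s m' j) (plog i m n) := symp_swap _ _

theorem cartanA_symm (i j : Fin 2) : cartanA i j = cartanA j i := by
  simp [cartanA, eq_comm]

theorem zmod_two_eq_iff {m n : ZMod 2} (h : m ≠ n) (k : ZMod 2) : k = n ↔ ¬ k = m := by
  revert m n k; decide

/-- The commutation relations between the lattice operators `w_i`. -/
theorem symp_lw_lw (i : Fin 2) (m n : ZMod 2) (j : Fin 2) (m' n' : ZMod 2) :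
    symp (P.lw i m n) (P.lw j m' n') =
      cartanA i j * ((if m' = n' then 0 else 1) - (if m = n then 0 else 1)) := by
  by_cases h : m = n <;> by_cases h' : m' = n'
  · rw [P.lw_eq_plog i h, P.lw_eq_plog j h', symp_plog_plog]
    simp [h, h']
  · rw [P.lw_eq_plog i h, P.lw_eq_add j h', symp_sub_right, symp_add_right, symp_plog_plog,
      symp_plog_hlog, symp_plog_hlog, symp_hlog_plog_true, symp_hlog_plog_false, cartanA_symm j i]
    subst h
    -- With only two positions and m' ≠ n', the position m equals exactly one of them, so exactly
    -- one of the two Cartan terms survives.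
    by_cases h₁ : n' = m
    · subst h₁; simp [h']
    · have h₂ := (zmod_two_eq_iff h' m)
      have h₃ : m = m' := by by_contra h₃; exact h₁ (h₂.2 h₃).symm
      subst h₃
      simp [h', h₁]
  · rw [P.lw_eq_plog j h', P.lw_eq_add i h, symp_sub_left, symp_add_left, symp_plog_plog,
      symp_hlog_plog_true, symp_hlog_plog_false]
    subst h'
    by_cases h₁ : n = m'
    · subst h₁; simp [h]
    · have h₂ := (zmod_two_eq_iff h m')
      have h₃ : m = m' := by by_contra h₃; exact h₁ (h₂.2 (Ne.symm h₃)).symm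
      subst h₃
      simp [h, h₁]
  · rw [P.lw_eq_add j h', P.lw_eq_add i h]
    simp only [symp_sub_left, symp_add_left, symp_sub_right, symp_add_right, symp_plog_plog,
      symp_plog_hlog, symp_hlog_plog_true, symp_hlog_plog_false, symp_hlog_hlog, cartanA_symm j i,
      h, h', eq_comm (a := m') (b := m), eq_comm (a := n') (b := n)]
    ring

/-- Conjugation by `q^T` on the points `m^+`, `n^-` shifts logarithms by this amount. -/
def shear (m n : ZMod 2) : LogMonom →ₗ[ℚ] LogMonom where
  toFun X := (0,
    (1 / 2 * hder true m 1 X.1 : ℂ) • hder false n 1 +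
      (1 / 2 * hder false n 1 X.1 : ℂ) • hder true m 1,
    P.c true m * d false n X.1 + d true m X.1 * P.c false n)
  map_add' X Y := by
    refine Prod.ext (by simp) (Prod.ext ?_ ?_)
    · simp only [Prod.fst_add, map_add, Prod.snd_add]; module
    · simp [d]; ring
  map_smul' r X := by
    refine Prod.ext (by simp) (Prod.ext ?_ ?_)
    · refine LinearMap.ext fun β => ?_
      simp [Rat.smul_def]; ring
    · simp [d, Rat.smul_def]; ring

theorem shear_hlog (m n : ZMod 2) (s : Bool) (m' : ZMod 2) (i : Fin 2) :
    P.shear m n (P.hlog s m' i) = 0 := by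
  refine Prod.ext rfl (Prod.ext ?_ ?_) <;> simp [shear, hlog, d]

theorem shear_shear (m n m' n' : ZMod 2) (X : LogMonom) :
    P.shear m n (P.shear m' n' X) = 0 := by
  refine Prod.ext rfl (Prod.ext ?_ ?_) <;> simp [shear, d]

theorem d_true_pair (m : ZMod 2) (m' n' : ZMod 2) (j : Fin 2) :
    d true m (pair m' n' j) = if m = m' ∧ j = 0 then 1 else 0 := by
  fin_cases j <;> by_cases h : m = m' <;> simp [d, pair, ex, sgn, h]

theorem d_false_pair (n : ZMod 2) (m' n' : ZMod 2) (j : Fin 2) :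
    d false n (pair m' n' j) = if n = n' ∧ j = 0 then -1 else 0 := by
  fin_cases j <;> by_cases h : n = n' <;> simp [d, pair, ex, sgn, h]

/-- T is the canonical element of the invariant form: contracting one slot with α_i leaves h_i in
the other. The terms c ⊗ d and d ⊗ c supply the vacuum eigenvalue c of h_0. -/
theorem shear_plog (m n : ZMod 2) (i : Fin 2) (m' n' : ZMod 2) :
    P.shear m n (plog i m' n') =
      (if m = m' then P.hlog false n i else 0) - (if n = n' then P.hlog true m i else 0) := by
  refine Prod.ext ?_ (Prod.ext ?_ ?_)
  · split_ifs <;> simp [shear, hlog]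
  · refine LinearMap.ext fun β => ?_
    fin_cases i <;> split_ifs <;>
      simp [shear, plog, hlog, hder_true_pair, hder_false_pair, hder_zero, cartanA,
        sub_eq_add_neg, *]
  · fin_cases i <;> split_ifs <;>
      simp [shear, plog, hlog, hvac, d_true_pair, d_false_pair, *]
      <;> ring

theorem shear_lw (m n : ZMod 2) (i : Fin 2) (m' n' : ZMod 2) :
    P.shear m n (P.lw i m' n') =
      (if m = m' then P.hlog false n i else 0) - (if n = n' then P.hlog true m i else 0) := by
  by_cases h : m' = n'
  · rw [P.lw_eq_plog i h, shear_plog]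
  · rw [P.lw_eq_add i h, map_sub, map_add, shear_hlog, shear_hlog, shear_plog, add_zero, sub_zero]

theorem hlog_add (s : Bool) (m : ZMod 2) :
    P.hlog s m 0 + P.hlog s m 1 = (0, 0, P.c s m) := by
  simp [hlog, hder_zero, hvac]

end QLattice.Params

/-! ### Conjugation identities in abstract rings and groups -/

theorem units_conj_one_sub_smul {R : Type*} [Ring R] [Algebra ℂ R] (u w : Rˣ) (z : ℂ) :
    (u : R) * (1 - z • (w : R)) * (u⁻¹ : Rˣ) = 1 - z • ((u * w * u⁻¹ : Rˣ) : R) := by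
  rw [mul_sub, sub_mul, mul_one, Units.mul_inv]
  simp only [Units.val_mul, mul_smul_comm, smul_mul_assoc]

theorem commute_one_sub_smul {R : Type*} [Ring R] [Algebra ℂ R] {u w : R} (h : Commute u w)
    (z : ℂ) : Commute u (1 - z • w) :=
  (Commute.one_right _).sub_right (h.smul_right _)

/-- This is the pattern of conjugation by the quasi R matrix: `x` is a monomial, `a` and `b` are the
real root products, `d` is the imaginary root product. Passing `a` and `b` costs one factor each,
passing `d` costs nothing. -/
theorem conj_eq_mul_of_twisted {G : Type*} [Group G] {x a b d n n' : G}
    (ha : n * (x * a) = a * x) (hb : x * b = n' * (b * x)) (hd : Commute x d)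
    (hnd : Commute n d) (hnb : Commute n b) :
    (a⁻¹ * d⁻¹ * b⁻¹)⁻¹ * x * (a⁻¹ * d⁻¹ * b⁻¹) = n * n'⁻¹ * x := by
  have h₁ : a * x * a⁻¹ = n * x := by rw [← ha]; group
  have h₂ : b * x * b⁻¹ = n'⁻¹ * x := by
    rw [mul_inv_eq_iff_eq_mul, mul_assoc, hb, inv_mul_cancel_left]
  calc (a⁻¹ * d⁻¹ * b⁻¹)⁻¹ * x * (a⁻¹ * d⁻¹ * b⁻¹) = b * d * (a * x * a⁻¹) * d⁻¹ * b⁻¹ := by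
        group
    _ = b * (n * (x * d)) * d⁻¹ * b⁻¹ := by rw [h₁, hd.eq, ← mul_assoc n, hnd.eq]; group
    _ = n * (b * x * b⁻¹) := by rw [← mul_assoc b n, ← hnb.eq]; group
    _ = n * n'⁻¹ * x := by rw [h₂, mul_assoc]

/-- The opposite conjugation. The hypotheses are stated for `x⁻¹` so that the same two exchange
relations for the real root products serve in both directions. -/
theorem conj_eq_mul_of_twisted' {G : Type*} [Group G] {x a b d n n' : G}
    (ha : n * (x⁻¹ * a) = a * x⁻¹) (hb : x⁻¹ * b = n' * (b * x⁻¹)) (hd : Commute x d)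
    (hnd : Commute n' d) (hna : Commute n a) (hna' : Commute n' a) (hnb' : Commute n' b) :
    (a⁻¹ * d⁻¹ * b⁻¹) * x * (a⁻¹ * d⁻¹ * b⁻¹)⁻¹ = x * (n * n'⁻¹) := by
  have h₁ : a⁻¹ * x * a = x * n :=
    calc a⁻¹ * x * a = (n * (x⁻¹ * a))⁻¹ * (n * a) := by group
      _ = x * n := by rw [ha, hna.eq]; group
  have h₂ : b⁻¹ * x * b = x * n'⁻¹ :=
    calc b⁻¹ * x * b = (x⁻¹ * b)⁻¹ * b := by group
      _ = x * (b⁻¹ * (n'⁻¹ * b)) := by rw [hb]; group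
      _ = x * n'⁻¹ := by rw [hnb'.inv_left.eq, inv_mul_cancel_left]
  calc (a⁻¹ * d⁻¹ * b⁻¹) * x * (a⁻¹ * d⁻¹ * b⁻¹)⁻¹ = a⁻¹ * d⁻¹ * (b⁻¹ * x * b) * d * a := by
        group
    _ = a⁻¹ * d⁻¹ * (x * d) * n'⁻¹ * a := by
        rw [h₂]; simp only [mul_assoc]; rw [hnd.inv_left.left_comm]
    _ = a⁻¹ * x * a * n'⁻¹ := by rw [hd.eq]; simp only [mul_assoc]; rw [hna'.inv_left.eq]; group
    _ = x * (n * n'⁻¹) := by rw [h₁, mul_assoc]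

namespace QLattice.Params

open QLattice

variable (P : Params)

/-! ### Conjugation by the R matrix -/

theorem norm_q_lt_one : ‖P.q‖ < 1 := by
  rw [q, Complex.norm_exp]
  exact Real.exp_lt_one_iff.2 P.re_neg

theorem norm_q_sq_lt_one : ‖P.q ^ 2‖ < 1 := by
  rw [norm_pow]
  exact pow_lt_one₀ (norm_nonneg _) P.norm_q_lt_one two_ne_zero

theorem q_ne_zero : P.q ≠ 0 := Complex.exp_ne_zero _

/-- The infinite product attached to the real root `α_i`. -/
def rootDilog (m n : ZMod 2) (i : Fin 2) : Opˣ :=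
  dilog (P.q ^ 2) (P.q * (P.q - P.q⁻¹) ^ 2) (pair m n i) (pair_pos m n i)

/-- The infinite product attached to the imaginary root. -/
def imDilog (m n : ZMod 2) : Opˣ :=
  dilog (P.q ^ 4) (P.q ^ 2 * (P.q - P.q⁻¹) ^ 4) (pair m n 0 + pair m n 1)
    (add_pos (pair_pos m n 0) (pair_pos m n 1))

/-- The power series part of the R matrix. -/
def quasiR (m n : ZMod 2) : Opˣ :=
  (P.rootDilog m n 1)⁻¹ * (P.imDilog m n)⁻¹ * (P.rootDilog m n 0)⁻¹

/-- `q^T` on the points `m^+`, `n^-`. -/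
def qT (m n : ZMod 2) : Opˣ := P.qdiag (P.tT m n)

theorem R_eq (m n : ZMod 2) : P.R m n = P.quasiR m n * (P.qT m n)⁻¹ := rfl

/-- The exponent T is a quadratic polynomial, so its difference between β + γ/2 and β - γ/2 is
exactly affine in β. The symmetric ordering of `wexp` leaves no additional scalar. -/
theorem qT_mul_wexp (m n : ZMod 2) (X : LogMonom) :
    P.qT m n * P.wexp X = P.wexp (X + P.shear m n X) * P.qT m n := by
  refine P.qdiag_mul_wexp _ _ _ (by simp [shear]) fun β => ?_
  simp [shear, tT, h, hvac, d, Rat.smul_def]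
  ring

/-- Pushing a monomial through the quasi R matrix when it commutes with it. -/
theorem wexp_commute_quasiR {m n : ZMod 2} {X : LogMonom} (h : ∀ i, X.2.1 (pair m n i) = 0) :
    Commute (P.wexp X) (P.quasiR m n) := by
  have h₁ : ∀ i, Commute (P.wexp X) (P.rootDilog m n i) := fun i => by
    rw [Commute, SemiconjBy, rootDilog, wexp_mul_dilog, h, qpow_zero, Units.val_one, mul_one]
  have h₂ : Commute (P.wexp X) (P.imDilog m n) := by
    rw [Commute, SemiconjBy, imDilog, wexp_mul_dilog, map_add, h, h, add_zero, qpow_zero,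
      Units.val_one, mul_one]
  exact ((h₁ 1).inv_right.mul_right h₂.inv_right).mul_right (h₁ 0).inv_right

/-- `1 - q^r (q - q⁻¹)² x^γ` for the exponent `γ` of `E_i ⊗ E_i`. -/
def rootFactor (r : ℂ) (m n : ZMod 2) (i : Fin 2) : Opˣ :=
  oneSub (P.qpow r * (P.q - P.q⁻¹) ^ 2) (pair m n i) (pair_pos m n i)

/-- The argument is shifted by q², which is the base of the product, so exactly the first factor is
split off. -/
theorem wexp_mul_rootDilog_of_two {m n : ZMod 2} {i : Fin 2} {X : LogMonom}
    (h : X.2.1 (pair m n i) = 2) :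
    P.rootFactor 1 m n i * (P.wexp X * P.rootDilog m n i) = P.rootDilog m n i * P.wexp X := by
  have hq : (P.qpow 2 : ℂ) = P.q ^ 2 := by rw [qpow_two, Units.val_pow_eq_pow_val, qpow_one]
  rw [rootDilog, wexp_mul_dilog, h, dilog_eq P.norm_q_sq_lt_one (P.q * _), hq,
    rootFactor, qpow_one]
  simp only [mul_assoc]

theorem wexp_mul_rootDilog_of_neg_two {m n : ZMod 2} {i : Fin 2} {X : LogMonom}
    (h : X.2.1 (pair m n i) = -2) :
    P.wexp X * P.rootDilog m n i =
      P.rootFactor (-1) m n i * (P.rootDilog m n i * P.wexp X) := by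
  have hq : (P.qpow (-2) : ℂ) * P.q ^ 2 = 1 := by
    rw [qpow_neg, qpow_two, ← P.qpow_one, ← Units.val_pow_eq_pow_val, Units.inv_mul]
  have hq' : P.q * (P.qpow (-2) : ℂ) = P.qpow (-1) := by
    rw [← qpow_one, ← Units.val_mul, ← qpow_add]; norm_num
  rw [rootDilog, wexp_mul_dilog, h, dilog_eq P.norm_q_sq_lt_one, mul_assoc (P.q * _), hq, mul_one,
    mul_right_comm P.q, hq', rootFactor, mul_assoc]

theorem rootFactor_commute_rootDilog (r : ℂ) (m n : ZMod 2) (i : Fin 2) (m' n' : ZMod 2)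
    (j : Fin 2) : Commute (P.rootFactor r m n i) (P.rootDilog m' n' j) :=
  oneSub_commute_dilog _ _ _ _ _ _ _

theorem rootFactor_commute_imDilog (r : ℂ) (m n : ZMod 2) (i : Fin 2) (m' n' : ZMod 2) :
    Commute (P.rootFactor r m n i) (P.imDilog m' n') :=
  oneSub_commute_dilog _ _ _ _ _ _ _

theorem wexp_mul_imDilog {m n : ZMod 2} {X : LogMonom}
    (h : X.2.1 (pair m n 0) + X.2.1 (pair m n 1) = 0) :
    Commute (P.wexp X) (P.imDilog m n) := by
  rw [Commute, SemiconjBy, imDilog, wexp_mul_dilog, map_add, h, qpow_zero, Units.val_one, mul_one]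

/-- The pairings 2 and -2 with the two simple roots add up to 0 on the imaginary root, so its
infinite product drops out and each real root product leaves one factor. -/
theorem quasiR_conj_wexp {m n : ZMod 2} {X : LogMonom} (h₁ : X.2.1 (pair m n 1) = 2)
    (h₀ : X.2.1 (pair m n 0) = -2) :
    (P.quasiR m n)⁻¹ * P.wexp X * P.quasiR m n =
      P.rootFactor 1 m n 1 * (P.rootFactor (-1) m n 0)⁻¹ * P.wexp X :=
  conj_eq_mul_of_twisted (P.wexp_mul_rootDilog_of_two h₁) (P.wexp_mul_rootDilog_of_neg_two h₀)
    (P.wexp_mul_imDilog (by rw [h₀, h₁]; norm_num)) (P.rootFactor_commute_imDilog _ _ _ _ _ _)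
    (P.rootFactor_commute_rootDilog _ _ _ _ _ _ _)

theorem quasiR_conj_inv_wexp {m n : ZMod 2} {X : LogMonom} (h₁ : X.2.1 (pair m n 1) = -2)
    (h₀ : X.2.1 (pair m n 0) = 2) :
    P.quasiR m n * P.wexp X * (P.quasiR m n)⁻¹ =
      P.wexp X * (P.rootFactor 1 m n 1 * (P.rootFactor (-1) m n 0)⁻¹) := by
  have h₁' : (-X).2.1 (pair m n 1) = 2 := by simp [h₁]
  have h₀' : (-X).2.1 (pair m n 0) = -2 := by simp [h₀]
  refine conj_eq_mul_of_twisted' ?_ ?_ (P.wexp_mul_imDilog (by rw [h₀, h₁]; norm_num))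
    (P.rootFactor_commute_imDilog _ _ _ _ _ _) (P.rootFactor_commute_rootDilog _ _ _ _ _ _ _)
    (P.rootFactor_commute_rootDilog _ _ _ _ _ _ _) (P.rootFactor_commute_rootDilog _ _ _ _ _ _ _)
  · rw [← wexp_neg]; exact P.wexp_mul_rootDilog_of_two h₁'
  · rw [← wexp_neg]; exact P.wexp_mul_rootDilog_of_neg_two h₀'

theorem qT_conj_wexp (m n : ZMod 2) (X : LogMonom) :
    P.qT m n * P.wexp X * (P.qT m n)⁻¹ = P.wexp (X + P.shear m n X) := by
  rw [qT_mul_wexp, mul_inv_cancel_right]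

theorem qT_conj_inv_wexp (m n : ZMod 2) (X : LogMonom) :
    (P.qT m n)⁻¹ * P.wexp X * P.qT m n = P.wexp (X - P.shear m n X) := by
  have h := P.qT_mul_wexp m n (X - P.shear m n X)
  rw [map_sub, shear_shear, sub_zero, sub_add_cancel] at h
  rw [mul_assoc, ← h, inv_mul_cancel_left]

/-- The R matrix shears the monomials commuting with its power series part. -/
theorem R_conj_wexp {m n : ZMod 2} {X : LogMonom} (h : ∀ i, X.2.1 (pair m n i) = 0) :
    (P.R m n)⁻¹ * P.wexp X * P.R m n = P.wexp (X + P.shear m n X) := by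
  rw [← qT_conj_wexp, R_eq, mul_inv_rev, inv_inv]
  simp only [mul_assoc]
  rw [← mul_assoc (P.wexp X), (P.wexp_commute_quasiR h).eq]
  simp only [mul_assoc, inv_mul_cancel_left]

theorem R_conj_inv_wexp {m n : ZMod 2} {X : LogMonom} (Y : LogMonom)
    (hY : X - P.shear m n X = Y) (h : ∀ i, Y.2.1 (pair m n i) = 0) :
    P.R m n * P.wexp X * (P.R m n)⁻¹ = P.wexp Y := by
  have h₁ : P.R m n * P.wexp X * (P.R m n)⁻¹ =
      P.quasiR m n * ((P.qT m n)⁻¹ * P.wexp X * P.qT m n) * (P.quasiR m n)⁻¹ := by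
    rw [R_eq, mul_inv_rev, inv_inv]
    simp only [mul_assoc]
  rw [h₁, qT_conj_inv_wexp, hY, ← (P.wexp_commute_quasiR h).eq, mul_inv_cancel_right]

theorem E_eq (s : Bool) (m : ZMod 2) (i : Fin 2) :
    P.E s m i = scal (-P.qq) * P.wexp (ex s m i, 0, 0) := by
  rw [E, monom_eq_wexp]

theorem k_eq (s : Bool) (m : ZMod 2) (i : Fin 2) : P.k s m i = P.wexp (P.hlog s m i) :=
  P.qdiag_eq_wexp _ _

theorem scal_mul_mul_scal_mul (z z' : ℂˣ) (A B : Opˣ) :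
    scal z * A * (scal z' * B) = scal (z * z') * (A * B) := by
  rw [mul_assoc, ← mul_assoc A, (commute_scal z' A).eq, scal_mul]
  simp only [mul_assoc]

/-- `w_i` is a multiple of a Weyl-ordered exponential. -/
theorem w_eq (i : Fin 2) (m n : ZMod 2) :
    P.w i m n = scal (P.qq ^ 2) * P.wexp (P.lw i m n) := by
  have hqq : (-P.qq) * (-P.qq) = P.qq ^ 2 := by rw [neg_mul_neg, sq]
  by_cases h : m = n
  · rw [w, if_pos h, P.lw_eq_plog i h, E_eq, E_eq, scal_mul_mul_scal_mul, hqq,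
      wexp_mul_of_symp_eq_zero]
    · simp [plog, pair]
    · simp [symp]
  -- Weyl ordering E k⁻¹ costs q and Weyl ordering k E costs q⁻¹; the two scalars cancel, which is
  -- why the prefactor is the same on and off the diagonal.
  · have h₁ : P.wexp (ex true m i, 0, 0) * (P.wexp (P.hlog true m i))⁻¹ =
        scal (P.qpow 1) * P.wexp ((ex true m i, 0, 0) - P.hlog true m i) := by
      rw [← wexp_neg, wexp_mul, ← sub_eq_add_neg]
      congr 3
      rw [symp_neg_right]
      fin_cases i <;> simp [symp, hlog, hder_apply, ex, sgn, cartanA]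
    have h₂ : P.wexp (P.hlog false n i) * P.wexp (ex false n i, 0, 0) =
        scal (P.qpow (-1)) * P.wexp (P.hlog false n i + (ex false n i, 0, 0)) := by
      rw [wexp_mul]
      congr 3
      fin_cases i <;> simp [symp, hlog, hder_apply, ex, sgn, cartanA]
    rw [w, if_neg h, P.lw_eq_add i h, E_eq, E_eq, k_eq, k_eq, mul_assoc (scal _), h₁,
      ← mul_assoc (P.wexp (P.hlog false n i)), (commute_scal _ (P.wexp (P.hlog false n i))).eq,
      mul_assoc (scal _) (P.wexp (P.hlog false n i)), h₂, scal_mul_mul_scal_mul, hqq,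
      scal_mul_mul_scal_mul, ← qpow_add, add_neg_cancel, qpow_zero, scal_one, one_mul,
      wexp_mul_of_symp_eq_zero]
    · congr 2
      have : plog i m n = ((ex true m i, 0, 0) + (ex false n i, 0, 0) : LogMonom) := by
        simp [plog, pair]
      rw [this]; abel
    · fin_cases i <;> simp [symp, hlog, hder_apply, ex]

theorem coe_rootFactor (r : ℂ) (m n : ZMod 2) (i : Fin 2) :
    (P.rootFactor r m n i : Op) =
      1 - (P.qpow r : ℂ) • ((scal (P.qq ^ 2) * P.wexp (plog i m n) : Opˣ) : Op) := by
  rw [rootFactor, coe_oneSub, coe_scal_mul, smul_smul, monom_eq_wexp]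
  rfl

/-- The shear by q^T turns E_i ⊗ E_i into E_i k_i⁻¹ ⊗ k_i E_i. This accounts for the two cases in
the definition of `w`. -/
theorem coe_qT_conj_rootFactor (r : ℂ) {m n : ZMod 2} (h : m ≠ n) (i : Fin 2) :
    ((P.qT m n * P.rootFactor r m n i * (P.qT m n)⁻¹ : Opˣ) : Op) =
      1 - (P.qpow r : ℂ) • (P.w i m n : Op) := by
  have h₁ : P.w i m n = P.qT m n * (scal (P.qq ^ 2) * P.wexp (plog i m n)) * (P.qT m n)⁻¹ := by
    rw [← mul_assoc, (commute_scal _ (P.qT m n)).eq, mul_assoc (scal _), mul_assoc (scal _),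
      qT_conj_wexp, shear_plog, if_pos rfl, if_pos rfl, w_eq, P.lw_eq_add i h, add_sub_assoc]
  rw [h₁, Units.val_mul, Units.val_mul, coe_rootFactor]
  exact units_conj_one_sub_smul (R := Op) _ _ _

/-- The invertible operator `1 - q^r w_i`. -/
def wFactor (r : ℂ) (i : Fin 2) (m n : ZMod 2) : Opˣ :=
  if m = n then P.rootFactor r m n i else P.qT m n * P.rootFactor r m n i * (P.qT m n)⁻¹

theorem coe_wFactor (r : ℂ) (i : Fin 2) (m n : ZMod 2) :
    (P.wFactor r i m n : Op) = 1 - (P.qpow r : ℂ) • (P.w i m n : Op) := by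
  rw [wFactor]
  split_ifs with h
  · rw [coe_rootFactor, w_eq, P.lw_eq_plog i h]
  · exact P.coe_qT_conj_rootFactor r h i

theorem commute_wFactor {U : Opˣ} {i : Fin 2} {m n : ZMod 2} (h : Commute U (P.w i m n)) (r : ℂ) :
    Commute U (P.wFactor r i m n) := by
  refine Units.ext ?_
  have h' : Commute (U : Op) (P.w i m n) := congrArg Units.val h
  rw [Units.val_mul, Units.val_mul, coe_wFactor]
  exact commute_one_sub_smul (R := Op) h' _

/-- The two operators act on disjoint pairs of lattice points. -/
theorem R_commute_w {m n : ZMod 2} (i : Fin 2) {m' n' : ZMod 2} (hm : m ≠ m') (hn : n ≠ n') :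
    Commute (P.R m n) (P.w i m' n') := by
  have h : ∀ j, (P.lw i m' n').2.1 (pair m n j) = 0 := fun j => by
    rw [← symp_plog_right]
    by_cases h : m' = n'
    · rw [P.lw_eq_plog i h, symp_plog_plog]
    · rw [P.lw_eq_add i h, symp_sub_left, symp_add_left, symp_plog_plog, symp_hlog_plog_true,
        symp_hlog_plog_false, if_neg hm.symm, if_neg hn.symm]
      ring
  have h₁ := P.R_conj_wexp h
  rw [shear_lw, if_neg hm, if_neg hn, sub_zero, add_zero, mul_assoc, inv_mul_eq_iff_eq_mul] at h₁
  rw [w_eq]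
  exact (commute_scal _ _).mul_right h₁.symm

/-- Conjugation by the R matrix of a monomial not commuting with its power series part. -/
theorem R_conj_wexp_of_ne {m n : ZMod 2} (h : m ≠ n) {X : LogMonom}
    (h₁ : X.2.1 (pair m n 1) = 2) (h₀ : X.2.1 (pair m n 0) = -2) :
    (P.R m n)⁻¹ * P.wexp X * P.R m n =
      P.wFactor 1 1 m n * (P.wFactor (-1) 0 m n)⁻¹ * P.wexp (X + P.shear m n X) := by
  rw [wFactor, if_neg h, wFactor, if_neg h, ← qT_conj_wexp, R_eq]
  calc _ = P.qT m n * ((P.quasiR m n)⁻¹ * P.wexp X * P.quasiR m n) * (P.qT m n)⁻¹ := by group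
    _ = _ := by rw [P.quasiR_conj_wexp h₁ h₀]; group

/-- In this direction q^T acts on the monomial before the quasi R matrix does, so the factors are
not sheared and involve w_i on the diagonal directly. -/
theorem R_conj_inv_wexp_of_eq {m : ZMod 2} {X : LogMonom} (Y : LogMonom)
    (hY : X - P.shear m m X = Y) (h₁ : Y.2.1 (pair m m 1) = -2) (h₀ : Y.2.1 (pair m m 0) = 2) :
    P.R m m * P.wexp X * (P.R m m)⁻¹ =
      P.wexp Y * (P.wFactor 1 1 m m * (P.wFactor (-1) 0 m m)⁻¹) := by
  rw [wFactor, if_pos rfl, wFactor, if_pos rfl, ← P.quasiR_conj_inv_wexp h₁ h₀, ← hY,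
    ← qT_conj_inv_wexp, R_eq]
  group

/-! ### The time evolution of monomials -/

theorem T_coe (O : Opˣ) : P.T (O : Op) = ((P.H⁻¹ * O * P.H : Opˣ) : Op) := rfl

theorem T_symm_coe (O : Opˣ) : P.T.symm (O : Op) = ((P.H * O * P.H⁻¹ : Opˣ) : Op) := rfl

theorem H_conj (O : Opˣ) : P.H⁻¹ * O * P.H =
    (P.R 1 0)⁻¹ * ((P.R 0 1)⁻¹ * ((P.R 0 0)⁻¹ * ((P.R 1 1)⁻¹ * O * P.R 1 1) * P.R 0 0) *
      P.R 0 1) * P.R 1 0 := by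
  rw [H, H0, H1]; group

theorem H_conj_inv (O : Opˣ) : P.H * O * P.H⁻¹ =
    P.R 1 1 * (P.R 0 0 * (P.R 0 1 * (P.R 1 0 * O * (P.R 1 0)⁻¹) * (P.R 0 1)⁻¹) * (P.R 0 0)⁻¹) *
      (P.R 1 1)⁻¹ := by
  rw [H, H0, H1]; group

/-- The total shear of the evolution. -/
def shearTot (X : LogMonom) : LogMonom :=
  P.shear 1 1 X + P.shear 0 0 X + P.shear 0 1 X + P.shear 1 0 X

/-- Monomials commuting with all `w_i` are only sheared. -/
theorem H_conj_wexp {X : LogMonom}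
    (h : ∀ i, X.2.1 (pair 1 1 i) = 0 ∧ (X + P.shear 1 1 X).2.1 (pair 0 0 i) = 0 ∧
      (X + P.shear 1 1 X + P.shear 0 0 X).2.1 (pair 0 1 i) = 0 ∧
      (X + P.shear 1 1 X + P.shear 0 0 X + P.shear 0 1 X).2.1 (pair 1 0 i) = 0) :
    P.H⁻¹ * P.wexp X * P.H = P.wexp (X + P.shearTot X) := by
  rw [H_conj, P.R_conj_wexp fun i => (h i).1, P.R_conj_wexp fun i => (h i).2.1]
  simp only [map_add, shear_shear, add_zero]
  rw [P.R_conj_wexp fun i => (h i).2.2.1]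
  simp only [map_add, shear_shear, add_zero]
  rw [P.R_conj_wexp fun i => (h i).2.2.2]
  simp only [map_add, shear_shear, add_zero, shearTot, add_assoc]

/-! ### The logarithms of the lattice variables -/

/-- The logarithms of the `a_j`. -/
def alog : Fin 6 → LogMonom :=
  ![(1 / 4 : ℚ) • (P.lw 0 0 1 - P.lw 0 1 0),
    (1 / 4 : ℚ) • (P.lw 1 0 1 - P.lw 1 1 0),
    -(1 / 4 : ℚ) • (P.lw 0 0 1 + P.lw 1 0 1),
    (1 / 4 : ℚ) • (P.lw 0 1 1 + P.lw 1 1 1),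
    (1 / 4 : ℚ) • (P.lw 1 0 0 - P.lw 1 1 1),
    (1 / 4 : ℚ) • (P.lw 0 0 0 - P.lw 0 1 1)]

/-- The scalar prefactors of the `a_j`. -/
def ascal : Fin 6 → ℂˣ := ![1, 1, P.qq⁻¹, P.qq, 1, 1]

theorem a_eq (j : Fin 6) : P.a j = scal (P.ascal j) * P.wexp (P.alog j) := by
  fin_cases j <;> simp [a, ascal, alog, scal_one]

/-- The logarithm of `-q F`. -/
def flog : LogMonom := (1 / 4 : ℚ) • (P.lw 0 1 1 + P.lw 0 0 0 - P.lw 1 0 0 - P.lw 1 1 1)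

/-- The logarithm of `-q G`. -/
def glog : LogMonom := (1 / 4 : ℚ) • (P.lw 0 1 0 + P.lw 0 0 1 - P.lw 1 0 1 - P.lw 1 1 0)

/-- Two mechanisms: a quotient of two w_i with the same i, both on or both off the diagonal, pairs
to zero since `symp_lw_lw` does not distinguish them; a product w_0 w_1 pairs to zero since the rows
of the affine Cartan matrix sum to zero. -/
theorem symp_alog_lw (j : Fin 6) (i : Fin 2) (m n : ZMod 2) :
    symp (P.alog j) (P.lw i m n) = 0 := by
  by_cases h : m = n <;> fin_cases j <;> fin_cases i <;>
    simp [alog, symp_smul_left, symp_add_left, symp_sub_left, symp_neg_left, symp_lw_lw, cartanA, h]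

theorem symp_alog_right {X : LogMonom} (h : ∀ i m n, symp X (P.lw i m n) = 0) (k : Fin 6) :
    symp X (P.alog k) = 0 := by
  fin_cases k <;>
    simp [alog, symp_smul_right, symp_add_right, symp_sub_right, symp_neg_right, h]

theorem symp_alog_alog (j k : Fin 6) : symp (P.alog j) (P.alog k) = 0 :=
  P.symp_alog_right (P.symp_alog_lw j) k

theorem symp_alog_flog (j : Fin 6) : symp (P.alog j) P.flog = 0 := by
  simp [flog, symp_smul_right, symp_add_right, symp_sub_right, symp_alog_lw]

theorem symp_alog_glog (j : Fin 6) : symp (P.alog j) P.glog = 0 := by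
  simp [glog, symp_smul_right, symp_add_right, symp_sub_right, symp_alog_lw]

theorem symp_flog_glog : symp P.flog P.glog = 2 := by
  simp [flog, glog, symp_smul_right, symp_add_right, symp_sub_right, symp_smul_left,
    symp_add_left, symp_sub_left, symp_lw_lw, cartanA]
  norm_num

theorem symp_lw_plog_of_eq (i : Fin 2) (m : ZMod 2) (j : Fin 2) (m' n' : ZMod 2) :
    symp (P.lw i m m) (plog j m' n') = 0 := by
  rw [P.lw_eq_plog i rfl, symp_plog_plog]

theorem symp_lw_plog_of_ne (i : Fin 2) {m n : ZMod 2} (h : m ≠ n) (j : Fin 2) (m' n' : ZMod 2) :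
    symp (P.lw i m n) (plog j m' n') =
      -cartanA i j * ((if n = n' then 1 else 0) + if m = m' then 1 else 0) := by
  rw [P.lw_eq_add i h, symp_sub_left, symp_add_left, symp_plog_plog, symp_hlog_plog_true,
    symp_hlog_plog_false]
  split_ifs <;> ring

/-- The common shear of all `w_i`. -/
def lam (i : Fin 2) : LogMonom :=
  P.hlog false 0 i + P.hlog false 1 i - P.hlog true 0 i - P.hlog true 1 i

theorem shearTot_eq (X : LogMonom) : P.shearTot X =
    (P.shear 1 1 + P.shear 0 0 + P.shear 0 1 + P.shear 1 0) X := rfl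

/-- Among the four R matrices, m^+ is paired with both minus points and n^- with both plus points,
so the total shear does not depend on (m, n). -/
theorem shearTot_lw (i : Fin 2) (m n : ZMod 2) : P.shearTot (P.lw i m n) = P.lam i := by
  simp only [shearTot, shear_lw, lam]
  have h : ∀ k : ZMod 2, k = 0 ∨ k = 1 := by decide
  rcases h m with rfl | rfl <;> rcases h n with rfl | rfl <;> simp <;> abel

theorem shearTot_smul (r : ℚ) (X : LogMonom) : P.shearTot (r • X) = r • P.shearTot X := by
  simp only [shearTot_eq, map_smul]

theorem shearTot_add (X Y : LogMonom) : P.shearTot (X + Y) = P.shearTot X + P.shearTot Y := by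
  simp only [shearTot_eq, map_add]

theorem shearTot_sub (X Y : LogMonom) : P.shearTot (X - Y) = P.shearTot X - P.shearTot Y := by
  simp only [shearTot_eq, map_sub]

theorem lam_add : P.lam 0 + P.lam 1 = (0, 0, P.ctot) := by
  have h : P.lam 0 + P.lam 1 = (P.hlog false 0 0 + P.hlog false 0 1) +
      (P.hlog false 1 0 + P.hlog false 1 1) - (P.hlog true 0 0 + P.hlog true 0 1) -
      (P.hlog true 1 0 + P.hlog true 1 1) := by
    simp only [lam]; abel
  rw [h]
  simp only [hlog_add]
  simp [ctot]

theorem shearTot_alog (j : Fin 6) :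
    P.shearTot (P.alog j) = ![0, 0, (0, 0, -P.ctot / 4), (0, 0, P.ctot / 4), 0, 0] j := by
  have h : ∀ r : ℚ, r • ((0, 0, P.ctot) : LogMonom) = (0, 0, r * P.ctot) := fun r => by
    simp [Rat.smul_def]
  fin_cases j <;>
    simp only [alog, shearTot_smul, shearTot_add, shearTot_sub, shearTot_lw, lam_add, h,
      sub_self, smul_zero, Fin.reduceFinMk, Matrix.cons_val]
  · simp; ring
  · simp; ring

/-- The four variables in w_i^{01} w_i^{10} are those in w_i^{00} w_i^{11}, so the two products
differ by the diagonal operator `lam i`. Hence `glog - flog` is a quarter of `lam 0 - lam 1`, which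
is half of the total shear of `flog`. -/
theorem flog_add_shearTot : P.flog + P.shearTot P.flog = (2 : ℚ) • P.glog - P.flog := by
  simp only [flog, glog, shearTot_smul, shearTot_add, shearTot_sub, shearTot_lw, lam]
  rw [P.lw_eq_plog 0 (rfl : (1 : ZMod 2) = 1), P.lw_eq_plog 0 (rfl : (0 : ZMod 2) = 0),
    P.lw_eq_plog 1 (rfl : (1 : ZMod 2) = 1), P.lw_eq_plog 1 (rfl : (0 : ZMod 2) = 0),
    P.lw_eq_add 0 zero_ne_one, P.lw_eq_add 1 zero_ne_one, P.lw_eq_add 0 one_ne_zero,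
    P.lw_eq_add 1 one_ne_zero]
  have h : ∀ i, plog i 0 1 + plog i 1 0 = plog i 0 0 + plog i 1 1 := fun i => by
    simp [plog, pair]; abel
  have h₀ := eq_sub_of_add_eq (h 0)
  have h₁ := eq_sub_of_add_eq (h 1)
  rw [h₀, h₁]
  module

theorem glog_sub_shearTot : P.glog - P.shearTot P.glog = (2 : ℚ) • P.flog - P.glog := by
  have h : P.shearTot P.glog = P.shearTot P.flog := by
    simp only [glog, flog, shearTot_smul, shearTot_add, shearTot_sub, shearTot_lw]
  rw [h, eq_sub_of_add_eq' P.flog_add_shearTot]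
  module

/-! ### The time evolution of the lattice variables -/

theorem H_conj_wexp_alog (j : Fin 6) :
    P.H⁻¹ * P.wexp (P.alog j) * P.H = P.wexp (P.alog j + P.shearTot (P.alog j)) := by
  refine P.H_conj_wexp fun i => ?_
  simp only [← symp_plog_right]
  fin_cases j <;> refine ⟨?_, ?_, ?_, ?_⟩ <;>
    simp [alog, symp_smul_left, symp_add_left, symp_sub_left, symp_neg_left, shear_lw,
      symp_lw_plog_of_eq, symp_lw_plog_of_ne, symp_hlog_plog_true, symp_hlog_plog_false] <;>
    fin_cases i <;> norm_num [cartanA]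

/-- The two diagonal R matrices only shear. After these shears the logarithm pairs with α_0, α_1 to
-2, 2 on each off-diagonal pair, which is the case where the infinite products collapse. -/
theorem H_conj_wexp_flog :
    P.H⁻¹ * P.wexp P.flog * P.H =
      P.wFactor 1 1 0 1 * (P.wFactor (-1) 0 0 1)⁻¹ *
        (P.wFactor 1 1 1 0 * (P.wFactor (-1) 0 1 0)⁻¹ * P.wexp (P.flog + P.shearTot P.flog)) := by
  have h₁ : ∀ i, P.flog.2.1 (pair 1 1 i) = 0 := fun i => by
    rw [← symp_plog_right]
    simp [flog, symp_smul_left, symp_add_left, symp_sub_left, symp_lw_plog_of_eq]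
  have h₂ : ∀ i, (P.flog + P.shear 1 1 P.flog).2.1 (pair 0 0 i) = 0 := fun i => by
    rw [← symp_plog_right]
    simp [flog, symp_smul_left, symp_add_left, symp_sub_left, symp_lw_plog_of_eq, shear_lw,
      symp_hlog_plog_true, symp_hlog_plog_false]
  have h₃ : ∀ i, (P.flog + P.shear 1 1 P.flog + P.shear 0 0 P.flog).2.1 (pair 0 1 i) =
      -cartanA 0 i := fun i => by
    rw [← symp_plog_right]
    simp [flog, symp_smul_left, symp_add_left, symp_sub_left, symp_lw_plog_of_eq, shear_lw,
      symp_hlog_plog_true, symp_hlog_plog_false]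
    fin_cases i <;> norm_num [cartanA]
  have h₄ : ∀ i, (P.flog + P.shear 1 1 P.flog + P.shear 0 0 P.flog + P.shear 0 1 P.flog).2.1
      (pair 1 0 i) = -cartanA 0 i := fun i => by
    rw [← symp_plog_right]
    simp [flog, symp_smul_left, symp_add_left, symp_sub_left, symp_neg_left,
      symp_lw_plog_of_eq, shear_lw, symp_hlog_plog_true, symp_hlog_plog_false]
    fin_cases i <;> norm_num [cartanA]
  -- The factors produced by `R 0 1` live on points not touched by `R 1 0`, so the last conjugation
  -- leaves them unchanged.
  have h₅ : Commute (P.R 1 0) (P.wFactor 1 1 0 1 * (P.wFactor (-1) 0 0 1)⁻¹) :=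
    (commute_wFactor P (P.R_commute_w 1 one_ne_zero zero_ne_one) 1).mul_right
      (commute_wFactor P (P.R_commute_w 0 one_ne_zero zero_ne_one) (-1)).inv_right
  have c₁ : ((-cartanA 0 1 : ℚ) : ℂ) = 2 := by norm_num [cartanA]
  have c₀ : ((-cartanA 0 0 : ℚ) : ℂ) = -2 := by norm_num [cartanA]
  rw [H_conj, P.R_conj_wexp h₁, P.R_conj_wexp h₂]
  simp only [map_add, shear_shear, add_zero]
  rw [P.R_conj_wexp_of_ne zero_ne_one ((h₃ 1).trans (by simpa using c₁))
    ((h₃ 0).trans (by simpa using c₀))]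
  simp only [map_add, shear_shear, add_zero]
  rw [← mul_assoc (P.R 1 0)⁻¹, (h₅.inv_left).eq, mul_assoc, mul_assoc, ← mul_assoc (P.R 1 0)⁻¹,
    P.R_conj_wexp_of_ne one_ne_zero ((h₄ 1).trans (by simpa using c₁))
    ((h₄ 0).trans (by simpa using c₀))]
  simp only [map_add, shear_shear, add_zero, shearTot, add_assoc]

/-- The mirror image of `H_conj_wexp_flog`: under the inverse evolution the off-diagonal R matrices
act first and only shear, after which the pairings on the diagonal pairs are 2, -2. -/
theorem H_conj_inv_wexp_glog :
    P.H * P.wexp P.glog * P.H⁻¹ =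
      P.wexp (P.glog - P.shearTot P.glog) * (P.wFactor 1 1 1 1 * (P.wFactor (-1) 0 1 1)⁻¹) *
        (P.wFactor 1 1 0 0 * (P.wFactor (-1) 0 0 0)⁻¹) := by
  have h₁ : ∀ i, (P.glog - P.shear 1 0 P.glog).2.1 (pair 1 0 i) = 0 := fun i => by
    rw [← symp_plog_right]
    simp [glog, symp_smul_left, symp_add_left, symp_sub_left, symp_lw_plog_of_ne, shear_lw,
      symp_hlog_plog_true, symp_hlog_plog_false]
    fin_cases i <;> norm_num [cartanA]
  have h₂ : ∀ i, (P.glog - P.shear 1 0 P.glog - P.shear 0 1 P.glog).2.1 (pair 0 1 i) = 0 :=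
    fun i => by
    rw [← symp_plog_right]
    simp [glog, symp_smul_left, symp_add_left, symp_sub_left, symp_lw_plog_of_ne, shear_lw,
      symp_hlog_plog_true, symp_hlog_plog_false]
    fin_cases i <;> norm_num [cartanA]
  have h₃ : ∀ i, (P.glog - P.shear 1 0 P.glog - P.shear 0 1 P.glog - P.shear 0 0 P.glog).2.1
      (pair 0 0 i) = cartanA 0 i := fun i => by
    rw [← symp_plog_right]
    simp [glog, symp_smul_left, symp_add_left, symp_sub_left, symp_neg_left,
      symp_lw_plog_of_ne, shear_lw, symp_hlog_plog_true, symp_hlog_plog_false]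
    fin_cases i <;> norm_num [cartanA]
  have h₄ : ∀ i, (P.glog - P.shear 1 0 P.glog - P.shear 0 1 P.glog - P.shear 0 0 P.glog -
      P.shear 1 1 P.glog).2.1 (pair 1 1 i) = cartanA 0 i := fun i => by
    rw [← symp_plog_right]
    simp [glog, symp_smul_left, symp_add_left, symp_sub_left, symp_neg_left,
      symp_lw_plog_of_ne, shear_lw, symp_hlog_plog_true, symp_hlog_plog_false]
    fin_cases i <;> norm_num [cartanA]
  have h₅ : Commute (P.R 1 1) (P.wFactor 1 1 0 0 * (P.wFactor (-1) 0 0 0)⁻¹) :=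
    (commute_wFactor P (P.R_commute_w 1 one_ne_zero one_ne_zero) 1).mul_right
      (commute_wFactor P (P.R_commute_w 0 one_ne_zero one_ne_zero) (-1)).inv_right
  have c₁ : (cartanA 0 1 : ℂ) = -2 := by norm_num [cartanA]
  have c₀ : (cartanA 0 0 : ℂ) = 2 := by norm_num [cartanA]
  rw [H_conj_inv, P.R_conj_inv_wexp _ rfl h₁, P.R_conj_inv_wexp (P.glog - P.shear 1 0 P.glog -
    P.shear 0 1 P.glog) (by simp only [map_sub, shear_shear, sub_zero]) h₂,
    P.R_conj_inv_wexp_of_eq (P.glog - P.shear 1 0 P.glog - P.shear 0 1 P.glog - P.shear 0 0 P.glog)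
    (by simp only [map_sub, shear_shear, sub_zero]) ((h₃ 1).trans c₁) ((h₃ 0).trans c₀),
    ← mul_assoc (P.R 1 1), mul_assoc _ _ (P.R 1 1)⁻¹, ← (h₅.inv_left).eq, ← mul_assoc,
    P.R_conj_inv_wexp_of_eq (P.glog - P.shear 1 0 P.glog - P.shear 0 1 P.glog -
    P.shear 0 0 P.glog - P.shear 1 1 P.glog)
    (by simp only [map_sub, shear_shear, sub_zero]) ((h₄ 1).trans c₁) ((h₄ 0).trans c₀)]
  congr 3
  simp only [shearTot]
  abel_nf

/-! ### Scaled monomials -/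

/-- A scalar multiple of a Weyl-ordered exponential. -/
def wmon (z : ℂˣ) (X : LogMonom) : Opˣ := scal z * P.wexp X

/-- With all commutators vanishing, an identity between products of monomials splits into one
identity of scalars and one linear identity of logarithms; the fourth root statements and the
formulas for p and t are proved in this way. -/
theorem wmon_mul {z z' : ℂˣ} {X Y : LogMonom} (h : symp X Y = 0) :
    P.wmon z X * P.wmon z' Y = P.wmon (z * z') (X + Y) := by
  rw [wmon, wmon, scal_mul_mul_scal_mul, P.wexp_mul_of_symp_eq_zero h, wmon]

theorem wmon_inv (z : ℂˣ) (X : LogMonom) : (P.wmon z X)⁻¹ = P.wmon z⁻¹ (-X) := by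
  rw [wmon, wmon, mul_inv_rev, scal_inv, wexp_neg, ← scal_inv]
  exact commute_scal _ _

theorem wmon_pow (z : ℂˣ) (X : LogMonom) (n : ℕ) :
    P.wmon z X ^ n = P.wmon (z ^ n) ((n : ℚ) • X) := by
  rw [wmon, wmon, (scal_commute _ _).mul_pow, wexp_pow, scal_pow]

theorem wmon_commute {z z' : ℂˣ} {X Y : LogMonom} (h : symp X Y = 0) :
    Commute (P.wmon z X) (P.wmon z' Y) :=
  (scal_commute _ _).mul_left ((commute_scal _ _).mul_right (P.wexp_commute h))

theorem scal_mul_wmon (z z' : ℂˣ) (X : LogMonom) :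
    scal z * P.wmon z' X = P.wmon (z * z') X := by
  rw [wmon, wmon, scal_mul, mul_assoc]

theorem a_eq_wmon (j : Fin 6) : P.a j = P.wmon (P.ascal j) (P.alog j) := P.a_eq j

theorem w_eq_wmon (i : Fin 2) (m n : ZMod 2) : P.w i m n = P.wmon (P.qq ^ 2) (P.lw i m n) :=
  P.w_eq i m n

theorem F_eq_wmon : P.F = P.wmon (-(P.qpow 1)⁻¹) P.flog := rfl

theorem G_eq_wmon : P.G = P.wmon (-(P.qpow 1)⁻¹) P.glog := rfl

theorem wmon_congr {z z' : ℂˣ} {X Y : LogMonom} (hz : z = z') (hX : X = Y) :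
    P.wmon z X = P.wmon z' Y := by rw [hz, hX]

theorem Del_eq (m n : ZMod 2) : P.Del m n = P.wmon (P.qq ^ 4) (P.lw 0 m n + P.lw 1 m n) := by
  rw [Del, w_eq_wmon, w_eq_wmon, wmon_mul]
  · rw [← pow_add]
  · simp [symp_lw_lw]

theorem a_commute_w (j : Fin 6) (i : Fin 2) (m n : ZMod 2) : Commute (P.a j) (P.w i m n) := by
  rw [a_eq_wmon, w_eq_wmon]
  exact P.wmon_commute (P.symp_alog_lw j i m n)

theorem a_commute_a (j k : Fin 6) : Commute (P.a j) (P.a k) := by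
  rw [a_eq_wmon, a_eq_wmon]
  exact P.wmon_commute (P.symp_alog_alog j k)

theorem a_commute_F (j : Fin 6) : Commute (P.a j) P.F := by
  rw [a_eq_wmon, F_eq_wmon]
  exact P.wmon_commute (P.symp_alog_flog j)

theorem a_commute_G (j : Fin 6) : Commute (P.a j) P.G := by
  rw [a_eq_wmon, G_eq_wmon]
  exact P.wmon_commute (P.symp_alog_glog j)

theorem F_mul_G : P.F * P.G = scal (P.qpow 2) * (P.G * P.F) := by
  rw [F_eq_wmon, G_eq_wmon, wmon, wmon, scal_mul_mul_scal_mul, scal_mul_mul_scal_mul,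
    wexp_mul_comm, symp_flog_glog, ← mul_assoc, ← mul_assoc, (scal_commute _ (scal _)).eq]
  simp only [mul_assoc]

theorem fourth_root_F : (scal (-P.qpow 1) * P.F) ^ 4 =
    P.w 0 1 1 * P.w 0 0 0 * (P.w 1 0 0 * P.w 1 1 1)⁻¹ := by
  rw [F_eq_wmon, scal_mul_wmon, wmon_pow]
  simp only [w_eq_wmon]
  rw [wmon_mul, wmon_mul, wmon_inv, wmon_mul]
  · refine P.wmon_congr ?_ ?_
    · simp
    · simp only [flog]; push_cast; module
  all_goals simp [symp_add_left, symp_add_right, symp_neg_right, symp_lw_lw]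

theorem fourth_root_G : (scal (-P.qpow 1) * P.G) ^ 4 =
    P.w 0 1 0 * P.w 0 0 1 * (P.w 1 0 1 * P.w 1 1 0)⁻¹ := by
  rw [G_eq_wmon, scal_mul_wmon, wmon_pow]
  simp only [w_eq_wmon]
  rw [wmon_mul, wmon_mul, wmon_inv, wmon_mul]
  · refine P.wmon_congr ?_ ?_
    · simp
    · simp only [glog]; push_cast; module
  all_goals simp [symp_add_left, symp_add_right, symp_neg_right, symp_lw_lw]

theorem w_mul_w_inv {i j : Fin 2} {m n m' n' : ZMod 2}
    (h : symp (P.lw i m n) (P.lw j m' n') = 0) :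
    P.w i m n * (P.w j m' n')⁻¹ = P.wmon 1 (P.lw i m n - P.lw j m' n') := by
  rw [w_eq_wmon, w_eq_wmon, wmon_inv, wmon_mul]
  · exact P.wmon_congr (by simp) (sub_eq_add_neg _ _).symm
  · rw [symp_neg_right, h, neg_zero]

theorem fourth_root_a :
    P.a 0 ^ 4 = P.w 0 0 1 * (P.w 0 1 0)⁻¹ ∧ P.a 1 ^ 4 = P.w 1 0 1 * (P.w 1 1 0)⁻¹ ∧
    P.a 2 ^ 4 = (P.Del 0 1)⁻¹ ∧ P.a 3 ^ 4 = P.Del 1 1 ∧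
    P.a 4 ^ 4 = P.w 1 0 0 * (P.w 1 1 1)⁻¹ ∧ P.a 5 ^ 4 = P.w 0 0 0 * (P.w 0 1 1)⁻¹ := by
  refine ⟨?_, ?_, ?_, ?_, ?_, ?_⟩
  · rw [w_mul_w_inv _ (by simp [symp_lw_lw]), a_eq_wmon, wmon_pow]
    exact P.wmon_congr (by simp [ascal]) (by simp only [alog, Matrix.cons_val]; module)
  · rw [w_mul_w_inv _ (by simp [symp_lw_lw]), a_eq_wmon, wmon_pow]
    exact P.wmon_congr (by simp [ascal]) (by simp only [alog, Matrix.cons_val]; module)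
  · rw [Del_eq, wmon_inv, a_eq_wmon, wmon_pow]
    exact P.wmon_congr (by simp [ascal]) (by simp only [alog, Matrix.cons_val]; module)
  · rw [Del_eq, a_eq_wmon, wmon_pow]
    exact P.wmon_congr (by simp [ascal]) (by simp only [alog, Matrix.cons_val]; module)
  · rw [w_mul_w_inv _ (by simp [symp_lw_lw]), a_eq_wmon, wmon_pow]
    exact P.wmon_congr (by simp [ascal]) (by simp only [alog, Matrix.cons_val]; module)
  · rw [w_mul_w_inv _ (by simp [symp_lw_lw]), a_eq_wmon, wmon_pow]
    exact P.wmon_congr (by simp [ascal]) (by simp only [alog, Matrix.cons_val]; module)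

/-- The logarithm of `t`. -/
def tlog : LogMonom := (1 / 4 : ℚ) • (P.lw 0 1 1 + P.lw 1 1 1 + P.lw 1 0 0 + P.lw 0 0 0)

/-- The logarithm of `p⁻¹ t`. -/
def ulog : LogMonom := (1 / 4 : ℚ) • (P.lw 0 0 1 + P.lw 0 1 0 + P.lw 1 0 1 + P.lw 1 1 0)

theorem pt_t : P.pt.t = P.wmon (P.qq ^ 2) P.tlog := by
  change P.a 3 ^ 2 * P.a 4 * P.a 5 = _
  simp only [a_eq_wmon]
  rw [wmon_pow, wmon_mul, wmon_mul]
  · refine P.wmon_congr (by simp [ascal]) ?_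
    simp only [alog, tlog, Matrix.cons_val]; module
  all_goals simp [symp_add_left, symp_smul_left, symp_alog_alog]

theorem pt_p_eq_wmon : P.pt.p = P.wmon 1 (P.tlog - P.ulog) := by
  change P.a 0 * P.a 1 * P.a 2 ^ 2 * P.a 3 ^ 2 * P.a 4 * P.a 5 = _
  simp only [a_eq_wmon]
  rw [wmon_pow, wmon_pow, wmon_mul, wmon_mul, wmon_mul, wmon_mul, wmon_mul]
  · refine P.wmon_congr (by simp [ascal]) ?_
    simp only [alog, tlog, ulog, Matrix.cons_val]; module
  all_goals simp [symp_add_left, symp_smul_left, symp_smul_right, symp_alog_alog]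

/-- The exchange of w_i^{01} w_i^{10} for w_i^{00} w_i^{11} leaves a multiple of `lam 0 + lam 1`,
which is central because h_0 + h_1 acts as a scalar at each point. Hence p is a scalar. -/
theorem tlog_sub_ulog : P.tlog - P.ulog = (0, 0, -P.ctot / 4) := by
  have h : P.tlog - P.ulog = -(1 / 4 : ℚ) • (P.lam 0 + P.lam 1) := by
    simp only [tlog, ulog, lam]
    rw [P.lw_eq_plog 0 (rfl : (1 : ZMod 2) = 1), P.lw_eq_plog 0 (rfl : (0 : ZMod 2) = 0),
      P.lw_eq_plog 1 (rfl : (1 : ZMod 2) = 1), P.lw_eq_plog 1 (rfl : (0 : ZMod 2) = 0),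
      P.lw_eq_add 0 zero_ne_one, P.lw_eq_add 1 zero_ne_one, P.lw_eq_add 0 one_ne_zero,
      P.lw_eq_add 1 one_ne_zero]
    have h : ∀ i, plog i 0 1 + plog i 1 0 = plog i 0 0 + plog i 1 1 := fun i => by
      simp [plog, pair]; abel
    rw [eq_sub_of_add_eq (h 0), eq_sub_of_add_eq (h 1)]
    module
  rw [h, lam_add]
  simp [Rat.smul_def]
  ring

theorem pt_p : P.pt.p = scal (P.qpow (-P.ctot / 4)) := by
  rw [pt_p_eq_wmon, tlog_sub_ulog, wmon, scal_one, one_mul, wexp_scalar]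

theorem Del_mul_Del : P.Del 0 0 * P.Del 1 1 = P.wmon (P.qq ^ 8) ((4 : ℚ) • P.tlog) := by
  rw [Del_eq, Del_eq, wmon_mul]
  · exact P.wmon_congr (by rw [← pow_add]) (by simp only [tlog]; module)
  · simp [symp_add_left, symp_add_right, symp_lw_lw]

theorem pt_t_pow : P.pt.t ^ 4 = P.Del 0 0 * P.Del 1 1 := by
  rw [Del_mul_Del, pt_t]
  exact (P.wmon_pow _ _ 4).trans (P.wmon_congr (by rw [← pow_mul]) (by norm_num))

end QLattice.Params

/-! ### Commuting families and ring inverses -/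

open scoped Ring

/-- Pairwise commuting elements of a group are the values of a homomorphism on monomials. -/
theorem exists_monomialHom {ι G : Type*} [Fintype ι] [DecidableEq ι] [Group G] (a : ι → G)
    (h : ∀ i j, Commute (a i) (a j)) :
    ∃ m : Multiplicative (ι → ℤ) →* G, (∀ i, m (.ofAdd (Pi.single i 1)) = a i) ∧
      ∀ g, (∀ i, Commute (a i) g) → ∀ e, Commute (m e) g := by
  have hc : Pairwise fun i j => ∀ x y : Multiplicative ℤ,
      Commute (zpowersHom G (a i) x) (zpowersHom G (a j) y) := fun i j _ x y => by
    simp only [zpowersHom_apply]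
    exact (h i j).zpow_zpow _ _
  let toPi : Multiplicative (ι → ℤ) →* (ι → Multiplicative ℤ) :=
    { toFun := fun e i => .ofAdd (e.toAdd i)
      map_one' := rfl
      map_mul' := fun _ _ => rfl }
  refine ⟨(MonoidHom.noncommPiCoprod (fun i => zpowersHom G (a i)) hc).comp toPi, fun i => ?_,
    fun g hg e => ?_⟩
  · have : toPi (.ofAdd (Pi.single i 1)) = Pi.mulSingle i (.ofAdd 1) := by
      ext j
      by_cases hj : j = i
      · subst hj; simp [toPi]
      · simp [toPi, hj]
    rw [MonoidHom.comp_apply, this, MonoidHom.noncommPiCoprod_mulSingle]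
    simp
  · refine (MonoidHom.commute_noncommPiCoprod (fun i => zpowersHom G (a i))
      (hcomm := hc) (fun i x => ?_) _).symm
    rw [zpowersHom_apply]
    exact ((hg i).zpow_left _).symm

theorem map_ringInverse_equiv {A B F : Type*} [MonoidWithZero A] [MonoidWithZero B]
    [EquivLike F A B] [MulEquivClass F A B] (φ : F) (a : A) : φ a⁻¹ʳ = (φ a)⁻¹ʳ := by
  have : MonoidWithZeroHomClass F A B := inferInstance
  by_cases h : IsUnit a
  · obtain ⟨u, rfl⟩ := h
    rw [Ring.inverse_unit]
    exact (Ring.inverse_unit (Units.map (φ : A →* B) u)).symm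
  · rw [Ring.inverse_non_unit _ h, Ring.inverse_non_unit, map_zero]
    rwa [isUnit_map_iff]

/-! ### The reflections as substitutions, and their involutivity -/

namespace QWeyl

namespace Pt

variable {D : Type*} [Ring D]

theorem s_two_F (x : Pt D) : (x.s 2).F = x.F * (↑(x.a 0 * (x.a 1)⁻¹) * x.G + ↑(x.a 2 ^ 2)) *
    (↑(x.a 0 * (x.a 1)⁻¹ * x.a 2 ^ 2) * x.G + 1)⁻¹ʳ := rfl

theorem s_three_G (x : Pt D) : (x.s 3).G = (↑(x.a 3 ^ 2 * x.a 4 * (x.a 5)⁻¹) * x.F + 1) *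
    (↑(x.a 4 * (x.a 5)⁻¹) * x.F + ↑(x.a 3 ^ 2))⁻¹ʳ * x.G := rfl

theorem s_F (x : Pt D) {i : Fin 6} (h : i ≠ 2) : (x.s i).F = x.F := if_neg h

theorem s_G (x : Pt D) {i : Fin 6} (h : i ≠ 3) : (x.s i).G = x.G := if_neg h

theorem s_a (x : Pt D) (i j : Fin 6) : (x.s i).a j = x.a i ^ (-cartan i j) * x.a j := rfl

theorem cartan_self (i : Fin 6) : cartan i i = 2 := by
  fin_cases i <;> rfl

theorem s_s_a (x : Pt D) (i j : Fin 6) : ((x.s i).s i).a j = x.a j := by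
  have h : (x.s i).a i = (x.a i)⁻¹ := by
    rw [s_a, cartan_self, zpow_neg, inv_mul_eq_iff_eq_mul, eq_mul_inv_iff_mul_eq]
    exact (zpow_two _).symm
  rw [s_a, h, s_a, inv_zpow, inv_mul_cancel_left]

theorem s_s_of_ne (x : Pt D) {i : Fin 6} (h₂ : i ≠ 2) (h₃ : i ≠ 3) : (x.s i).s i = x :=
  Pt.ext (funext fun j => s_s_a x i j) (by rw [s_F _ h₂, s_F _ h₂]) (by rw [s_G _ h₃, s_G _ h₃])

/-- s_2 inverts a_2 and fixes a_0 a_1⁻¹ and G, so numerator and denominator change places up to the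
factor a_2⁻² common to both; the second substitution cancels the first. -/
theorem s_two_s_two (x : Pt D) {X Y : Dˣ}
    (hX : ↑(x.a 0 * (x.a 1)⁻¹) * x.G + ↑(x.a 2 ^ 2) = (X : D))
    (hY : ↑(x.a 0 * (x.a 1)⁻¹ * x.a 2 ^ 2) * x.G + 1 = (Y : D))
    (h₀ : Commute (x.a 2) (x.a 0)) (h₁ : Commute (x.a 2) (x.a 1))
    (hG : Commute (x.a 2 : D) x.G) : (x.s 2).s 2 = x := by
  refine Pt.ext (funext fun j => s_s_a x 2 j) ?_ (by rw [s_G _ (by decide), s_G _ (by decide)])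
  have a₀ : (x.s 2).a 0 = x.a 2 * x.a 0 := by
    rw [s_a]; exact congrArg (· * _) (zpow_one _)
  have a₁ : (x.s 2).a 1 = x.a 2 * x.a 1 := by
    rw [s_a]; exact congrArg (· * _) (zpow_one _)
  have a₂ : (x.s 2).a 2 = (x.a 2)⁻¹ := by
    rw [s_a, cartan_self, zpow_neg, inv_mul_eq_iff_eq_mul, eq_mul_inv_iff_mul_eq]
    exact (zpow_two _).symm
  set b := x.a 0 * (x.a 1)⁻¹ with hb
  set c := x.a 2 ^ 2 with hc
  have hcb : Commute c b := (h₀.mul_right h₁.inv_right).pow_left 2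
  have hb' : (x.s 2).a 0 * ((x.s 2).a 1)⁻¹ = b := by
    rw [a₀, a₁, h₁.eq, mul_inv_rev, h₀.eq, hb]; group
  have hcG : Commute (c : D) x.G := by rw [hc, Units.val_pow_eq_pow_val]; exact hG.pow_left 2
  have hcX : Commute c X := Units.ext (by
    rw [Units.val_mul, Units.val_mul, ← hX]
    exact (Commute.mul_right (congrArg Units.val hcb) hcG).add_right (Commute.refl _))
  have hcY : Commute c Y := Units.ext (by
    rw [Units.val_mul, Units.val_mul, ← hY]
    exact (Commute.mul_right (congrArg Units.val (hcb.mul_right (Commute.refl c))) hcG).add_right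
      (Commute.one_right _))
  have hX' : ↑((x.s 2).a 0 * ((x.s 2).a 1)⁻¹) * (x.s 2).G + ↑((x.s 2).a 2 ^ 2) =
      ((c⁻¹ * Y : Dˣ) : D) := by
    rw [hb', a₂, inv_pow, ← hc, s_G _ (by decide), Units.val_mul c⁻¹, ← hY, mul_add, mul_one,
      ← mul_assoc, ← Units.val_mul, ← hcb.eq, inv_mul_cancel_left]
  have hY' : ↑((x.s 2).a 0 * ((x.s 2).a 1)⁻¹ * (x.s 2).a 2 ^ 2) * (x.s 2).G + 1 =
      ((c⁻¹ * X : Dˣ) : D) := by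
    rw [hb', a₂, inv_pow, ← hc, s_G _ (by decide), Units.val_mul c⁻¹, ← hX, mul_add, ← mul_assoc,
      ← Units.val_mul, ← Units.val_mul, inv_mul_cancel, Units.val_one, hcb.inv_left.eq]
  rw [s_two_F, hX', hY', s_two_F, hX, hY]
  simp only [Ring.inverse_unit, mul_assoc, ← Units.val_mul]
  have : X * (Y⁻¹ * (c⁻¹ * (Y * (c⁻¹ * X)⁻¹))) = 1 := by
    rw [hcY.inv_left.left_comm, inv_mul_cancel_left, mul_inv_rev, inv_inv, ← hcX.inv_right.eq,
      inv_mul_cancel_left, mul_inv_cancel]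
  rw [this, Units.val_one, mul_one]

/-- As for s_2, with a_3⁻² as the common factor; the multiplier of G now stands on the left, so the
cancellation takes place there. -/
theorem s_three_s_three (x : Pt D) {X Y : Dˣ}
    (hX : ↑(x.a 4 * (x.a 5)⁻¹) * x.F + ↑(x.a 3 ^ 2) = (X : D))
    (hY : ↑(x.a 3 ^ 2 * x.a 4 * (x.a 5)⁻¹) * x.F + 1 = (Y : D))
    (h₄ : Commute (x.a 3) (x.a 4)) (h₅ : Commute (x.a 3) (x.a 5))
    (hF : Commute (x.a 3 : D) x.F) : (x.s 3).s 3 = x := by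
  refine Pt.ext (funext fun j => s_s_a x 3 j) (by rw [s_F _ (by decide), s_F _ (by decide)]) ?_
  have a₄ : (x.s 3).a 4 = x.a 3 * x.a 4 := by
    rw [s_a]; exact congrArg (· * _) (zpow_one _)
  have a₅ : (x.s 3).a 5 = x.a 3 * x.a 5 := by
    rw [s_a]; exact congrArg (· * _) (zpow_one _)
  have a₃ : (x.s 3).a 3 = (x.a 3)⁻¹ := by
    rw [s_a, cartan_self, zpow_neg, inv_mul_eq_iff_eq_mul, eq_mul_inv_iff_mul_eq]
    exact (zpow_two _).symm
  set b := x.a 4 * (x.a 5)⁻¹ with hb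
  set c := x.a 3 ^ 2 with hc
  have hcb : Commute c b := (h₄.mul_right h₅.inv_right).pow_left 2
  have hb' : (x.s 3).a 4 * ((x.s 3).a 5)⁻¹ = b := by
    rw [a₄, a₅, h₅.eq, mul_inv_rev, h₄.eq, hb]; group
  rw [mul_assoc, ← hb] at hY
  have hcF : Commute (c : D) x.F := by rw [hc, Units.val_pow_eq_pow_val]; exact hF.pow_left 2
  have hcX : Commute c X := Units.ext (by
    rw [Units.val_mul, Units.val_mul, ← hX]
    exact (Commute.mul_right (congrArg Units.val hcb) hcF).add_right (Commute.refl _))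
  have hcY : Commute c Y := Units.ext (by
    rw [Units.val_mul, Units.val_mul, ← hY]
    exact (Commute.mul_right (congrArg Units.val ((Commute.refl c).mul_right hcb)) hcF).add_right
      (Commute.one_right _))
  have hX' : ↑((x.s 3).a 4 * ((x.s 3).a 5)⁻¹) * (x.s 3).F + ↑((x.s 3).a 3 ^ 2) =
      ((c⁻¹ * Y : Dˣ) : D) := by
    rw [hb', a₃, inv_pow, ← hc, s_F _ (by decide), Units.val_mul c⁻¹, ← hY, mul_add, mul_one,
      ← mul_assoc, ← Units.val_mul, inv_mul_cancel_left]
  have hY' : ↑((x.s 3).a 3 ^ 2 * (x.s 3).a 4 * ((x.s 3).a 5)⁻¹) * (x.s 3).F + 1 =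
      ((c⁻¹ * X : Dˣ) : D) := by
    rw [mul_assoc ((x.s 3).a 3 ^ 2), hb', a₃, inv_pow, ← hc, s_F _ (by decide), Units.val_mul c⁻¹ X,
      ← hX, mul_add,
      ← mul_assoc ((c⁻¹ : Dˣ) : D), ← Units.val_mul, ← Units.val_mul, inv_mul_cancel,
      Units.val_one]
  rw [s_three_G, hX', hY', s_three_G, mul_assoc c, ← hb, hX, hY]
  simp only [Ring.inverse_unit, ← mul_assoc, ← Units.val_mul]
  have : c⁻¹ * X * (c⁻¹ * Y)⁻¹ * Y * X⁻¹ = 1 := by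
    calc c⁻¹ * X * (c⁻¹ * Y)⁻¹ * Y * X⁻¹ = c⁻¹ * (X * Y⁻¹) * c * Y * X⁻¹ := by group
      _ = 1 := by rw [(hcX.inv_left.mul_right hcY.inv_left.inv_right).eq]; group
  rw [this, Units.val_one, one_mul]

/-- Substitution commutes with automorphisms. -/
theorem map_s [Algebra ℂ D] (φ : D ≃ₐ[ℂ] D) (i : Fin 6) (x : Pt D) :
    (x.map φ).s i = (x.s i).map φ := by
  refine Pt.ext (funext fun j => ?_) ?_ ?_
  · simp [s, map]
  · by_cases h : i = 2
    · subst h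
      simp [s, map, map_ringInverse_equiv]
    · simp [s, map, h]
  · by_cases h : i = 3
    · subst h
      simp [s, map, map_ringInverse_equiv]
    · simp [s, map, h]

theorem map_σ [Algebra ℂ D] (φ : D ≃ₐ[ℂ] D) (q : ℂ) (x : Pt D) : (x.map φ).σ q = (x.σ q).map φ := by
  refine Pt.ext (funext fun j => ?_) ?_ ?_
  · fin_cases j <;> rfl
  · simp [σ, map, map_ringInverse_equiv]
  · simp [σ, map, map_ringInverse_equiv]

theorem map_mul [Algebra ℂ D] (φ ψ : D ≃ₐ[ℂ] D) (x : Pt D) : x.map (φ * ψ) = (x.map ψ).map φ := rfl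

end Pt

/-! ### Invertible factors and exponent vectors of monomials -/

namespace Pt

variable {D : Type*} [Ring D]

/-- The factors of the `q`-Painlevé VI equations, as units. -/
structure Factors (x : Pt D) where
  (F G A₁ B₁ A₂ B₂ C₁ E₁ C₂ E₂ : Dˣ)
  hF : x.F = F
  hG : x.G = G
  hA₁ : (G : D) + ↑(x.p⁻¹ * x.a 1 ^ (-2 : ℤ) * x.t) = A₁
  hB₁ : (G : D) + ↑(x.p * x.a 0 ^ (-2 : ℤ) * x.t⁻¹) = B₁
  hA₂ : (G : D) + ↑(x.p⁻¹ * x.a 1 ^ (2 : ℤ) * x.t) = A₂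
  hB₂ : (G : D) + ↑(x.p * x.a 0 ^ (2 : ℤ) * x.t⁻¹) = B₂
  hC₁ : (F : D) + ↑(x.a 4 ^ (2 : ℤ) * x.t) = C₁
  hE₁ : (F : D) + ↑(x.a 5 ^ (2 : ℤ) * x.t⁻¹) = E₁
  hC₂ : (F : D) + ↑(x.a 4 ^ (-2 : ℤ) * x.t) = C₂
  hE₂ : (F : D) + ↑(x.a 5 ^ (-2 : ℤ) * x.t⁻¹) = E₂

/-- Up to `q⁻²`, the right-hand side of the equation for `T(F)`. -/
def Factors.M {x : Pt D} (f : Factors x) : Dˣ :=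
  x.p ^ 2 * x.t⁻¹ ^ 2 * (f.A₁ * f.B₁⁻¹) * (f.A₂ * f.B₂⁻¹) * f.F⁻¹

/-- Up to `q⁻²`, the right-hand side of the equation for `T⁻¹(G)`. -/
def Factors.N {x : Pt D} (f : Factors x) : Dˣ :=
  x.t⁻¹ ^ 2 * f.G⁻¹ * (f.C₁ * f.E₁⁻¹) * (f.C₂ * f.E₂⁻¹)

end Pt

open Pt

theorem IsQPVI.of_factors {D : Type*} [Ring D] [Algebra ℂ D] {q : ℂ} {T : D ≃ₐ[ℂ] D} {x : Pt D}
    (f : Factors x)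
    (T_a : ∀ j : Fin 6, j ≠ 2 → j ≠ 3 → T (x.a j) = x.a j)
    (T_p : T x.p = x.p) (T_t : T x.t = ↑(x.p⁻¹ ^ 2 * x.t))
    (T_F : T f.F = (q ^ 2)⁻¹ • (f.M : D))
    (T_G : T.symm f.G = (q ^ 2)⁻¹ • (f.N : D)) : IsQPVI q T x where
  T_a := T_a
  T_p := T_p
  T_t := T_t
  unit_F := f.hF ▸ f.F.isUnit
  unit_G := f.hG ▸ f.G.isUnit
  unit_G₁ := by rw [f.hG, f.hB₁]; exact f.B₁.isUnit
  unit_G₂ := by rw [f.hG, f.hB₂]; exact f.B₂.isUnit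
  unit_F₁ := by rw [f.hF, f.hE₁]; exact f.E₁.isUnit
  unit_F₂ := by rw [f.hF, f.hE₂]; exact f.E₂.isUnit
  T_F := by
    rw [f.hF, T_F, f.hG, f.hA₁, f.hA₂, f.hB₁, f.hB₂, Factors.M]
    simp only [Units.val_mul, Ring.inverse_unit]
  T_symm_G := by
    rw [f.hG, T_G, f.hF, f.hC₁, f.hC₂, f.hE₁, f.hE₂, Factors.N]
    simp only [Units.val_mul, Ring.inverse_unit]

namespace Pt

variable {D : Type*} [Ring D]

/-- Monomials in the `a_j`, parametrized by their exponents. -/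
abbrev MonomialHom (D : Type*) [Ring D] : Type _ := Multiplicative (Fin 6 → ℤ) →* Dˣ

/-- The values of the `a_j` at the point `x` are the monomials with exponents `e j`. -/
def HasExp (m : MonomialHom D) (x : Pt D) (e : Fin 6 → Fin 6 → ℤ) : Prop :=
  ∀ j, x.a j = m (.ofAdd (e j))

/-- The action of the simple reflections on exponents. -/
def sExp (i : Fin 6) (e : Fin 6 → Fin 6 → ℤ) : Fin 6 → Fin 6 → ℤ :=
  fun j k => -cartan i j * e i k + e j k

/-- The action of the diagram automorphism on exponents. -/
def σExp (e : Fin 6 → Fin 6 → ℤ) : Fin 6 → Fin 6 → ℤ :=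
  ![e 1, e 0, e 2, e 3, e 5, e 4]

/-- The exponents of the generators. -/
def genExp : Fin 6 → Fin 6 → ℤ :=
  ![![1, 0, 0, 0, 0, 0], ![0, 1, 0, 0, 0, 0], ![0, 0, 1, 0, 0, 0], ![0, 0, 0, 1, 0, 0],
    ![0, 0, 0, 0, 1, 0], ![0, 0, 0, 0, 0, 1]]

theorem HasExp.s {m : MonomialHom D} {x : Pt D} {e : Fin 6 → Fin 6 → ℤ} (h : HasExp m x e)
    (i : Fin 6) : HasExp m (x.s i) (sExp i e) := fun j => by
  rw [s_a, h, h, ← map_zpow, ← _root_.map_mul]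
  rfl

theorem HasExp.σ [Algebra ℂ D] {m : MonomialHom D} {x : Pt D} {e : Fin 6 → Fin 6 → ℤ}
    (h : HasExp m x e) (q : ℂ) : HasExp m (x.σ q) (σExp e) := fun j => by
  fin_cases j
  exacts [h 1, h 0, h 2, h 3, h 5, h 4]

theorem HasExp.p {m : MonomialHom D} {x : Pt D} {e : Fin 6 → Fin 6 → ℤ} (h : HasExp m x e)
    {k : Fin 6 → ℤ} (hk : k = e 0 + e 1 + 2 • e 2 + 2 • e 3 + e 4 + e 5) :
    x.p = m (.ofAdd k) := by
  rw [hk, Pt.p]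
  simp only [h _, ← map_pow, ← _root_.map_mul]
  rfl

theorem HasExp.t {m : MonomialHom D} {x : Pt D} {e : Fin 6 → Fin 6 → ℤ} (h : HasExp m x e)
    {k : Fin 6 → ℤ} (hk : k = 2 • e 3 + e 4 + e 5) : x.t = m (.ofAdd k) := by
  rw [hk, Pt.t]
  simp only [h _, ← map_pow, ← _root_.map_mul]
  rfl

theorem exists_hasExp [Algebra ℂ D] {q : ℂ} {x : Pt D} (h : Relations q x) :
    ∃ m : MonomialHom D, HasExp m x genExp ∧
      ∀ g : Dˣ, (∀ i, Commute (x.a i : D) g) → ∀ e, Commute (m e) g := by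
  obtain ⟨m, hm, hc⟩ := exists_monomialHom x.a h.aa
  refine ⟨m, fun j => ?_, fun g hg => hc g fun i => Units.ext (hg i)⟩
  rw [← hm j]
  congr 2
  revert j
  decide

section SimpleReflections

variable {m : MonomialHom D} {y : Pt D} {e : Fin 6 → Fin 6 → ℤ} {F G : Dˣ}

theorem commute_of_add_eq {g F u A : Dˣ} (hF : Commute g F) (hu : Commute g u)
    (hA : (F : D) + u = A) : Commute g A := Units.ext <| by
  rw [Units.val_mul, Units.val_mul, ← hA]
  exact Commute.add_right (congrArg Units.val hF) (congrArg Units.val hu)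

/-- Pulling out the coefficient of G leaves G plus a monomial, the form in which the factors of the
equations are given. The hypothesis on exponents says which of them occurs. -/
theorem num_s_two (hy : HasExp m y e) (hG : y.G = G) {B : Dˣ} {v : Fin 6 → ℤ}
    (hB : (G : D) + ↑(m (.ofAdd v)) = B) (hv : e 0 - e 1 + v = 2 • e 2) :
    ↑(y.a 0 * (y.a 1)⁻¹) * y.G + ↑(y.a 2 ^ 2) = ((m (.ofAdd (e 0 - e 1)) * B : Dˣ) : D) := by
  have h₁ : y.a 0 * (y.a 1)⁻¹ = m (.ofAdd (e 0 - e 1)) := by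
    rw [hy, hy, ← map_inv, ← _root_.map_mul, ← ofAdd_neg, ← ofAdd_add, sub_eq_add_neg]
  have h₂ : y.a 2 ^ 2 = m (.ofAdd (e 0 - e 1)) * m (.ofAdd v) := by
    rw [hy, ← map_pow, ← _root_.map_mul, ← ofAdd_nsmul, ← ofAdd_add, hv]
  rw [h₁, h₂, hG, Units.val_mul, Units.val_mul, ← hB, mul_add]

theorem den_s_two (hy : HasExp m y e) (hG : y.G = G) {A : Dˣ} {u : Fin 6 → ℤ}
    (hA : (G : D) + ↑(m (.ofAdd u)) = A) (hu : e 0 - e 1 + 2 • e 2 + u = 0) :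
    ↑(y.a 0 * (y.a 1)⁻¹ * y.a 2 ^ 2) * y.G + 1 =
      ((m (.ofAdd (e 0 - e 1 + 2 • e 2)) * A : Dˣ) : D) := by
  have h₁ : y.a 0 * (y.a 1)⁻¹ * y.a 2 ^ 2 = m (.ofAdd (e 0 - e 1 + 2 • e 2)) := by
    rw [hy, hy, hy, ← map_inv, ← map_pow, ← _root_.map_mul, ← _root_.map_mul, ← ofAdd_neg,
      ← ofAdd_nsmul, ← ofAdd_add, ← ofAdd_add, sub_eq_add_neg]
  have h₂ : m (.ofAdd (e 0 - e 1 + 2 • e 2)) * m (.ofAdd u) = 1 := by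
    rw [← _root_.map_mul, ← ofAdd_add, hu, ofAdd_zero, _root_.map_one]
  rw [h₁, hG, Units.val_mul, ← hA, mul_add, ← Units.val_mul _ (m (.ofAdd u)), h₂, Units.val_one]

theorem s_two_F_eq (hy : HasExp m y e) (hG : y.G = G) (hmG : ∀ k, Commute (m k) G) {A B : Dˣ}
    {u v : Fin 6 → ℤ} (hB : (G : D) + ↑(m (.ofAdd v)) = B) (hA : (G : D) + ↑(m (.ofAdd u)) = A)
    (hv : e 0 - e 1 + v = 2 • e 2) (hu : e 0 - e 1 + 2 • e 2 + u = 0) :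
    (y.s 2).F = y.F * ((B * A⁻¹ * m (.ofAdd (-(2 • e 2))) : Dˣ) : D) := by
  rw [s_two_F, num_s_two hy hG hB hv, den_s_two hy hG hA hu, Ring.inverse_unit, mul_assoc,
    ← Units.val_mul, mul_inv_rev, ← map_inv, ← ofAdd_neg]
  have h : m (.ofAdd (-(2 • e 2))) = m (.ofAdd (e 0 - e 1)) *
      m (.ofAdd (-(e 0 - e 1 + 2 • e 2))) := by
    rw [← _root_.map_mul, ← ofAdd_add]
    congr 2; abel
  have hc := (commute_of_add_eq (hmG (.ofAdd (e 0 - e 1))) ((Commute.all _ _).map m) hB).mul_right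
    (commute_of_add_eq (hmG (.ofAdd (e 0 - e 1))) ((Commute.all _ _).map m) hA).inv_right
  rw [h, ← mul_assoc (B * A⁻¹), ← hc.eq]
  simp only [mul_assoc]

theorem s_two_s_two_eq (hy : HasExp m y e) (hG : y.G = G) (hmG : ∀ k, Commute (m k) G) {A B : Dˣ}
    {u v : Fin 6 → ℤ} (hB : (G : D) + ↑(m (.ofAdd v)) = B) (hA : (G : D) + ↑(m (.ofAdd u)) = A)
    (hv : e 0 - e 1 + v = 2 • e 2) (hu : e 0 - e 1 + 2 • e 2 + u = 0) : (y.s 2).s 2 = y := by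
  have hc : ∀ i j, Commute (y.a i) (y.a j) := fun i j => by
    rw [hy, hy]; exact (Commute.all _ _).map m
  refine s_two_s_two y (num_s_two hy hG hB hv) (den_s_two hy hG hA hu) (hc _ _) (hc _ _) ?_
  rw [hy, hG]
  exact congrArg Units.val (hmG _)

/-- After σ the variable F has become a conjugate of F⁻¹. Conjugating back and multiplying by F
turns the factors of s_3 into factors F + u. -/
theorem conj_inv_add_one {F G u A : Dˣ} (hu : Commute u G) (hA : (F : D) + u = A) :
    (u : D) * ↑(G⁻¹ * F⁻¹ * G) + 1 = ((G⁻¹ * (A * F⁻¹) * G : Dˣ) : D) := by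
  have h₁ : u * (G⁻¹ * F⁻¹ * G) = G⁻¹ * (u * (F⁻¹ * G)) := by
    rw [← mul_assoc, ← mul_assoc, hu.inv_right.eq]; simp only [mul_assoc]
  have h₂ : (1 : D) = ((G⁻¹ * (F * (F⁻¹ * G)) : Dˣ) : D) := by
    rw [mul_inv_cancel_left, inv_mul_cancel, Units.val_one]
  rw [← Units.val_mul, h₁, h₂, mul_assoc G⁻¹, mul_assoc A]
  simp only [Units.val_mul _ (_ * (F⁻¹ * G)), Units.val_mul _ (F⁻¹ * G)]
  rw [← mul_add, ← add_mul, ← hA, add_comm (F : D)]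

theorem num_s_three (hy : HasExp m y e) (hF : y.F = ↑(G⁻¹ * F⁻¹ * G)) (hmG : ∀ k, Commute (m k) G)
    {C : Dˣ} {k : Fin 6 → ℤ} (hC : (F : D) + ↑(m (.ofAdd k)) = C) (hk : 2 • e 3 + e 4 - e 5 = k) :
    ↑(y.a 3 ^ 2 * y.a 4 * (y.a 5)⁻¹) * y.F + 1 = ((G⁻¹ * (C * F⁻¹) * G : Dˣ) : D) := by
  have h₁ : y.a 3 ^ 2 * y.a 4 * (y.a 5)⁻¹ = m (.ofAdd k) := by
    rw [hy, hy, hy, ← map_inv, ← map_pow, ← _root_.map_mul, ← _root_.map_mul, ← ofAdd_neg,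
      ← ofAdd_nsmul, ← ofAdd_add, ← ofAdd_add, ← sub_eq_add_neg, hk]
  rw [h₁, hF, conj_inv_add_one (hmG _) hC]

theorem den_s_three (hy : HasExp m y e) (hF : y.F = ↑(G⁻¹ * F⁻¹ * G)) (hmG : ∀ k, Commute (m k) G)
    {E : Dˣ} {k : Fin 6 → ℤ} (hE : (F : D) + ↑(m (.ofAdd k)) = E) (hk : e 4 - e 5 = 2 • e 3 + k) :
    ↑(y.a 4 * (y.a 5)⁻¹) * y.F + ↑(y.a 3 ^ 2) =
      ((m (.ofAdd (2 • e 3)) * (G⁻¹ * (E * F⁻¹) * G) : Dˣ) : D) := by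
  have h₁ : y.a 4 * (y.a 5)⁻¹ = m (.ofAdd (2 • e 3)) * m (.ofAdd k) := by
    rw [hy, hy, ← map_inv, ← _root_.map_mul, ← _root_.map_mul, ← ofAdd_neg, ← ofAdd_add,
      ← ofAdd_add, ← hk, sub_eq_add_neg]
  have h₂ : y.a 3 ^ 2 = m (.ofAdd (2 • e 3)) := by
    rw [hy, ← map_pow, ← ofAdd_nsmul]
  rw [h₁, h₂, hF, Units.val_mul, Units.val_mul (m _), ← conj_inv_add_one (hmG _) hE, mul_add,
    mul_one, mul_assoc]

/-- The value of G is kept in the shape κ G⁻¹ r, which s_3 preserves, so the formula can be applied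
a second time to its own output. -/
theorem s_three_G_eq [Algebra ℂ D] (hy : HasExp m y e) (hF : y.F = ↑(G⁻¹ * F⁻¹ * G))
    (hmF : ∀ k, Commute (m k) F) (hmG : ∀ k, Commute (m k) G) {C E : Dˣ} {k l : Fin 6 → ℤ}
    (hC : (F : D) + ↑(m (.ofAdd k)) = C) (hE : (F : D) + ↑(m (.ofAdd l)) = E)
    (hk : 2 • e 3 + e 4 - e 5 = k) (hl : e 4 - e 5 = 2 • e 3 + l) {κ : ℂ} {r : Dˣ}
    (hG : y.G = κ • ((G⁻¹ * r : Dˣ) : D)) :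
    (y.s 3).G = κ • ((G⁻¹ * (C * E⁻¹ * m (.ofAdd (-(2 • e 3))) * r) : Dˣ) : D) := by
  rw [s_three_G, num_s_three hy hF hmG hC hk, den_s_three hy hF hmG hE hl, Ring.inverse_unit, hG,
    mul_smul_comm, ← Units.val_mul, ← Units.val_mul]
  have h := (hmG (.ofAdd (2 • e 3))).inv_left
  have hE' := (commute_of_add_eq (hmF (.ofAdd (2 • e 3))) ((Commute.all _ _).map m) hE).inv_left
  rw [ofAdd_neg, map_inv, mul_inv_rev (m _)]
  generalize (m (.ofAdd (2 • e 3)))⁻¹ = n at h hE'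
  rw [mul_assoc C, ← hE'.inv_right.eq]
  congr 2
  calc G⁻¹ * (C * F⁻¹) * G * ((G⁻¹ * (E * F⁻¹) * G)⁻¹ * n) * (G⁻¹ * r)
      = G⁻¹ * C * E⁻¹ * (G * n * G⁻¹) * r := by group
    _ = G⁻¹ * (C * (n * E⁻¹) * r) := by rw [← h.eq, hE'.inv_right.eq]; group

theorem s_three_s_three_eq (hy : HasExp m y e) (hF : y.F = ↑(G⁻¹ * F⁻¹ * G))
    (hmF : ∀ k, Commute (m k) F) (hmG : ∀ k, Commute (m k) G) {C E : Dˣ} {k l : Fin 6 → ℤ}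
    (hC : (F : D) + ↑(m (.ofAdd k)) = C) (hE : (F : D) + ↑(m (.ofAdd l)) = E)
    (hk : 2 • e 3 + e 4 - e 5 = k) (hl : e 4 - e 5 = 2 • e 3 + l) : (y.s 3).s 3 = y := by
  have hc : ∀ i j, Commute (y.a i) (y.a j) := fun i j => by
    rw [hy, hy]; exact (Commute.all _ _).map m
  refine s_three_s_three y (den_s_three hy hF hmG hE hl) (num_s_three hy hF hmG hC hk)
    (hc _ _) (hc _ _) ?_
  rw [hy, hF]
  exact congrArg Units.val (((hmG _).inv_right.mul_right (hmF _).inv_right).mul_right (hmG _))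

end SimpleReflections

end Pt

end QWeyl

theorem Ring.inverse_inv_smul {D : Type*} [Ring D] [Algebra ℂ D] {z : ℂ} (hz : z ≠ 0) (u : Dˣ) :
    (z⁻¹ • (u : D))⁻¹ʳ = z • ((u⁻¹ : Dˣ) : D) := by
  let w : Dˣ :=
    { val := z⁻¹ • (u : D)
      inv := z • ((u⁻¹ : Dˣ) : D)
      val_inv := by simp [hz]
      inv_val := by simp [hz] }
  exact Ring.inverse_unit w

/-! ### The two half words of T_3 and their values on F and G -/

namespace QWeyl.Pt

variable {D : Type*} [Ring D]

theorem HasExp.ext {m : MonomialHom D} {x y : Pt D} {e e' : Fin 6 → Fin 6 → ℤ} (hx : HasExp m x e)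
    (hy : HasExp m y e') (he : ∀ j k, e j k = e' j k) : x.a = y.a := by
  obtain rfl : e = e' := funext fun j => funext (he j)
  exact funext fun j => (hx j).trans (hy j).symm

namespace Factors

variable {x : Pt D} {m : MonomialHom D}

theorem monom_G (h : HasExp m x genExp) (i : Fin 6) (n : ℤ) {k : Fin 6 → ℤ}
    (hk : k = -(genExp 0 + genExp 1 + 2 • genExp 2 + 2 • genExp 3 + genExp 4 + genExp 5) +
      n • genExp i + (2 • genExp 3 + genExp 4 + genExp 5)) :
    x.p⁻¹ * x.a i ^ n * x.t = m (.ofAdd k) := by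
  rw [hk, h.p rfl, h.t rfl, h i, ← map_inv, ← map_zpow, ← _root_.map_mul, ← _root_.map_mul]
  rfl

theorem monom_G' (h : HasExp m x genExp) (i : Fin 6) (n : ℤ) {k : Fin 6 → ℤ}
    (hk : k = (genExp 0 + genExp 1 + 2 • genExp 2 + 2 • genExp 3 + genExp 4 + genExp 5) +
      n • genExp i - (2 • genExp 3 + genExp 4 + genExp 5)) :
    x.p * x.a i ^ n * x.t⁻¹ = m (.ofAdd k) := by
  rw [hk, h.p rfl, h.t rfl, h i, ← map_inv, ← map_zpow, ← _root_.map_mul, ← _root_.map_mul,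
    sub_eq_add_neg]
  rfl

theorem monom_F (h : HasExp m x genExp) (i : Fin 6) (n : ℤ) {k : Fin 6 → ℤ}
    (hk : k = n • genExp i + (2 • genExp 3 + genExp 4 + genExp 5)) :
    x.a i ^ n * x.t = m (.ofAdd k) := by
  rw [hk, h.t rfl, h i, ← map_zpow, ← _root_.map_mul]
  rfl

theorem monom_F' (h : HasExp m x genExp) (i : Fin 6) (n : ℤ) {k : Fin 6 → ℤ}
    (hk : k = n • genExp i - (2 • genExp 3 + genExp 4 + genExp 5)) :
    x.a i ^ n * x.t⁻¹ = m (.ofAdd k) := by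
  rw [hk, h.t rfl, h i, ← map_inv, ← map_zpow, ← _root_.map_mul, sub_eq_add_neg]
  rfl

theorem G_add_monom (f : Factors x) (h : HasExp m x genExp) :
    ((f.G : D) + ↑(m (.ofAdd ![-1, -3, -2, 0, 0, 0])) = f.A₁ ∧
      (f.G : D) + ↑(m (.ofAdd ![-1, 1, 2, 0, 0, 0])) = f.B₁) ∧
    (f.G : D) + ↑(m (.ofAdd ![-1, 1, -2, 0, 0, 0])) = f.A₂ ∧
      (f.G : D) + ↑(m (.ofAdd ![3, 1, 2, 0, 0, 0])) = f.B₂ := by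
  refine ⟨⟨?_, ?_⟩, ?_, ?_⟩
  · rw [← f.hA₁, ← monom_G h 1 (-2) (by decide)]
  · rw [← f.hB₁, ← monom_G' h 0 (-2) (by decide)]
  · rw [← f.hA₂, ← monom_G h 1 2 (by decide)]
  · rw [← f.hB₂, ← monom_G' h 0 2 (by decide)]

theorem F_add_monom (f : Factors x) (h : HasExp m x genExp) :
    ((f.F : D) + ↑(m (.ofAdd ![0, 0, 0, 2, 3, 1])) = f.C₁ ∧
      (f.F : D) + ↑(m (.ofAdd ![0, 0, 0, -2, -1, 1])) = f.E₁) ∧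
    (f.F : D) + ↑(m (.ofAdd ![0, 0, 0, 2, -1, 1])) = f.C₂ ∧
      (f.F : D) + ↑(m (.ofAdd ![0, 0, 0, -2, -1, -3])) = f.E₂ := by
  refine ⟨⟨?_, ?_⟩, ?_, ?_⟩
  · rw [← f.hC₁, ← monom_F h 4 2 (by decide)]
  · rw [← f.hE₁, ← monom_F' h 5 2 (by decide)]
  · rw [← f.hC₂, ← monom_F h 4 (-2) (by decide)]
  · rw [← f.hE₂, ← monom_F' h 5 (-2) (by decide)]

end Factors

theorem commute_of_add_monom {m : MonomialHom D} {F A B : Dˣ} (hmF : ∀ k, Commute (m k) F)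
    {k l : Multiplicative (Fin 6 → ℤ)} (hA : (F : D) + m k = A) (hB : (F : D) + m l = B) :
    Commute A B :=
  commute_of_add_eq (commute_of_add_eq (Commute.refl F) (hmF k).symm hA).symm
    (commute_of_add_eq (hmF l) ((Commute.all _ _).map m) hA).symm hB

/-- The images of the generators under `s_2 s_1 s_0 s_2`. -/
def reflG (x : Pt D) : Pt D := s 2 (s 0 (s 1 (s 2 x)))

section

variable {x : Pt D} {m : MonomialHom D}

theorem reflG_G (x : Pt D) : x.reflG.G = x.G := by
  rw [reflG, s_G _ (by decide), s_G _ (by decide), s_G _ (by decide), s_G _ (by decide)]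

theorem HasExp.reflG {e : Fin 6 → Fin 6 → ℤ} (h : HasExp m x e) :
    HasExp m x.reflG (sExp 2 (sExp 0 (sExp 1 (sExp 2 e)))) := (((h.s 2).s 1).s 0).s 2

/-- Each of the two s_2 contributes one quotient: B₁/A₂ at the original exponents, and B₂/A₁ after
s_2, s_1, s_0 have changed them. Everything built from G and monomials commutes, so only the total
monomial has to be compared. -/
theorem Factors.reflG_F (f : Factors x) (h : HasExp m x genExp) (hmG : ∀ k, Commute (m k) f.G) :
    x.reflG.F = ((f.M⁻¹ : Dˣ) : D) := by
  obtain ⟨⟨hA₁, hB₁⟩, hA₂, hB₂⟩ := f.G_add_monom h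
  have hw : (s 0 (s 1 (s 2 x))).G = f.G := by
    rw [s_G _ (by decide), s_G _ (by decide), s_G _ (by decide), f.hG]
  rw [reflG, s_two_F_eq (((h.s 2).s 1).s 0) hw hmG hB₂ hA₁ (by decide) (by decide),
    s_F _ (by decide), s_F _ (by decide), s_two_F_eq h f.hG hmG hB₁ hA₂ (by decide) (by decide),
    f.hF, ← Units.val_mul, ← Units.val_mul, Factors.M, h.p rfl, h.t rfl]
  have hm : ∀ k, Commute (m k) (f.B₂ * f.A₁⁻¹) := fun k =>
    (commute_of_add_eq (hmG k) ((Commute.all _ _).map m) hB₂).mul_right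
      (commute_of_add_eq (hmG k) ((Commute.all _ _).map m) hA₁).inv_right
  have hB : Commute f.B₁ (f.B₂ * f.A₂⁻¹) := (commute_of_add_monom hmG hB₁ hB₂).mul_right
    (commute_of_add_monom hmG hB₁ hA₂).inv_right
  have hA : Commute f.A₂⁻¹ f.B₂ := (commute_of_add_monom hmG hA₂ hB₂).inv_left
  rw [← map_pow m, ← map_inv m, ← map_pow m, ← _root_.map_mul m]
  generalize hk₁ : Multiplicative.ofAdd (-(2 • genExp 2)) = k₁
  generalize hk₂ : Multiplicative.ofAdd (-(2 • sExp 0 (sExp 1 (sExp 2 genExp)) 2)) = k₂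
  generalize hk : Multiplicative.ofAdd (_ : Fin 6 → ℤ) ^ 2 *
    (Multiplicative.ofAdd (_ : Fin 6 → ℤ))⁻¹ ^ 2 = k
  -- The two powers of a_2 left over by the reflections combine to p⁻² t², an identity of integer
  -- vectors.
  have hkk : k₁ * k₂ = k⁻¹ := by
    rw [← hk₁, ← hk₂, ← hk]
    decide
  congr 1
  calc f.F * (f.B₁ * f.A₂⁻¹ * m k₁) * (f.B₂ * f.A₁⁻¹ * m k₂)
      = f.F * f.B₁ * f.A₂⁻¹ * (m k₁ * (f.B₂ * f.A₁⁻¹)) * m k₂ := by simp only [mul_assoc]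
    _ = f.F * f.B₁ * (f.A₂⁻¹ * f.B₂) * f.A₁⁻¹ * (m k₁ * m k₂) := by
      rw [(hm k₁).eq]; simp only [mul_assoc]
    _ = f.F * (f.B₁ * (f.B₂ * f.A₂⁻¹)) * f.A₁⁻¹ * (m k)⁻¹ := by
      rw [hA.eq, ← _root_.map_mul, hkk, map_inv]; simp only [mul_assoc]
    _ = _ := by rw [hB.eq]; group

end

variable [Algebra ℂ D]

theorem σ_σ {q : ℂ} (hq : q ≠ 0) (x : Pt D) {F G : Dˣ} (hF : x.F = F) (hG : x.G = G) :
    (x.σ q).σ q = x := by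
  have hq₂ : q ^ 2 ≠ 0 := pow_ne_zero 2 hq
  refine Pt.ext (funext fun j => by fin_cases j <;> rfl) ?_ ?_
  · change (q ^ 2)⁻¹ • ((q ^ 2)⁻¹ • x.F⁻¹ʳ)⁻¹ʳ = x.F
    rw [hF, Ring.inverse_unit, Ring.inverse_inv_smul hq₂, inv_smul_smul₀ hq₂, inv_inv]
  · change (q ^ 2)⁻¹ • ((q ^ 2)⁻¹ • x.G⁻¹ʳ)⁻¹ʳ = x.G
    rw [hG, Ring.inverse_unit, Ring.inverse_inv_smul hq₂, inv_smul_smul₀ hq₂, inv_inv]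

/-- The relation F G = q² G F absorbs the scalar q⁻² into conjugation by G. -/
theorem σ_F {q : ℂ} (hq : q ≠ 0) {x : Pt D} {F G : Dˣ} (hF : x.F = F) (hG : x.G = G)
    (hFG : x.F * x.G = q ^ 2 • (x.G * x.F)) : (x.σ q).F = ↑(G⁻¹ * F⁻¹ * G) := by
  change (q ^ 2)⁻¹ • x.F⁻¹ʳ = _
  rw [inv_smul_eq_iff₀ (pow_ne_zero 2 hq), hF, Ring.inverse_unit]
  rw [hF, hG] at hFG
  calc ((F⁻¹ : Dˣ) : D) = ((G⁻¹ * F⁻¹ : Dˣ) : D) * (F * G) * ((F⁻¹ : Dˣ) : D) := by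
        simp only [← Units.val_mul]
        congr 1; group
    _ = q ^ 2 • ((G⁻¹ * F⁻¹ * G : Dˣ) : D) := by
        rw [hFG, mul_smul_comm, smul_mul_assoc]
        simp only [← Units.val_mul]
        congr 2; group


/-- The images of the generators under `σ s_3 s_5 s_4 s_3`. -/
def reflF (q : ℂ) (x : Pt D) : Pt D := s 3 (s 4 (s 5 (s 3 (σ q x))))

section

variable {x : Pt D} {m : MonomialHom D} {q : ℂ}

theorem reflF_F (q : ℂ) (x : Pt D) : (x.reflF q).F = (x.σ q).F := by
  rw [reflF, s_F _ (by decide), s_F _ (by decide), s_F _ (by decide), s_F _ (by decide)]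

theorem HasExp.reflF {e : Fin 6 → Fin 6 → ℤ} (h : HasExp m x e) (q : ℂ) :
    HasExp m (x.reflF q) (sExp 3 (sExp 4 (sExp 5 (sExp 3 (σExp e))))) :=
  ((((h.σ q).s 3).s 5).s 4).s 3

/-- The two s_3 contribute C₂/E₁ and then C₁/E₂. The factor q⁻² comes from σ alone. -/
theorem Factors.reflF_G (f : Factors x) (hq : q ≠ 0) (hFG : x.F * x.G = q ^ 2 • (x.G * x.F))
    (h : HasExp m x genExp) (hmF : ∀ k, Commute (m k) f.F) (hmG : ∀ k, Commute (m k) f.G) :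
    (x.reflF q).G = (q ^ 2)⁻¹ • (f.N : D) := by
  obtain ⟨⟨hC₁, hE₁⟩, hC₂, hE₂⟩ := f.F_add_monom h
  have hσ := σ_F hq f.hF f.hG hFG
  have hG : (x.σ q).G = (q ^ 2)⁻¹ • ((f.G⁻¹ * 1 : Dˣ) : D) := by
    change (q ^ 2)⁻¹ • x.G⁻¹ʳ = _
    rw [f.hG, Ring.inverse_unit, mul_one]
  have hw : (s 4 (s 5 (s 3 (x.σ q)))).F = ↑(f.G⁻¹ * f.F⁻¹ * f.G) := by
    rw [s_F _ (by decide), s_F _ (by decide), s_F _ (by decide), hσ]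
  have h₁ := s_three_G_eq (h.σ q) hσ hmF hmG hC₂ hE₁ (by decide) (by decide) hG
  rw [← s_G (s 3 (x.σ q)) (i := 5) (by decide), ← s_G (s 5 (s 3 (x.σ q))) (i := 4) (by decide)]
    at h₁
  rw [reflF, s_three_G_eq ((((h.σ q).s 3).s 5).s 4) hw hmF hmG hC₁ hE₂ (by decide) (by decide) h₁,
    Factors.N, h.t rfl]
  have hm : ∀ k, Commute (m k) (f.C₂ * f.E₁⁻¹) := fun k =>
    (commute_of_add_eq (hmF k) ((Commute.all _ _).map m) hC₂).mul_right
      (commute_of_add_eq (hmF k) ((Commute.all _ _).map m) hE₁).inv_right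
  have hm' : ∀ k, Commute (m k) (f.C₁ * f.E₁⁻¹) := fun k =>
    (commute_of_add_eq (hmF k) ((Commute.all _ _).map m) hC₁).mul_right
      (commute_of_add_eq (hmF k) ((Commute.all _ _).map m) hE₁).inv_right
  have hE : Commute f.E₂⁻¹ (f.C₂ * f.E₁⁻¹) :=
    ((commute_of_add_monom hmF hE₂ hC₂).mul_right
      (commute_of_add_monom hmF hE₂ hE₁).inv_right).inv_left
  have hC : Commute f.C₂ f.E₁⁻¹ := (commute_of_add_monom hmF hC₂ hE₁).inv_right
  rw [← map_inv m, ← map_pow m]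
  generalize hk₁ : Multiplicative.ofAdd (-(2 • σExp genExp 3)) = k₁
  generalize hk₂ :
    Multiplicative.ofAdd (-(2 • sExp 4 (sExp 5 (sExp 3 (σExp genExp))) 3)) = k₂
  generalize hk : (Multiplicative.ofAdd (_ : Fin 6 → ℤ))⁻¹ ^ 2 = k
  have hkk : k₂ * k₁ = k := by
    rw [← hk₁, ← hk₂, ← hk]
    decide
  congr 2
  calc f.G⁻¹ * (f.C₁ * f.E₂⁻¹ * m k₂ * (f.C₂ * f.E₁⁻¹ * m k₁ * 1))
      = f.G⁻¹ * f.C₁ * f.E₂⁻¹ * (m k₂ * (f.C₂ * f.E₁⁻¹)) * m k₁ := by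
        simp only [mul_assoc, mul_one]
    _ = f.G⁻¹ * f.C₁ * (f.E₂⁻¹ * (f.C₂ * f.E₁⁻¹)) * (m k₂ * m k₁) := by
      rw [(hm k₂).eq]; simp only [mul_assoc]
    _ = f.G⁻¹ * (f.C₁ * f.E₁⁻¹) * ((f.C₂ * f.E₂⁻¹) * m k) := by
      rw [hE.eq, ← _root_.map_mul, hkk, hC.eq]; simp only [mul_assoc]
    _ = _ := by
      have hm₂ : Commute (m k) (f.C₂ * f.E₂⁻¹) :=
        (commute_of_add_eq (hmF k) ((Commute.all _ _).map m) hC₂).mul_right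
          (commute_of_add_eq (hmF k) ((Commute.all _ _).map m) hE₂).inv_right
      rw [← hm₂.eq, ← mul_assoc, mul_assoc f.G⁻¹, ← (hm' k).eq, ← mul_assoc f.G⁻¹,
        ← (hmG k).inv_right.eq]

end

end QWeyl.Pt

/-! ### From the equations to T_3 and back -/

namespace QWeyl

namespace Pt

section

variable {D : Type*} [Ring D] {x : Pt D} {m : MonomialHom D}

theorem Factors.s_two_s_two (f : Factors x) (h : HasExp m x genExp)
    (hmG : ∀ k, Commute (m k) f.G) : (x.s 2).s 2 = x := by
  obtain ⟨⟨-, hB₁⟩, hA₂, -⟩ := f.G_add_monom h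
  exact s_two_s_two_eq h f.hG hmG hB₁ hA₂ (by decide) (by decide)

theorem Factors.s_two_s_two' (f : Factors x) (h : HasExp m x genExp)
    (hmG : ∀ k, Commute (m k) f.G) : s 2 x.reflG = s 0 (s 1 (s 2 x)) := by
  obtain ⟨⟨hA₁, -⟩, -, hB₂⟩ := f.G_add_monom h
  have hw : (s 0 (s 1 (s 2 x))).G = f.G := by
    rw [s_G _ (by decide), s_G _ (by decide), s_G _ (by decide), f.hG]
  exact s_two_s_two_eq (((h.s 2).s 1).s 0) hw hmG hB₂ hA₁ (by decide) (by decide)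

theorem Factors.undo_reflG (f : Factors x) (h : HasExp m x genExp)
    (hmG : ∀ k, Commute (m k) f.G) : s 2 (s 1 (s 0 (s 2 x.reflG))) = x := by
  rw [f.s_two_s_two' h hmG, s_s_of_ne _ (by decide) (by decide),
    s_s_of_ne _ (by decide) (by decide), f.s_two_s_two h hmG]

end

variable {D : Type*} [Ring D] [Algebra ℂ D]

theorem map_p (φ : D ≃ₐ[ℂ] D) (x : Pt D) : ((x.map φ).p : D) = φ x.p := by
  simp [p, map]

theorem map_t (φ : D ≃ₐ[ℂ] D) (x : Pt D) : ((x.map φ).t : D) = φ x.t := by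
  simp [t, map]

theorem map_F (φ : D ≃ₐ[ℂ] D) (x : Pt D) : (x.map φ).F = φ x.F := rfl

theorem map_G (φ : D ≃ₐ[ℂ] D) (x : Pt D) : (x.map φ).G = φ x.G := rfl

theorem σ_F_def (q : ℂ) (x : Pt D) : (x.σ q).F = (q ^ 2)⁻¹ • x.F⁻¹ʳ := rfl

theorem map_symm_map (φ : D ≃ₐ[ℂ] D) (x : Pt D) : (x.map φ).map φ.symm = x :=
  Pt.ext (funext fun _ => Units.ext (φ.symm_apply_apply _)) (φ.symm_apply_apply _)
    (φ.symm_apply_apply _)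

theorem T3_eq (q : ℂ) (x : Pt D) : x.T3 q = σ q (s 3 (s 5 (s 4 (s 3 x.reflG)))) := rfl

theorem T3inv_eq (q : ℂ) (x : Pt D) : x.T3inv q = s 2 (s 1 (s 0 (s 2 (x.reflF q)))) := rfl

theorem map_reflF (φ : D ≃ₐ[ℂ] D) (q : ℂ) (x : Pt D) :
    (x.map φ).reflF q = (x.reflF q).map φ := by
  simp only [reflF, map_s, map_σ]

theorem T3_F (q : ℂ) (x : Pt D) : (x.T3 q).F = (q ^ 2)⁻¹ • x.reflG.F⁻¹ʳ := by
  change (q ^ 2)⁻¹ • (s 3 (s 5 (s 4 (s 3 x.reflG)))).F⁻¹ʳ = _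
  rw [s_F _ (by decide), s_F _ (by decide), s_F _ (by decide), s_F _ (by decide)]

theorem T3inv_G (q : ℂ) (x : Pt D) : (x.T3inv q).G = (x.reflF q).G := by
  change (s 2 (s 1 (s 0 (s 2 (x.reflF q))))).G = _
  rw [s_G _ (by decide), s_G _ (by decide), s_G _ (by decide), s_G _ (by decide)]

/-- The exponents of the `T_3(a_j)`. -/
def T3Exp : Fin 6 → Fin 6 → ℤ :=
  ![![1, 0, 0, 0, 0, 0], ![0, 1, 0, 0, 0, 0], ![1, 1, 3, 2, 1, 1], ![-1, -1, -2, -1, -1, -1],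
    ![0, 0, 0, 0, 1, 0], ![0, 0, 0, 0, 0, 1]]

theorem HasExp.T3 {m : MonomialHom D} {x : Pt D} (h : HasExp m x genExp) (q : ℂ) :
    HasExp m (x.T3 q) T3Exp := by
  have h' : HasExp m (x.T3 q) (σExp (sExp 3 (sExp 5 (sExp 4 (sExp 3
    (sExp 2 (sExp 0 (sExp 1 (sExp 2 genExp))))))))) := ((((h.reflG.s 3).s 4).s 5).s 3).σ q
  intro j
  rw [h' j]
  congr 2
  revert j
  decide

section

variable {x : Pt D} {m : MonomialHom D} {q : ℂ}

theorem Factors.s_three_s_three (f : Factors x) (hq : q ≠ 0)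
    (hFG : x.F * x.G = q ^ 2 • (x.G * x.F)) (h : HasExp m x genExp)
    (hmF : ∀ k, Commute (m k) f.F) (hmG : ∀ k, Commute (m k) f.G) :
    ((x.σ q).s 3).s 3 = x.σ q := by
  obtain ⟨⟨-, hE₁⟩, hC₂, -⟩ := f.F_add_monom h
  exact s_three_s_three_eq (h.σ q) (σ_F hq f.hF f.hG hFG) hmF hmG hC₂ hE₁ (by decide) (by decide)

theorem Factors.s_three_s_three' (f : Factors x) (hq : q ≠ 0)
    (hFG : x.F * x.G = q ^ 2 • (x.G * x.F)) (h : HasExp m x genExp)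
    (hmF : ∀ k, Commute (m k) f.F) (hmG : ∀ k, Commute (m k) f.G) :
    s 3 (x.reflF q) = s 4 (s 5 (s 3 (x.σ q))) := by
  obtain ⟨⟨hC₁, -⟩, -, hE₂⟩ := f.F_add_monom h
  have hw : (s 4 (s 5 (s 3 (x.σ q)))).F = ↑(f.G⁻¹ * f.F⁻¹ * f.G) := by
    rw [s_F _ (by decide), s_F _ (by decide), s_F _ (by decide), σ_F hq f.hF f.hG hFG]
  exact s_three_s_three_eq ((((h.σ q).s 3).s 5).s 4) hw hmF hmG hC₁ hE₂ (by decide) (by decide)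

theorem Factors.undo_reflF (f : Factors x) (hq : q ≠ 0) (hFG : x.F * x.G = q ^ 2 • (x.G * x.F))
    (h : HasExp m x genExp) (hmF : ∀ k, Commute (m k) f.F) (hmG : ∀ k, Commute (m k) f.G) :
    σ q (s 3 (s 5 (s 4 (s 3 (x.reflF q))))) = x := by
  rw [f.s_three_s_three' hq hFG h hmF hmG, s_s_of_ne _ (by decide) (by decide),
    s_s_of_ne _ (by decide) (by decide), f.s_three_s_three hq hFG h hmF hmG,
    σ_σ hq x f.hF f.hG]

/-- The images of the generators under an automorphism satisfying the `q`-Painlevé VI equations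
are those under `T_3`. -/
theorem Factors.map_eq_T3 (f : Factors x) (hq : q ≠ 0) (hFG : x.F * x.G = q ^ 2 • (x.G * x.F))
    (h : HasExp m x genExp) (hmF : ∀ k, Commute (m k) f.F) (hmG : ∀ k, Commute (m k) f.G)
    {φ : D ≃ₐ[ℂ] D} (hφ : HasExp m (x.map φ) T3Exp) (hF : φ f.F = (q ^ 2)⁻¹ • (f.M : D))
    (hG : φ.symm f.G = (q ^ 2)⁻¹ • (f.N : D)) :
    x.map φ = x.T3 q ∧ x.map φ.symm = x.T3inv q := by
  have hq₂ : q ^ 2 ≠ 0 := pow_ne_zero 2 hq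
  -- T_3 is factored through its two half words. For F, applying `φ` to q⁻² F⁻¹ gives q⁻² (q⁻² M)⁻¹
  -- = M⁻¹; for G, `φ` undoes the given value of its inverse. Undoing either half word then
  -- determines `φ` or its inverse on all generators, including φ(G) and φ⁻¹(F), which the equations
  -- do not mention.
  have key : x.reflG = (x.reflF q).map φ := by
    refine Pt.ext ?_ ?_ ?_
    · rw [← map_reflF]
      exact h.reflG.ext (hφ.reflF q) (by decide)
    · rw [f.reflG_F h hmG, map_F, reflF_F, σ_F_def, map_smul, map_ringInverse_equiv, f.hF,
        hF, Ring.inverse_inv_smul hq₂,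
        inv_smul_smul₀ hq₂]
    · rw [reflG_G, f.hG, map_G, f.reflF_G hq hFG h hmF hmG, ← hG, φ.apply_symm_apply]
  constructor
  · rw [T3_eq, key]
    simp only [map_s, map_σ]
    rw [f.undo_reflF hq hFG h hmF hmG]
  · rw [T3inv_eq, ← map_symm_map φ (x.reflF q), ← key]
    simp only [map_s]
    rw [f.undo_reflG h hmG]

/-- An automorphism inducing the substitution `T_3` satisfies the `q`-Painlevé VI equations. -/
theorem Factors.isQPVI_of_map_eq_T3 (f : Factors x) (hq : q ≠ 0)
    (hFG : x.F * x.G = q ^ 2 • (x.G * x.F))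
    (h : HasExp m x genExp) (hmF : ∀ k, Commute (m k) f.F) (hmG : ∀ k, Commute (m k) f.G)
    {φ : D ≃ₐ[ℂ] D} (h₁ : x.map φ = x.T3 q) (h₂ : x.map φ.symm = x.T3inv q) : IsQPVI q φ x := by
  have hT : HasExp m (x.map φ) T3Exp := h₁ ▸ h.T3 q
  refine IsQPVI.of_factors f (fun j hj₂ hj₃ => ?_) ?_ ?_ ?_ ?_
  · have hj : T3Exp j = genExp j := by
      revert j
      decide
    exact congrArg Units.val ((hT j).trans (hj ▸ h j).symm)
  · rw [← map_p, hT.p (k := ![1, 1, 2, 2, 1, 1]) (by decide),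
      h.p (k := ![1, 1, 2, 2, 1, 1]) (by decide)]
  · have hk : Multiplicative.ofAdd ![-2, -2, -4, -2, -1, -1] =
        (Multiplicative.ofAdd ![1, 1, 2, 2, 1, 1])⁻¹ ^ 2 *
          (Multiplicative.ofAdd ![0, 0, 0, 2, 1, 1] : Multiplicative (Fin 6 → ℤ)) := by decide
    rw [← map_t, hT.t (k := ![-2, -2, -4, -2, -1, -1]) (by decide),
      h.t (k := ![0, 0, 0, 2, 1, 1]) (by decide), h.p (k := ![1, 1, 2, 2, 1, 1]) (by decide),
      ← map_inv m, ← map_pow m, ← _root_.map_mul m, hk]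
  · rw [← f.hF]
    refine (congrArg Pt.F h₁).trans ?_
    rw [T3_F, f.reflG_F h hmG, Ring.inverse_unit, inv_inv]
  · rw [← f.hG]
    refine (congrArg Pt.G h₂).trans ?_
    rw [T3inv_G, f.reflF_G hq hFG h hmF hmG]

end

/-! ### Invertibility of the factors in a skew field -/

section DivisionRing

variable {K : Type*} [DivisionRing K] [Algebra ℂ K] {x : Pt K} {q : ℂ}

/-- If F were -u, it would commute with G, contradicting the twisted relation with c ≠ 1. -/
theorem add_ne_zero_of_mul_eq_smul {F G : K} {u : Kˣ} {c : ℂ} (hG : G ≠ 0) (hc : c ≠ 1)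
    (h : F * G = c • (G * F)) (hu : Commute (u : K) G) : F + u ≠ 0 := by
  intro h₀
  obtain rfl : F = -u := eq_neg_of_add_eq_zero_left h₀
  rw [neg_mul, mul_neg, ← hu.eq, smul_neg, neg_inj] at h
  have : (1 - c) • ((u : K) * G) = 0 := by rw [sub_smul, one_smul, ← h, sub_self]
  rcases smul_eq_zero.1 this with h' | h'
  · exact hc (sub_eq_zero.1 h').symm
  · exact mul_ne_zero u.ne_zero hG h'

/-- In a skew field the factors of the `q`-Painlevé VI equations are invertible. -/
theorem nonempty_factors (hx : Relations q x) (hq : q ≠ 0) (hq₂ : q ^ 2 ≠ 1)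
    (hF : x.F ≠ 0) (hG : x.G ≠ 0) : Nonempty (Factors x) := by
  obtain ⟨m, h, hm⟩ := exists_hasExp hx
  have hmF := hm (Units.mk0 x.F hF) hx.aF
  have hmG := hm (Units.mk0 x.G hG) hx.aG
  have hFm : ∀ {u : Kˣ}, (∃ k, u = m k) → x.F + u ≠ 0 := by
    rintro _ ⟨k, rfl⟩
    exact add_ne_zero_of_mul_eq_smul hG hq₂ hx.FG (congrArg Units.val (hmG k))
  have hGm : ∀ {u : Kˣ}, (∃ k, u = m k) → x.G + u ≠ 0 := by
    rintro _ ⟨k, rfl⟩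
    refine add_ne_zero_of_mul_eq_smul hF (c := (q ^ 2)⁻¹) (inv_ne_one.2 hq₂) ?_
      (congrArg Units.val (hmF k))
    rw [hx.FG, inv_smul_smul₀ (pow_ne_zero 2 hq)]
  exact ⟨
    { F := Units.mk0 x.F hF
      G := Units.mk0 x.G hG
      A₁ := Units.mk0 _ (hGm ⟨_, Factors.monom_G h 1 (-2) rfl⟩)
      B₁ := Units.mk0 _ (hGm ⟨_, Factors.monom_G' h 0 (-2) rfl⟩)
      A₂ := Units.mk0 _ (hGm ⟨_, Factors.monom_G h 1 2 rfl⟩)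
      B₂ := Units.mk0 _ (hGm ⟨_, Factors.monom_G' h 0 2 rfl⟩)
      C₁ := Units.mk0 _ (hFm ⟨_, Factors.monom_F h 4 2 rfl⟩)
      E₁ := Units.mk0 _ (hFm ⟨_, Factors.monom_F' h 5 2 rfl⟩)
      C₂ := Units.mk0 _ (hFm ⟨_, Factors.monom_F h 4 (-2) rfl⟩)
      E₂ := Units.mk0 _ (hFm ⟨_, Factors.monom_F' h 5 (-2) rfl⟩)
      hF := rfl
      hG := rfl
      hA₁ := rfl
      hB₁ := rfl
      hA₂ := rfl
      hB₂ := rfl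
      hC₁ := rfl
      hE₁ := rfl
      hC₂ := rfl
      hE₂ := rfl }⟩

end DivisionRing

/-! ### Automorphisms realizing the reflections -/

theorem map_mul_symm (φ ψ : D ≃ₐ[ℂ] D) (x : Pt D) :
    x.map (φ * ψ).symm = (x.map φ.symm).map ψ.symm := rfl

theorem map_symm_eq {φ : D ≃ₐ[ℂ] D} {x y : Pt D} (h : y.map φ = x) : x.map φ.symm = y := by
  rw [← h, map_symm_map]

/-- Automorphisms realizing the formulas for the simple reflections and for `σ` realize
`T_3` and its inverse. -/
theorem Factors.isQPVI_of_reflections {q : ℂ} {x : Pt D} (f : Factors x) (hq : q ≠ 0)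
    (hx : Relations q x) {s : Fin 6 → D ≃ₐ[ℂ] D} {σ : D ≃ₐ[ℂ] D} (hs : ∀ i, x.map (s i) = x.s i)
    (hσ : x.map σ = x.σ q) :
    IsQPVI q (s 2 * s 1 * s 0 * s 2 * s 3 * s 4 * s 5 * s 3 * σ) x := by
  obtain ⟨m, h, hm⟩ := exists_hasExp hx
  have hmF := hm f.F (f.hF ▸ hx.aF)
  have hmG := hm f.G (f.hG ▸ hx.aG)
  have hss : ∀ i, (x.s i).s i = x → x.map (s i).symm = x.s i := fun i hi =>
    map_symm_eq (by rw [← map_s, hs, hi])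
  have hσ' : x.map σ.symm = x.σ q :=
    map_symm_eq (by rw [← map_σ, hσ, σ_σ hq x f.hF f.hG])
  have h₀ := hss 0 (s_s_of_ne _ (by decide) (by decide))
  have h₁ := hss 1 (s_s_of_ne _ (by decide) (by decide))
  have h₂ := hss 2 (f.s_two_s_two h hmG)
  -- Involutivity of s_3 is available at the point transformed by σ, because that is where the
  -- factors F + u appear; it is carried back along the automorphism σ.
  have h₃ := hss 3 <| by
    have := f.s_three_s_three hq hx.FG h hmF hmG
    rw [← hσ, map_s, map_s] at this
    rw [← map_symm_map σ ((x.s 3).s 3), this, map_symm_map]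
  have h₄ := hss 4 (s_s_of_ne _ (by decide) (by decide))
  have h₅ := hss 5 (s_s_of_ne _ (by decide) (by decide))
  refine f.isQPVI_of_map_eq_T3 hq hx.FG h hmF hmG ?_ ?_
  · simp only [map_mul, hσ, ← map_s, ← map_σ, hs, T3]
  · simp only [map_mul_symm, h₀, h₁, h₂, h₃, h₄, h₅, ← map_s, hσ', T3inv]

end Pt

/-! ### Sums with monomials as products with factors 1 - zW -/

variable {D : Type*} [Ring D]

theorem add_eq_units_mul [Algebra ℂ D] {N W G u : Dˣ} {z : ℂ} (hN : (N : D) = 1 - z • (W : D))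
    (hu : (u : D) = (-z) • ((W * G : Dˣ) : D)) : (G : D) + u = ((N * G : Dˣ) : D) := by
  rw [hu, Units.val_mul, Units.val_mul, hN, sub_mul, one_mul, smul_mul_assoc, neg_smul,
    ← sub_eq_add_neg]

theorem add_eq_mul_units [Algebra ℂ D] {N W G v : Dˣ} {z : ℂ} (hN : (N : D) = 1 - z • (W : D))
    (hG : (G : D) = (-z) • ((v * W : Dˣ) : D)) : (G : D) + v = ((v * N : Dˣ) : D) := by
  rw [hG, Units.val_mul, Units.val_mul, hN, mul_sub, mul_one, mul_smul_comm, neg_smul,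
    neg_add_eq_sub]

/-- The factors, from the values of the monomials in them. -/
def Pt.Factors.mk' {x : Pt D} {F G A₁ B₁ A₂ B₂ C₁ E₁ C₂ E₂ : Dˣ}
    (hF : x.F = F) (hG : x.G = G)
    {u₁ v₁ u₂ v₂ y₁ z₁ y₂ z₂ : Dˣ}
    (hu₁ : x.p⁻¹ * x.a 1 ^ (-2 : ℤ) * x.t = u₁) (hA₁ : G + (u₁ : D) = A₁)
    (hv₁ : x.p * x.a 0 ^ (-2 : ℤ) * x.t⁻¹ = v₁) (hB₁ : G + (v₁ : D) = B₁)
    (hu₂ : x.p⁻¹ * x.a 1 ^ (2 : ℤ) * x.t = u₂) (hA₂ : G + (u₂ : D) = A₂)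
    (hv₂ : x.p * x.a 0 ^ (2 : ℤ) * x.t⁻¹ = v₂) (hB₂ : G + (v₂ : D) = B₂)
    (hy₁ : x.a 4 ^ (2 : ℤ) * x.t = y₁) (hC₁ : F + (y₁ : D) = C₁)
    (hz₁ : x.a 5 ^ (2 : ℤ) * x.t⁻¹ = z₁) (hE₁ : F + (z₁ : D) = E₁)
    (hy₂ : x.a 4 ^ (-2 : ℤ) * x.t = y₂) (hC₂ : F + (y₂ : D) = C₂)
    (hz₂ : x.a 5 ^ (-2 : ℤ) * x.t⁻¹ = z₂) (hE₂ : F + (z₂ : D) = E₂) : Factors x :=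
  ⟨F, G, A₁, B₁, A₂, B₂, C₁, E₁, C₂, E₂, hF, hG, hu₁ ▸ hA₁, hv₁ ▸ hB₁, hu₂ ▸ hA₂, hv₂ ▸ hB₂,
    hy₁ ▸ hC₁, hz₁ ▸ hE₁, hy₂ ▸ hC₂, hz₂ ▸ hE₂⟩

end QWeyl

/-- The `v` cancel against the denominators and the two copies of `g` move to the right. The pairing
is crossed: the equations put n₁ over m₁, whereas an R matrix produces n₂ with m₁. -/
theorem Commute.ratio_product_left {G : Type*} [Group G] {g n₁ m₁ n₂ m₂ v₁ v₂ : G}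
    (hv₁ : ∀ y ∈ [g, n₁, m₁, v₂], Commute v₁ y) (hv₂ : ∀ y ∈ [g, n₂, m₂, n₁, m₁], Commute v₂ y)
    (hg : ∀ y ∈ [n₂, m₁, m₂], Commute g y) (hn : Commute n₂ n₁) (hm : Commute n₂ m₁)
    (hnm : Commute n₁ m₁) :
    v₁ * v₂ * (n₁ * g * (v₁ * m₁)⁻¹) * (n₂ * g * (v₂ * m₂)⁻¹) =
      n₂ * m₁⁻¹ * (n₁ * m₂⁻¹) * g ^ 2 := by
  simp only [List.mem_cons, List.not_mem_nil, or_false, forall_eq_or_imp, forall_eq] at hv₁ hv₂ hg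
  obtain ⟨v₁g, v₁n, v₁m, v₁v⟩ := hv₁
  obtain ⟨v₂g, v₂n, v₂m, v₂n', v₂m'⟩ := hv₂
  obtain ⟨gn, gm, gm'⟩ := hg
  have h₁ : v₁ * (n₁ * g * (v₁ * m₁)⁻¹) = n₁ * m₁⁻¹ * g := by
    have : Commute v₁ (n₁ * g * m₁⁻¹) := (v₁n.mul_right v₁g).mul_right v₁m.inv_right
    rw [mul_inv_rev, ← mul_assoc (n₁ * g), ← mul_assoc v₁, this.eq, mul_inv_cancel_right,
      mul_assoc, gm.inv_right.eq, mul_assoc]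
  have h₂ : v₂ * (n₂ * g * (v₂ * m₂)⁻¹) = n₂ * m₂⁻¹ * g := by
    have : Commute v₂ (n₂ * g * m₂⁻¹) := (v₂n.mul_right v₂g).mul_right v₂m.inv_right
    rw [mul_inv_rev, ← mul_assoc (n₂ * g), ← mul_assoc v₂, this.eq, mul_inv_cancel_right,
      mul_assoc, gm'.inv_right.eq, mul_assoc]
  have h₃ : Commute v₂ (n₁ * m₁⁻¹ * g) := (v₂n'.mul_right v₂m'.inv_right).mul_right v₂g
  calc v₁ * v₂ * (n₁ * g * (v₁ * m₁)⁻¹) * (n₂ * g * (v₂ * m₂)⁻¹)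
      = v₂ * (v₁ * (n₁ * g * (v₁ * m₁)⁻¹)) * (n₂ * g * (v₂ * m₂)⁻¹) := by
        rw [v₁v.eq]; simp only [mul_assoc]
    _ = n₁ * m₁⁻¹ * (g * (n₂ * m₂⁻¹)) * g := by
        rw [h₁, h₃.eq, mul_assoc, h₂]; simp only [mul_assoc]
    _ = n₁ * (m₁⁻¹ * n₂) * m₂⁻¹ * g ^ 2 := by
        rw [(gn.mul_right gm'.inv_right).eq, sq]; simp only [mul_assoc]
    _ = n₂ * (n₁ * m₁⁻¹) * m₂⁻¹ * g ^ 2 := by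
        rw [← hm.inv_right.eq, ← mul_assoc, ← hn.eq]; simp only [mul_assoc]
    _ = n₂ * m₁⁻¹ * (n₁ * m₂⁻¹) * g ^ 2 := by
        rw [hnm.inv_right.eq]; simp only [mul_assoc]

/-! ### Matching the lattice factors with the factors of the equations -/

namespace QLattice.Params

open QLattice

variable (P : Params)

theorem wmon_zpow (z : ℂˣ) (X : LogMonom) (n : ℤ) :
    P.wmon z X ^ n = P.wmon (z ^ n) ((n : ℚ) • X) := by
  cases n with
  | ofNat n => simpa using P.wmon_pow z X n
  | negSucc n =>
    rw [zpow_negSucc, zpow_negSucc, wmon_pow, wmon_inv]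
    refine P.wmon_congr rfl ?_
    push_cast
    module

theorem symp_p (X : LogMonom) : symp (P.tlog - P.ulog) X = 0 := by
  rw [tlog_sub_ulog]
  simp [symp]

theorem symp_alog_tlog (j : Fin 6) : symp (P.alog j) P.tlog = 0 := by
  simp [tlog, symp_smul_right, symp_add_right, symp_alog_lw]

theorem symp_tlog_lw (i : Fin 2) (m n : ZMod 2) : symp P.tlog (P.lw i m n) = 0 := by
  by_cases h : m = n <;> fin_cases i <;>
    simp [tlog, symp_smul_left, symp_add_left, symp_lw_lw, cartanA, h]

theorem symp_lw_glog (i : Fin 2) {m n : ZMod 2} (h : m ≠ n) : symp (P.lw i m n) P.glog = 0 := by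
  simp [glog, symp_smul_right, symp_add_right, symp_sub_right, symp_lw_lw, h]

theorem symp_lw_flog (i : Fin 2) {m n : ZMod 2} (h : m = n) : symp (P.lw i m n) P.flog = 0 := by
  simp [flog, symp_smul_right, symp_add_right, symp_sub_right, symp_lw_lw, h]

/-- The monomial in a numerator is -q w_1 G, so that the sum with G becomes (1 - q w_1) G. -/
theorem num_G (k : ℤ) {m n : ZMod 2} (h : k = -2 ∧ m = 1 ∧ n = 0 ∨ k = 2 ∧ m = 0 ∧ n = 1) :
    P.pt.p⁻¹ * P.a 1 ^ k * P.pt.t = scal (-P.qpow 1) * (P.w 1 m n * P.G) := by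
  rw [pt_p_eq_wmon, pt_t, a_eq_wmon, w_eq_wmon, G_eq_wmon, wmon_zpow, wmon_inv, wmon_mul,
    wmon_mul, wmon_mul, scal_mul_wmon]
  · refine P.wmon_congr (by simp [ascal, mul_comm (P.qpow 1), mul_assoc]) ?_
    rcases h with ⟨rfl, rfl, rfl⟩ | ⟨rfl, rfl, rfl⟩ <;>
      simp only [alog, tlog, ulog, glog, Matrix.cons_val] <;> push_cast <;> module
  · exact P.symp_lw_glog 1 (by rcases h with ⟨-, rfl, rfl⟩ | ⟨-, rfl, rfl⟩ <;> decide)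
  · rw [symp_add_left, symp_neg_left, symp_smul_left, symp_p, symp_alog_tlog]; simp
  · rw [symp_neg_left, symp_p, neg_zero]

/-- With v the monomial of the denominator, G = -q⁻¹ v w_0, so that G + v = v (1 - q⁻¹ w_0). -/
theorem den_G (k : ℤ) {m n : ZMod 2} (h : k = -2 ∧ m = 0 ∧ n = 1 ∨ k = 2 ∧ m = 1 ∧ n = 0) :
    P.G = scal (-P.qpow (-1)) * (P.pt.p * P.a 0 ^ k * P.pt.t⁻¹ * P.w 0 m n) := by
  rw [pt_p_eq_wmon, pt_t, a_eq_wmon, w_eq_wmon, G_eq_wmon, wmon_zpow, wmon_inv, wmon_mul,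
    wmon_mul, wmon_mul, scal_mul_wmon]
  · refine P.wmon_congr (by simp [ascal, qpow_neg]) ?_
    rcases h with ⟨rfl, rfl, rfl⟩ | ⟨rfl, rfl, rfl⟩ <;>
      simp only [alog, tlog, ulog, glog, Matrix.cons_val] <;> push_cast <;> module
  · rw [symp_add_left, symp_add_left, symp_neg_left, symp_smul_left, symp_p, symp_alog_lw]
    simp [symp_tlog_lw]
  · rw [symp_add_left, symp_smul_left, symp_p, symp_neg_right, symp_alog_tlog]; simp
  · rw [symp_p]

theorem num_F (k : ℤ) {m : ZMod 2} (h : k = 2 ∧ m = 0 ∨ k = -2 ∧ m = 1) :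
    P.a 4 ^ k * P.pt.t = scal (-P.qpow 1) * (P.w 1 m m * P.F) := by
  rw [pt_t, a_eq_wmon, w_eq_wmon, F_eq_wmon, wmon_zpow, wmon_mul, wmon_mul, scal_mul_wmon]
  · refine P.wmon_congr (by simp [ascal, mul_comm (P.qpow 1), mul_assoc]) ?_
    rcases h with ⟨rfl, rfl⟩ | ⟨rfl, rfl⟩ <;>
      simp only [alog, tlog, flog, Matrix.cons_val] <;> push_cast <;> module
  · exact P.symp_lw_flog 1 rfl
  · rw [symp_smul_left, symp_alog_tlog, mul_zero]

theorem den_F (k : ℤ) {m : ZMod 2} (h : k = 2 ∧ m = 1 ∨ k = -2 ∧ m = 0) :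
    P.F = scal (-P.qpow (-1)) * (P.a 5 ^ k * P.pt.t⁻¹ * P.w 0 m m) := by
  rw [pt_t, a_eq_wmon, w_eq_wmon, F_eq_wmon, wmon_zpow, wmon_inv, wmon_mul, wmon_mul,
    scal_mul_wmon]
  · refine P.wmon_congr (by simp [ascal, qpow_neg]) ?_
    rcases h with ⟨rfl, rfl⟩ | ⟨rfl, rfl⟩ <;>
      simp only [alog, tlog, flog, Matrix.cons_val] <;> push_cast <;> module
  · rw [symp_add_left, symp_neg_left, symp_smul_left, symp_alog_lw]
    simp [symp_tlog_lw]
  · rw [symp_smul_left, symp_neg_right, symp_alog_tlog]; simp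

theorem w_commute_w (i : Fin 2) {m n : ZMod 2} (j : Fin 2) {m' n' : ZMod 2}
    (h : m = n ↔ m' = n') : Commute (P.w i m n) (P.w j m' n') := by
  rw [w_eq_wmon, w_eq_wmon]
  exact P.wmon_commute (by simp [symp_lw_lw, h])

theorem wFactor_commute_wFactor (r r' : ℂ) (i : Fin 2) {m n : ZMod 2} (j : Fin 2)
    {m' n' : ZMod 2} (h : m = n ↔ m' = n') :
    Commute (P.wFactor r i m n) (P.wFactor r' j m' n') :=
  P.commute_wFactor (P.commute_wFactor (P.w_commute_w j i h.symm) r).symm r'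

theorem G_commute_wFactor (r : ℂ) (i : Fin 2) {m n : ZMod 2} (h : m ≠ n) :
    Commute P.G (P.wFactor r i m n) := by
  refine P.commute_wFactor ?_ r
  rw [w_eq_wmon, G_eq_wmon]
  exact (P.wmon_commute (P.symp_lw_glog i h)).symm

theorem F_commute_wFactor (r : ℂ) (i : Fin 2) (m : ZMod 2) :
    Commute P.F (P.wFactor r i m m) := by
  refine P.commute_wFactor ?_ r
  rw [w_eq_wmon, F_eq_wmon]
  exact (P.wmon_commute (P.symp_lw_flog i rfl)).symm

theorem pt_p_commute {U : Opˣ} (h : ∀ j, Commute (P.a j) U) : Commute P.pt.p U :=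
  (((((h 0).mul_left (h 1)).mul_left ((h 2).pow_left 2)).mul_left ((h 3).pow_left 2)).mul_left
    (h 4)).mul_left (h 5)

theorem pt_t_commute {U : Opˣ} (h : ∀ j, Commute (P.a j) U) : Commute P.pt.t U :=
  (((h 3).pow_left 2).mul_left (h 4)).mul_left (h 5)

/-- The monomials of the denominators are central. -/
theorem den_commute {U : Opˣ} (h : ∀ j, Commute (P.a j) U) (k : ℤ) :
    Commute (P.pt.p * P.a 0 ^ k * P.pt.t⁻¹) U ∧ Commute (P.a 5 ^ k * P.pt.t⁻¹) U :=
  ⟨((P.pt_p_commute h).mul_left ((h 0).zpow_left k)).mul_left (P.pt_t_commute h).inv_left,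
    ((h 5).zpow_left k).mul_left (P.pt_t_commute h).inv_left⟩

theorem a_commute_wFactor (j : Fin 6) (r : ℂ) (i : Fin 2) (m n : ZMod 2) :
    Commute (P.a j) (P.wFactor r i m n) := P.commute_wFactor (P.a_commute_w j i m n) r

theorem a_commute_p (j : Fin 6) : Commute (P.a j) P.pt.p :=
  (P.pt_p_commute fun k => P.a_commute_a k j).symm

theorem a_commute_t (j : Fin 6) : Commute (P.a j) P.pt.t :=
  (P.pt_t_commute fun k => P.a_commute_a k j).symm

theorem H_conj_wmon {z : ℂˣ} {X : LogMonom} :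
    P.H⁻¹ * P.wmon z X * P.H = scal z * (P.H⁻¹ * P.wexp X * P.H) := by
  rw [wmon, ← mul_assoc, (commute_scal z P.H⁻¹).eq]
  simp only [mul_assoc]

theorem H_conj_inv_wmon {z : ℂˣ} {X : LogMonom} :
    P.H * P.wmon z X * P.H⁻¹ = scal z * (P.H * P.wexp X * P.H⁻¹) := by
  rw [wmon, ← mul_assoc, (commute_scal z P.H).eq]
  simp only [mul_assoc]

/-- By `flog_add_shearTot` the sheared logarithm is that of G² F⁻¹. Reordering G² F⁻¹ into one
exponential costs q², half of the symplectic pairing 4; this gives the q⁻² in the equation for F. -/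
theorem leading_F : P.wmon (-(P.qpow 1)⁻¹) (P.flog + P.shearTot P.flog) =
    scal ((P.qpow 1)⁻¹ ^ 2) * (P.G ^ 2 * P.F⁻¹) := by
  have h : symp (((2 : ℕ) : ℚ) • P.glog) (-P.flog) / 2 = 2 := by
    rw [symp_smul_left, symp_neg_right, symp_swap, symp_flog_glog]; norm_num
  rw [flog_add_shearTot, G_eq_wmon, F_eq_wmon, wmon_pow, wmon_inv, wmon, wmon, wmon,
    scal_mul_mul_scal_mul, wexp_mul, h, ← mul_assoc, ← mul_assoc, ← scal_mul, ← scal_mul, qpow_two]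
  congr 2
  · ext
    push_cast
    field_simp
  · push_cast; module

theorem leading_G : P.wmon (-(P.qpow 1)⁻¹) (P.glog - P.shearTot P.glog) =
    scal ((P.qpow 1)⁻¹ ^ 2) * (P.G⁻¹ * P.F ^ 2) := by
  have h : symp (-P.glog) (((2 : ℕ) : ℚ) • P.flog) / 2 = 2 := by
    rw [symp_smul_right, symp_neg_left, symp_swap, symp_flog_glog]; norm_num
  rw [glog_sub_shearTot, G_eq_wmon, F_eq_wmon, wmon_pow, wmon_inv, wmon, wmon, wmon,
    scal_mul_mul_scal_mul, wexp_mul, h, ← mul_assoc, ← mul_assoc, ← scal_mul, ← scal_mul, qpow_two]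
  congr 2
  · ext
    push_cast
    field_simp
  · push_cast; module

end QLattice.Params

theorem Commute.mul_zpow_mul_eq_sq {G : Type*} [Group G] {p c t : G} (hpt : Commute p t)
    (hp : Commute c p) (ht : Commute c t) :
    p * c ^ (-2 : ℤ) * t⁻¹ * (p * c ^ (2 : ℤ) * t⁻¹) = p ^ 2 * t⁻¹ ^ 2 := by
  have h₁ : Commute (c ^ (-2 : ℤ)) (t⁻¹ * p) := (ht.inv_right.mul_right hp).zpow_left _
  calc p * c ^ (-2 : ℤ) * t⁻¹ * (p * c ^ (2 : ℤ) * t⁻¹)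
      = p * (c ^ (-2 : ℤ) * (t⁻¹ * p)) * c ^ (2 : ℤ) * t⁻¹ := by simp only [mul_assoc]
    _ = p * (t⁻¹ * p) * (c ^ (-2 : ℤ) * c ^ (2 : ℤ)) * t⁻¹ := by
      rw [h₁.eq]; simp only [mul_assoc]
    _ = p ^ 2 * t⁻¹ ^ 2 := by
      rw [← zpow_add, neg_add_cancel, zpow_zero, mul_one, ← hpt.inv_right.eq, sq, sq]
      simp only [mul_assoc]

/-! ### The lattice equations and the identification with T_3 -/

namespace QLattice.Params

open QLattice QWeyl

variable (P : Params)

theorem H_conj_F :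
    P.H⁻¹ * P.F * P.H = scal ((P.qpow 1)⁻¹ ^ 2) * (P.pt.p ^ 2 * P.pt.t⁻¹ ^ 2 *
      (P.wFactor 1 1 1 0 * P.G * (P.pt.p * P.a 0 ^ (-2 : ℤ) * P.pt.t⁻¹ * P.wFactor (-1) 0 0 1)⁻¹) *
      (P.wFactor 1 1 0 1 * P.G * (P.pt.p * P.a 0 ^ (2 : ℤ) * P.pt.t⁻¹ * P.wFactor (-1) 0 1 0)⁻¹) *
      P.F⁻¹) := by
  have hw := fun k i m n => P.den_commute (fun j => P.a_commute_wFactor j k i m n)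
  have hG := P.den_commute P.a_commute_G
  have hv : Commute (P.pt.p * P.a 0 ^ (-2 : ℤ) * P.pt.t⁻¹) (P.pt.p * P.a 0 ^ (2 : ℤ) * P.pt.t⁻¹) :=
    (P.den_commute (fun j => ((P.a_commute_p j).mul_right
      ((P.a_commute_a j 0).zpow_right 2)).mul_right (P.a_commute_t j).inv_right) _).1
  have hvv : P.pt.p * P.a 0 ^ (-2 : ℤ) * P.pt.t⁻¹ * (P.pt.p * P.a 0 ^ (2 : ℤ) * P.pt.t⁻¹) =
      P.pt.p ^ 2 * P.pt.t⁻¹ ^ 2 :=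
     Commute.mul_zpow_mul_eq_sq (P.pt_p_commute P.a_commute_t) (P.a_commute_p 0)
      (P.a_commute_t 0)
  have key := Commute.ratio_product_left (g := P.G) (n₁ := P.wFactor 1 1 1 0)
    (m₁ := P.wFactor (-1) 0 0 1) (n₂ := P.wFactor 1 1 0 1) (m₂ := P.wFactor (-1) 0 1 0)
    (v₁ := P.pt.p * P.a 0 ^ (-2 : ℤ) * P.pt.t⁻¹) (v₂ := P.pt.p * P.a 0 ^ (2 : ℤ) * P.pt.t⁻¹)
    (by
      simp only [List.mem_cons, List.not_mem_nil, or_false, forall_eq_or_imp, forall_eq]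
      exact ⟨(hG _).1, (hw _ _ _ _ _).1, (hw _ _ _ _ _).1, hv⟩)
    (by
      simp only [List.mem_cons, List.not_mem_nil, or_false, forall_eq_or_imp, forall_eq]
      exact ⟨(hG _).1, (hw _ _ _ _ _).1, (hw _ _ _ _ _).1, (hw _ _ _ _ _).1, (hw _ _ _ _ _).1⟩)
    (by
      simp only [List.mem_cons, List.not_mem_nil, or_false, forall_eq_or_imp, forall_eq]
      exact ⟨P.G_commute_wFactor _ _ zero_ne_one, P.G_commute_wFactor _ _ zero_ne_one,
        P.G_commute_wFactor _ _ one_ne_zero⟩)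
    (P.wFactor_commute_wFactor _ _ _ _ (by decide))
    (P.wFactor_commute_wFactor _ _ _ _ (by decide))
    (P.wFactor_commute_wFactor _ _ _ _ (by decide))
  -- The prefactor p² t⁻² is the product of the monomials of the two denominators: the opposite
  -- powers of a_0 cancel.
  rw [← hvv, key]
  nth_rw 1 [F_eq_wmon]
  rw [H_conj_wmon, H_conj_wexp_flog, ← mul_assoc (P.wFactor 1 1 0 1 * _), ← mul_assoc (scal _),
    (scal_commute (-(P.qpow 1)⁻¹) _).eq, mul_assoc, ← wmon, leading_F, ← mul_assoc,
    (commute_scal _ _).eq]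
  simp only [mul_assoc]

theorem H_conj_inv_G :
    P.H * P.G * P.H⁻¹ = scal ((P.qpow 1)⁻¹ ^ 2) * (P.pt.t⁻¹ ^ 2 * P.G⁻¹ *
      (P.wFactor 1 1 0 0 * P.F * (P.a 5 ^ (2 : ℤ) * P.pt.t⁻¹ * P.wFactor (-1) 0 1 1)⁻¹) *
      (P.wFactor 1 1 1 1 * P.F * (P.a 5 ^ (-2 : ℤ) * P.pt.t⁻¹ * P.wFactor (-1) 0 0 0)⁻¹)) := by
  have hw := fun k i m n => P.den_commute (fun j => P.a_commute_wFactor j k i m n)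
  have hF := P.den_commute P.a_commute_F
  have hv : Commute (P.a 5 ^ (2 : ℤ) * P.pt.t⁻¹) (P.a 5 ^ (-2 : ℤ) * P.pt.t⁻¹) :=
    (P.den_commute (fun j => ((P.a_commute_a j 5).zpow_right (-2)).mul_right
      (P.a_commute_t j).inv_right) _).2
  have hvv : P.a 5 ^ (2 : ℤ) * P.pt.t⁻¹ * (P.a 5 ^ (-2 : ℤ) * P.pt.t⁻¹) = P.pt.t⁻¹ ^ 2 := by
    rw [mul_assoc, ← mul_assoc P.pt.t⁻¹, ((P.a_commute_t 5).inv_right.zpow_left (-2)).eq.symm,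
      mul_assoc, ← mul_assoc, ← zpow_add, add_neg_cancel, zpow_zero, one_mul, sq]
  have key := Commute.ratio_product_left (g := P.F) (n₁ := P.wFactor 1 1 0 0)
    (m₁ := P.wFactor (-1) 0 1 1) (n₂ := P.wFactor 1 1 1 1) (m₂ := P.wFactor (-1) 0 0 0)
    (v₁ := P.a 5 ^ (2 : ℤ) * P.pt.t⁻¹) (v₂ := P.a 5 ^ (-2 : ℤ) * P.pt.t⁻¹)
    (by
      simp only [List.mem_cons, List.not_mem_nil, or_false, forall_eq_or_imp, forall_eq]
      exact ⟨(hF _).2, (hw _ _ _ _ _).2, (hw _ _ _ _ _).2, hv⟩)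
    (by
      simp only [List.mem_cons, List.not_mem_nil, or_false, forall_eq_or_imp, forall_eq]
      exact ⟨(hF _).2, (hw _ _ _ _ _).2, (hw _ _ _ _ _).2, (hw _ _ _ _ _).2, (hw _ _ _ _ _).2⟩)
    (by
      simp only [List.mem_cons, List.not_mem_nil, or_false, forall_eq_or_imp, forall_eq]
      exact ⟨P.F_commute_wFactor _ _ _, P.F_commute_wFactor _ _ _, P.F_commute_wFactor _ _ _⟩)
    (P.wFactor_commute_wFactor _ _ _ _ (by decide))
    (P.wFactor_commute_wFactor _ _ _ _ (by decide))
    (P.wFactor_commute_wFactor _ _ _ _ (by decide))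
  have ht : Commute (P.pt.t⁻¹ ^ 2) P.G⁻¹ :=
    ((P.pt_t_commute P.a_commute_G).inv_left.pow_left 2).inv_right
  -- The evolution yields the factors to the right of F², the equation to the left; F commutes with
  -- the diagonal w_i.
  have hd : ∀ r, P.F ^ 2 * (P.wFactor 1 1 1 1 * (P.wFactor (-1) 0 1 1)⁻¹ *
      (P.wFactor 1 1 0 0 * (P.wFactor (-1) 0 0 0)⁻¹)) * r = (P.wFactor 1 1 1 1 *
      (P.wFactor (-1) 0 1 1)⁻¹ * (P.wFactor 1 1 0 0 * (P.wFactor (-1) 0 0 0)⁻¹)) * P.F ^ 2 * r :=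
    fun r => by
      congr 1
      exact ((((P.F_commute_wFactor 1 1 1).mul_right (P.F_commute_wFactor (-1) 0 1).inv_right)
        ).mul_right ((P.F_commute_wFactor 1 1 0).mul_right
          (P.F_commute_wFactor (-1) 0 0).inv_right)).pow_left 2
  rw [ht.eq, ← hvv, mul_assoc P.G⁻¹, mul_assoc P.G⁻¹, key]
  have hd' := hd 1
  rw [mul_one, mul_one] at hd'
  rw [← hd']
  nth_rw 1 [G_eq_wmon]
  rw [H_conj_inv_wmon, H_conj_inv_wexp_glog, mul_assoc (P.wexp _), ← mul_assoc (scal _), ← wmon,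
    leading_G]
  simp only [mul_assoc]

/-- The multipliers of the `a_j` under the time evolution. -/
theorem H_conj_a (j : Fin 6) : P.H⁻¹ * P.a j * P.H =
    scal (P.qpow (![0, 0, -P.ctot / 4, P.ctot / 4, 0, 0] j)) * P.a j := by
  have h : P.shearTot (P.alog j) = (0, 0, ![0, 0, -P.ctot / 4, P.ctot / 4, 0, 0] j) := by
    rw [shearTot_alog]
    fin_cases j <;> rfl
  rw [a_eq_wmon, H_conj_wmon, H_conj_wexp_alog, h, ← P.wexp_mul_of_symp_eq_zero, wexp_scalar, wmon,
    ← mul_assoc, ← (scal_commute _ _).eq]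
  simp [symp]

theorem H_conj_scal (z : ℂˣ) : P.H⁻¹ * scal z * P.H = scal z := by
  rw [(commute_scal z P.H⁻¹).eq, inv_mul_cancel_right]

theorem H_conj_a_of_ne {j : Fin 6} (h₂ : j ≠ 2) (h₃ : j ≠ 3) : P.H⁻¹ * P.a j * P.H = P.a j := by
  have : (![0, 0, -P.ctot / 4, P.ctot / 4, 0, 0] j : ℂ) = 0 := by
    fin_cases j <;> first | rfl | exact absurd rfl h₂ | exact absurd rfl h₃
  rw [H_conj_a, this, qpow_zero, scal_one, one_mul]

theorem H_conj_a_three : P.H⁻¹ * P.a 3 * P.H = P.pt.p⁻¹ * P.a 3 := by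
  rw [H_conj_a, pt_p, ← scal_inv, ← qpow_neg, neg_div, neg_neg]
  rfl

theorem H_conj_t : P.H⁻¹ * P.pt.t * P.H = P.pt.p⁻¹ ^ 2 * P.pt.t := by
  calc P.H⁻¹ * P.pt.t * P.H = (P.H⁻¹ * P.a 3 * P.H) ^ 2 * (P.H⁻¹ * P.a 4 * P.H) *
        (P.H⁻¹ * P.a 5 * P.H) := by
        change P.H⁻¹ * (P.a 3 ^ 2 * P.a 4 * P.a 5) * P.H = _
        simp only [sq]
        group
    _ = P.pt.p⁻¹ ^ 2 * P.pt.t := by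
        rw [H_conj_a_three, P.H_conj_a_of_ne (j := 4) (by decide) (by decide),
          P.H_conj_a_of_ne (j := 5) (by decide) (by decide), ((P.a_commute_p 3).inv_right.symm).mul_pow,
          mul_assoc, mul_assoc]
        change _ = P.pt.p⁻¹ ^ 2 * (P.a 3 ^ 2 * P.a 4 * P.a 5)
        rw [mul_assoc (P.a 3 ^ 2)]

/-- The operator is t⁴, and t is multiplied by p⁻² = q^{c/2}. -/
theorem T_Del : P.T ↑(P.Del 0 0 * P.Del 1 1) =
    ↑(scal (P.qpow (2 * P.ctot)) * (P.Del 0 0 * P.Del 1 1)) := by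
  have hp : P.pt.p⁻¹ ^ 2 = scal (P.qpow (P.ctot / 2)) := by
    rw [pt_p, ← scal_inv, ← qpow_neg, sq, ← scal_mul, ← qpow_add]
    congr 2; ring
  have h : P.H⁻¹ * P.pt.t ^ 4 * P.H = (P.H⁻¹ * P.pt.t * P.H) ^ 4 := by
    simp only [pow_succ, pow_zero]
    group
  rw [← pt_t_pow, T_coe, h, H_conj_t, hp, (scal_commute _ _).mul_pow, ← scal_pow]
  congr 3
  simp only [pow_succ, pow_zero, one_mul, ← qpow_add]
  congr 1; ring

theorem coe_scal_inv_q_sq_mul (U : Opˣ) :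
    ((scal ((P.qpow 1)⁻¹ ^ 2) * U : Opˣ) : Op) = (P.q ^ 2)⁻¹ • (U : Op) := by
  rw [coe_scal_mul]
  congr 1
  rw [inv_pow, Units.val_inv_eq_inv_val, Units.val_pow_eq_pow_val, qpow_one]

theorem num_coe {N W G u : Opˣ} {z : ℂˣ} (hN : (N : Op) = 1 - (z : ℂ) • (W : Op))
    (hu : u = scal (-z) * (W * G)) : (G : Op) + u = ((N * G : Opˣ) : Op) := by
  refine add_eq_units_mul (D := Op) hN ?_
  rw [hu, coe_scal_mul]
  rfl

theorem den_coe {N W G v : Opˣ} {z : ℂˣ} (hN : (N : Op) = 1 - (z : ℂ) • (W : Op))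
    (hG : G = scal (-z) * (v * W)) : (G : Op) + v = ((v * N : Opˣ) : Op) := by
  refine add_eq_mul_units (D := Op) (z := z) (W := W) hN ?_
  conv_lhs => rw [hG, coe_scal_mul]
  rfl

theorem T_coe_eq {A B : Opˣ} (h : P.H⁻¹ * A * P.H = B) : P.T (A : Op) = (B : Op) := by
  rw [T_coe, h]

theorem T_symm_coe_eq {A B : Opˣ} (h : P.H * A * P.H⁻¹ = B) : P.T.symm (A : Op) = (B : Op) := by
  rw [T_symm_coe, h]

theorem H_conj_p : P.H⁻¹ * P.pt.p * P.H = P.pt.p := by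
  rw [pt_p, H_conj_scal]

/-- The factors of the lattice equations. -/
def factors : Pt.Factors P.pt :=
  Pt.Factors.mk' (F := P.F) (G := P.G) rfl rfl
    (P.num_G (-2) (by simp)) (num_coe (P.coe_wFactor 1 1 1 0) rfl)
    (rfl : _ = P.pt.p * P.a 0 ^ (-2 : ℤ) * P.pt.t⁻¹)
    (den_coe (P.coe_wFactor (-1) 0 0 1) (P.den_G (-2) (by simp)))
    (P.num_G 2 (by simp)) (num_coe (P.coe_wFactor 1 1 0 1) rfl)
    (rfl : _ = P.pt.p * P.a 0 ^ (2 : ℤ) * P.pt.t⁻¹)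
    (den_coe (P.coe_wFactor (-1) 0 1 0) (P.den_G 2 (by simp)))
    (P.num_F 2 (by simp)) (num_coe (P.coe_wFactor 1 1 0 0) rfl)
    (rfl : _ = P.a 5 ^ (2 : ℤ) * P.pt.t⁻¹)
    (den_coe (P.coe_wFactor (-1) 0 1 1) (P.den_F 2 (by simp)))
    (P.num_F (-2) (by simp)) (num_coe (P.coe_wFactor 1 1 1 1) rfl)
    (rfl : _ = P.a 5 ^ (-2 : ℤ) * P.pt.t⁻¹)
    (den_coe (P.coe_wFactor (-1) 0 0 0) (P.den_F (-2) (by simp)))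

theorem factors_M : P.factors.M = P.pt.p ^ 2 * P.pt.t⁻¹ ^ 2 *
      (P.wFactor 1 1 1 0 * P.G * (P.pt.p * P.a 0 ^ (-2 : ℤ) * P.pt.t⁻¹ * P.wFactor (-1) 0 0 1)⁻¹) *
      (P.wFactor 1 1 0 1 * P.G * (P.pt.p * P.a 0 ^ (2 : ℤ) * P.pt.t⁻¹ * P.wFactor (-1) 0 1 0)⁻¹) *
      P.F⁻¹ := rfl

theorem factors_N : P.factors.N = P.pt.t⁻¹ ^ 2 * P.G⁻¹ *
      (P.wFactor 1 1 0 0 * P.F * (P.a 5 ^ (2 : ℤ) * P.pt.t⁻¹ * P.wFactor (-1) 0 1 1)⁻¹) *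
      (P.wFactor 1 1 1 1 * P.F * (P.a 5 ^ (-2 : ℤ) * P.pt.t⁻¹ * P.wFactor (-1) 0 0 0)⁻¹) := rfl

theorem factors_F : P.factors.F = P.F := rfl

theorem factors_G : P.factors.G = P.G := rfl

theorem T_F : P.T (P.factors.F : Op) = (P.q ^ 2)⁻¹ • (P.factors.M : Op) := by
  rw [factors_F, factors_M]
  exact (P.T_coe_eq P.H_conj_F).trans (P.coe_scal_inv_q_sq_mul _)

theorem T_symm_G : P.T.symm (P.factors.G : Op) = (P.q ^ 2)⁻¹ • (P.factors.N : Op) := by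
  rw [factors_G, factors_N]
  exact (P.T_symm_coe_eq P.H_conj_inv_G).trans (P.coe_scal_inv_q_sq_mul _)

theorem isQPVI : IsQPVI P.q P.T P.pt :=
  IsQPVI.of_factors P.factors (fun _ h₂ h₃ => P.T_coe_eq (P.H_conj_a_of_ne h₂ h₃))
    (P.T_coe_eq P.H_conj_p) (P.T_coe_eq P.H_conj_t) P.T_F P.T_symm_G

theorem relations : Relations P.q P.pt where
  aa := P.a_commute_a
  aF j := congrArg Units.val (P.a_commute_F j)
  aG j := congrArg Units.val (P.a_commute_G j)
  FG := by
    refine (congrArg Units.val P.F_mul_G).trans ((coe_scal_mul _ _).trans ?_)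
    have : (P.qpow 2 : ℂ) = P.q ^ 2 := by rw [qpow_two, Units.val_pow_eq_pow_val, qpow_one]
    rw [this]
    rfl

theorem q_sq_ne_one : P.q ^ 2 ≠ 1 := fun h =>
  P.q_sub_inv_ne_zero (sub_eq_zero.2 (eq_inv_of_mul_eq_one_left (by rw [← sq, h])))

theorem map_T_a (j : Fin 6) : (P.pt.map P.T).a j = P.H⁻¹ * P.a j * P.H :=
  Units.ext (P.T_coe (P.a j))

theorem H_conj_a_two : P.H⁻¹ * P.a 2 * P.H = P.pt.p * P.a 2 := by
  rw [H_conj_a, pt_p]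
  rfl

/-- Only a_2 and a_3 move, by the factors p and p⁻¹. Reading the scalar p as a monomial in the a_j
gives rows 2 and 3 of `T3Exp`. -/
theorem map_T_hasExp {m : Pt.MonomialHom Op} (h : Pt.HasExp m P.pt Pt.genExp) :
    Pt.HasExp m (P.pt.map P.T) Pt.T3Exp := by
  have hp := h.p rfl
  intro j
  rw [map_T_a]
  by_cases h₂ : j = 2
  · subst h₂
    refine P.H_conj_a_two.trans ((congrArg₂ (· * ·) hp (h 2)).trans
      ((_root_.map_mul m _ _).symm.trans
      (congrArg m ?_)))
    decide
  by_cases h₃ : j = 3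
  · subst h₃
    refine P.H_conj_a_three.trans ((congrArg₂ (· * ·) ((congrArg (·⁻¹) hp).trans (map_inv m _).symm)
      (h 3)).trans ((_root_.map_mul m _ _).symm.trans (congrArg m ?_)))
    decide
  refine (P.H_conj_a_of_ne h₂ h₃).trans ((h j).trans (congrArg (fun e => m (.ofAdd e)) ?_))
  revert j
  decide

theorem map_T_eq : P.pt.map P.T = P.pt.T3 P.q ∧ P.pt.map P.T.symm = P.pt.T3inv P.q := by
  obtain ⟨m, h, hm⟩ := Pt.exists_hasExp P.relations
  exact P.factors.map_eq_T3 P.q_ne_zero P.relations.FG h (hm _ P.relations.aF)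
    (hm _ P.relations.aG) (P.map_T_hasExp h) P.T_F P.T_symm_G

end QLattice.Params

end

theorem theorem2 (P : QLattice.Params) :
    -- `-q F`, `-q G` and the `a_j` are the stated fourth roots
    ((QLattice.scal (-P.qpow 1) * P.F) ^ 4 =
        P.w 0 1 1 * P.w 0 0 0 * (P.w 1 0 0 * P.w 1 1 1)⁻¹ ∧
      (QLattice.scal (-P.qpow 1) * P.G) ^ 4 =
        P.w 0 1 0 * P.w 0 0 1 * (P.w 1 0 1 * P.w 1 1 0)⁻¹ ∧
      P.a 0 ^ 4 = P.w 0 0 1 * (P.w 0 1 0)⁻¹ ∧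
      P.a 1 ^ 4 = P.w 1 0 1 * (P.w 1 1 0)⁻¹ ∧
      P.a 2 ^ 4 = (P.Del 0 1)⁻¹ ∧
      P.a 3 ^ 4 = P.Del 1 1 ∧
      P.a 4 ^ 4 = P.w 1 0 0 * (P.w 1 1 1)⁻¹ ∧
      P.a 5 ^ 4 = P.w 0 0 0 * (P.w 0 1 1)⁻¹) ∧
    -- the `a_j` commute with all observables
    (∀ j i m n, Commute (P.a j) (P.w i m n)) ∧
    -- `p` is the scalar `q^{-c/4}`, and `t` is the fourth root of `Δ(0^+0^-) Δ(1^+1^-)`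
    (P.pt.p = QLattice.scal (P.qpow (-P.ctot / 4)) ∧
      P.pt.t ^ 4 = P.Del 0 0 * P.Del 1 1 ∧
      P.T ↑(P.Del 0 0 * P.Del 1 1) =
        ↑(QLattice.scal (P.qpow (2 * P.ctot)) * (P.Del 0 0 * P.Del 1 1))) ∧
    -- the lattice dynamics is the quantized discrete Painlevé VI system
    (QWeyl.Relations P.q P.pt ∧ QWeyl.IsQPVI P.q P.T P.pt) ∧
    -- it coincides with the translation `T_3` of the Weyl group, evaluated at the lattice variables
    (QWeyl.Pt.map P.T P.pt = QWeyl.Pt.T3 P.q P.pt ∧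
      QWeyl.Pt.map P.T.symm P.pt = QWeyl.Pt.T3inv P.q P.pt) ∧
    -- and the automorphism `T_3` of a skew field obeys the same system
    (∀ (K : Type*) [DivisionRing K] [Algebra ℂ K] (x : QWeyl.Pt K)
        (s : Fin 6 → K ≃ₐ[ℂ] K) (σ : K ≃ₐ[ℂ] K),
      x.F ≠ 0 → x.G ≠ 0 → QWeyl.Relations P.q x →
      (∀ i, x.map (s i) = x.s i) → x.map σ = x.σ P.q →
      QWeyl.IsQPVI P.q (s 2 * s 1 * s 0 * s 2 * s 3 * s 4 * s 5 * s 3 * σ) x) := by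
  refine ⟨⟨P.fourth_root_F, P.fourth_root_G, P.fourth_root_a⟩, P.a_commute_w,
    ⟨P.pt_p, P.pt_t_pow, P.T_Del⟩, ⟨P.relations, P.isQPVI⟩, P.map_T_eq, ?_⟩
  intro K _ _ x s σ hF hG hx hs hσ
  obtain ⟨f⟩ := QWeyl.Pt.nonempty_factors hx P.q_ne_zero P.q_sq_ne_one hF hG
  exact f.isQPVI_of_reflections P.q_ne_zero hx hs hσ
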